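/- \textbf{Setting.} A network with $n$ processors is a connected graph on $n$ nodes with edge weights at least $1$; $d(u,v)$ is the weighted shortest-path distance. Communication is synchronous: a message sent over an edge of weight $w$ arrives exactly $w$ time units later. In the distributed serving with mobile servers (DSMS) problem, $k$ identical servers are initially at $k$ different nodes, each with a dummy request at its node, and requests are invoked at nodes one by one, each only after the previous one has been served. A (possibly randomized) online distributed protocol, in which each processor acts only on its own state, on its own random coins, on the messages it has received, and on the requests invoked at it and the servers that arrive at it, has to append every request to one of $k$ schedules (queues), each of which starts with the dummy request of one of the servers: the processor that invoked the last request of a schedule has to decide that a request, invoked at some node $v$, is the successor of that request, and it then sends the server of that schedule to $v$. The protocol solves DSMS if, almost surely, all its scheduling decisions are legal and every request is eventually scheduled. Its cost is the sum of the latencies (weights of the traversed edges) of all messages sent. An adaptive online adversary chooses each request, and the time at which it is invoked, knowing the protocol and its scheduling decisions so far, and serves each request at once with one of its own $k$ servers (with the same initial positions), paying the distance $d$ from the node of that server's previous request. The protocol is $\rho$-competitive against adaptive online adversaries if, for each initial placement, there is a constant $b$ such that for every such adversary and at all times the expected cost of the protocol is at most $\rho$ times the expected cost of the adversary plus $b$.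 \textbf{Theorem.} There is a universal constant $c>0$ such that for every $n\ge 1$ there is a network with $n$ processors with the following property. For every number of servers $1\le k<n$, every online distributed protocol that solves DSMS with $k$ servers on this network and is $\rho$-competitive against adaptive online adversaries, where communication is synchronous and requests are invoked one by one, satisfies $$\rho\;\ge\; c\cdot\max\Big\{k,\ \frac{\log n}{\log\log n}\Big\}$$ (for $n\le 2$ the second term, which is not positive or not defined, is ignored). In particular, no online distributed protocol for DSMS has competitive ratio $o(\max\{k,\log n/\log\log n\})$. -/

import Mathlib

open scoped ENNReal NNReal

/-- A point-to-point communication network with processors `Fin n`: a connected graph whose edges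
(bidirectional links) carry weights that are at least `1`.  The weights are integers, so that
synchronous communication proceeds in global pulses. -/
structure Network (n : ℕ) where
  graph : SimpleGraph (Fin n)
  connected : graph.Connected
  weight : Sym2 (Fin n) → ℕ
  one_le_weight : ∀ e ∈ graph.edgeSet, 1 ≤ weight e

/-- The weighted shortest-path distance between two processors. -/
noncomputable def Network.dist {n : ℕ} (N : Network n) (u v : Fin n) : ℕ :=
  sInf {L : ℕ | ∃ p : N.graph.Walk u v, L = (p.edges.map N.weight).sum}

/-- What a processor perceives at one pulse: for every processor `u`, the message (if any) that
arrives from `u`; whether a new request is invoked here; and which server (if any) arrives here. -/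
structure ProcInput (n k : ℕ) (Msg : Type) where
  inbox : Fin n → Option Msg
  request : Bool
  arrival : Option (Fin k)

/-- What a processor does at one pulse: for every neighbour `u`, it may send one message (of
unrestricted size) to `u`; and it may decide that the current request, invoked at `u`, is the
successor, in the schedule of server `z`, of the last request of that schedule
(`assign = some (z, u)`), upon which it sends server `z` to `u`. -/
structure ProcOutput (n k : ℕ) (Msg : Type) where
  outbox : Fin n → Option Msg
  assign : Option (Fin k × Fin n)

/-- A (randomized) synchronous distributed protocol for `k` servers on `n` processors.  The initial
states may depend on the initial placement of the servers.  At every pulse, every processor receives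
a fresh coin; the coin vectors of different pulses are independent and have the law `coinLaw`, which
may be any joint law (so independent private coins, shared coins and no coins at all are special
cases).  A processor acts on its own state, its own perceptions and its own coin only. -/
structure Protocol (n k : ℕ) where
  State : Type
  Msg : Type
  Coin : Type
  coinLaw : PMF (Fin n → Coin)
  init : (Fin k ↪ Fin n) → Fin n → State
  step : Fin n → State → ProcInput n k Msg → Coin → State × ProcOutput n k Msg

/-- The status of the most recent request: there is none that is not served (`idle`); the request
invoked at node `u` at time `t` has not been scheduled (`waiting u t`); it has been scheduled, and
server `z` reaches its node `u` at time `a` (`moving z u a`). -/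
inductive Status (n k : ℕ) where
  | idle : Status n k
  | waiting (u : Fin n) (t : ℕ) : Status n k
  | moving (z : Fin k) (u : Fin n) (a : ℕ) : Status n k

/-- What the adversary sees of the protocol at a pulse: for every server the node of the last
request of its schedule, and the status of the most recent request. -/
structure View (n k : ℕ) where
  tail : Fin k → Fin n
  status : Status n k

/-- An adaptive online adversary.  At each pulse, knowing what it has seen so far (latest view
first), it may invoke a request at a node `u` and serve it, at once, with its own server `z`
(`some (u, z)`). -/
abbrev Adversary (n k : ℕ) : Type := List (View n k) → Option (Fin n × Fin k)

/-- A global configuration of an execution, at the beginning of pulse `time`. -/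
structure Config {n k : ℕ} (P : Protocol n k) where
  time : ℕ
  /-- local states of the processors -/
  state : Fin n → P.State
  /-- `sent s u v` is the message that `u` sent to `v` at pulse `s` -/
  sent : ℕ → Fin n → Fin n → Option P.Msg
  /-- nodes of the last requests of the `k` schedules (initially, of the dummy requests) -/
  tail : Fin k → Fin n
  status : Status n k
  /-- whether an illegal scheduling decision has been taken -/
  faulty : Bool
  /-- total communication cost of the protocol so far -/
  cost : ℕ
  /-- the views of the adversary so far, latest first -/
  views : List (View n k)
  /-- positions of the servers of the adversary -/
  advPos : Fin k → Fin n
  /-- total cost of the adversary so far -/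
  advCost : ℕ

namespace Protocol

variable {n k : ℕ}

/-- The initial configuration: server `z` and its dummy request are at node `p z`. -/
def initConfig (P : Protocol n k) (p : Fin k ↪ Fin n) : Config P where
  time := 0
  state := P.init p
  sent := fun _ _ _ => none
  tail := p
  status := .idle
  faulty := false
  cost := 0
  views := []
  advPos := p
  advCost := 0

/-- The server (if any) that is at its destination at time `t`, with that destination. -/
def arrivalAt (t : ℕ) : Status n k → Option (Fin k × Fin n)
  | .moving z u a => if a ≤ t then some (z, u) else none
  | _ => none

/-- The status after the arrival (if any) at time `t`. -/
def afterArrival (t : ℕ) : Status n k → Status n k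
  | .moving z u a => if a ≤ t then .idle else .moving z u a
  | s => s

open scoped Classical in
/-- The effect of the scheduling decisions `d` of all processors at time `t` on the tails of the
schedules and on the status.  A decision is legal if it is the only one at this pulse, is about the
request that waits to be scheduled, names the node of that request, and is taken by the processor
that invoked the last request of the schedule in question.  The result is `none` if an illegal
decision is taken. -/
noncomputable def resolve (N : Network n) (t : ℕ) (tail : Fin k → Fin n) (status : Status n k)
    (d : Fin n → Option (Fin k × Fin n)) : Option ((Fin k → Fin n) × Status n k) :=
  match (List.finRange n).filterMap (fun v => (d v).map fun a => (v, a)) with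
  | [] => some (tail, status)
  | [(v, (z, u))] =>
      if (∃ s, status = .waiting u s) ∧ tail z = v then
        some (Function.update tail z u, .moving z u (t + N.dist v u))
      else none
  | _ => none

open scoped Classical in
/-- One pulse of an execution with the coins `ω`.  First a server may arrive, which completes the
service of the current request.  If then no request is pending, the adversary may invoke a new one.
A message sent over an edge arrives after a number of pulses equal to the weight of the edge, and
adds this weight to the cost of the protocol.  The adversary pays the distances over which it moves
its servers. -/
noncomputable def pulse (P : Protocol n k) (N : Network n) (A : Adversary n k) (c : Config P)
    (ω : Fin n → P.Coin) : Config P :=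
  let arr := arrivalAt c.time c.status
  let status₁ := afterArrival c.time c.status
  let views := (⟨c.tail, status₁⟩ : View n k) :: c.views
  let req : Option (Fin n × Fin k) := if status₁ = .idle then A views else none
  let status₂ : Status n k := match req with
    | some (u, _) => .waiting u c.time
    | none => status₁
  let advCost := match req with
    | some (u, z) => c.advCost + N.dist (c.advPos z) u
    | none => c.advCost
  let advPos := match req with
    | some (u, z) => Function.update c.advPos z u
    | none => c.advPos
  let input : Fin n → ProcInput n k P.Msg := fun v =>
    { inbox := fun u =>
        if N.graph.Adj u v ∧ N.weight s(u, v) ≤ c.time then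
          c.sent (c.time - N.weight s(u, v)) u v
        else none
      request := decide (∃ z, req = some (v, z))
      arrival := match arr with
        | some (z, u) => if u = v then some z else none
        | none => none }
  let result := fun v => P.step v (c.state v) (input v) (ω v)
  let out := fun v => (result v).2
  let resolved := resolve N c.time c.tail status₂ fun v => (out v).assign
  { time := c.time + 1
    state := fun v => (result v).1
    sent := Function.update c.sent c.time fun v u => (out v).outbox u
    tail := match resolved with
      | some r => r.1
      | none => c.tail
    status := match resolved with
      | some r => r.2
      | none => status₂
    faulty := c.faulty || resolved.isNone
    cost := c.cost + ∑ v, ∑ u,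
      if N.graph.Adj v u ∧ ((out v).outbox u).isSome then N.weight s(v, u) else 0
    views := views
    advPos := advPos
    advCost := advCost }

/-- The configuration reached from the placement `p` with a given list of coin vectors, one for
each pulse, the latest first. -/
noncomputable def run (P : Protocol n k) (N : Network n) (p : Fin k ↪ Fin n) (A : Adversary n k) :
    List (Fin n → P.Coin) → Config P
  | [] => P.initConfig p
  | ω :: l => P.pulse N A (P.run N p A l) ω

/-- The law of the coin vectors of the first `T` pulses. -/
noncomputable def coins (P : Protocol n k) : ℕ → PMF (List (Fin n → P.Coin))
  | 0 => PMF.pure []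
  | T + 1 => (P.coins T).bind fun l => P.coinLaw.map fun ω => ω :: l

/-- The expectation of a quantity that depends on the configuration after `T` pulses. -/
noncomputable def expect (P : Protocol n k) (N : Network n) (p : Fin k ↪ Fin n)
    (A : Adversary n k) (T : ℕ) (f : Config P → ℝ≥0∞) : ℝ≥0∞ :=
  ∑' l, P.coins T l * f (P.run N p A l)

/-- The protocol solves the problem on the network `N` when requests are invoked one by one:
almost surely, no illegal scheduling decision is ever taken, and every request is eventually
scheduled (and hence served): the probability that a request invoked by time `t` still waits
at time `T` tends to `0` as `T` tends to infinity. -/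
def Solves (P : Protocol n k) (N : Network n) : Prop :=
  ∀ (p : Fin k ↪ Fin n) (A : Adversary n k),
    (∀ T, ∀ l ∈ (P.coins T).support, (P.run N p A l).faulty = false) ∧
    ∀ t : ℕ, Filter.Tendsto
      (fun T => (P.coins T).toOuterMeasure
        {l | ∃ u s, s ≤ t ∧ (P.run N p A l).status = .waiting u s})
      Filter.atTop (nhds 0)

/-- The protocol is `ρ`-competitive on the network `N` against adaptive online adversaries that
invoke requests one by one: up to an additive constant that does not depend on the adversary,
its expected cost is at most `ρ` times the expected cost of the adversary. -/
def Competitive (P : Protocol n k) (N : Network n) (ρ : ℝ≥0) : Prop :=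
  ∀ p : Fin k ↪ Fin n, ∃ b : ℝ≥0, ∀ (A : Adversary n k) (T : ℕ),
    P.expect N p A T (fun c => (c.cost : ℝ≥0∞)) ≤
      (ρ : ℝ≥0∞) * P.expect N p A T (fun c => (c.advCost : ℝ≥0∞)) + (b : ℝ≥0∞)

end Protocol

/-!
The competitive ratio is bounded from below in two ways.

*By the number of servers.* On every network, `k ≤ 2 * ρ` (`servers_le_two_mul`). As for the
`k`-server problem, the adversary restricts itself to `k + 1` nodes and requests the one at which no
schedule ends. It can serve these requests by any of `k` offline algorithms, whose configurations
are the `k` ones that cover the last request; a request at `u` makes only one of them move a server,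
from the last request to `u`. So in total the `k` algorithms pay the distance between consecutive
requests. The protocol has to pay this distance as well: to schedule a request, a processor at the
end of some schedule must learn about it, and this is the processor at which the next request will
be invoked. The protocol does not notice which algorithm serves.

*By the search for a hidden centre.* The network `Network.withStar` consists of a graph `H` with
edges of weight `1`, without cycles of length at most `2 * m` (`SimpleGraph.DetourGE`), in which at
least half of the vertices have degree `32 * m ^ 2`, and of a star with edges of weight `m` that
makes the diameter at most `2 * m`. In a phase, the adversary makes `m` requests at neighbours of a
vertex `x`, and pays at most `4 * m` for them with a single server. The claim is that, for a suitable `x`, the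
protocol can be made to pay at least `m ^ 2 / 4` on average (`exists_phase`). To be served at a cost
below `m`, a request at `v` must reach a processor that is informed of the earlier requests of the
phase or is the end of a schedule at the beginning of the phase (`exists_mem_explored`). Until it
meets one, it explores the network as if there had been no earlier request, over fewer than `m`
edges, which are in `H`. For different neighbours `v` of `x`, the explored parts are disjoint since
`H` has no short cycles, unless they contain the edge to `x` (`SimpleGraph.card_hit_le`); and a
request explores less than `m` edges, so that it does this for few `x` on average
(`exists_centre`). The number of informed processors is at most the number of servers, requests
and messages so far (`card_informed_le`). If it is of order `m ^ 2`, the protocol has paid enough;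
otherwise most of the neighbours `v` explore no informed processor, and one of them is a good next
request (`exists_costly_request`). Iterating the phases gives `m ≤ 16 * ρ` if `k ≤ m`
(`le_sixteen_mul`).

In both parts, a request is made when the network is quiet, that is, when with high probability the
previous request has been served and no message would be sent any more without a new request. Such
times exist since the protocol solves the problem and its expected cost is bounded as long as the
adversary makes no further requests (`exists_quietTime`). Executions against different adversaries
are compared under the same coins; they agree at the processors that no message from a processor
at which they differ has reached (`agree_of_notMem`).

A graph `H` on `n` vertices as required exists if `n ≥ 2 * (32 * m ^ 2 + 1) ^ (2 * m)`
(`SimpleGraph.exists_detourGE`). For the largest such `m`, the quotient `log n / log (log n)` is at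
most of the order of `m + 1`. If `k ≤ m`, the second bound applies, and otherwise the first one is
at least as good.
-/

/-! ### Executions driven by a fixed sequence of coins -/

namespace Protocol

variable {n k : ℕ}

/-- The configuration at time `t` of the execution in which the coins of pulse `s` are `w s`. -/
noncomputable def conf (P : Protocol n k) (N : Network n) (p : Fin k ↪ Fin n) (A : Adversary n k)
    (w : ℕ → Fin n → P.Coin) : ℕ → Config P
  | 0 => P.initConfig p
  | t + 1 => P.pulse N A (P.conf N p A w t) (w t)

open scoped Classical in
/-- The request (with the serving adversary server) that is invoked at the pulse that starts in
configuration `c`. -/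
noncomputable def reqOf {P : Protocol n k} (A : Adversary n k) (c : Config P) :
    Option (Fin n × Fin k) :=
  if afterArrival c.time c.status = .idle then
    A (⟨c.tail, afterArrival c.time c.status⟩ :: c.views) else none

open scoped Classical in
/-- What processor `v` perceives at the pulse that starts in configuration `c`. -/
noncomputable def inputOf {P : Protocol n k} (N : Network n) (A : Adversary n k) (c : Config P)
    (v : Fin n) : ProcInput n k P.Msg where
  inbox := fun u =>
    if N.graph.Adj u v ∧ N.weight s(u, v) ≤ c.time then
      c.sent (c.time - N.weight s(u, v)) u v
    else none
  request := decide (∃ z, reqOf A c = some (v, z))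
  arrival := match arrivalAt c.time c.status with
    | some (z, u) => if u = v then some z else none
    | none => none

/-- The request invoked at time `t`. -/
noncomputable def reqAt (P : Protocol n k) (N : Network n) (p : Fin k ↪ Fin n) (A : Adversary n k)
    (w : ℕ → Fin n → P.Coin) (t : ℕ) : Option (Fin n × Fin k) :=
  reqOf A (P.conf N p A w t)

/-- What processor `v` perceives at time `t`. -/
noncomputable def inAt (P : Protocol n k) (N : Network n) (p : Fin k ↪ Fin n) (A : Adversary n k)
    (w : ℕ → Fin n → P.Coin) (t : ℕ) (v : Fin n) : ProcInput n k P.Msg :=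
  inputOf N A (P.conf N p A w t) v

/-- What processor `v` does at time `t`. -/
noncomputable def outAt (P : Protocol n k) (N : Network n) (p : Fin k ↪ Fin n) (A : Adversary n k)
    (w : ℕ → Fin n → P.Coin) (t : ℕ) (v : Fin n) : ProcOutput n k P.Msg :=
  (P.step v ((P.conf N p A w t).state v) (P.inAt N p A w t v) (w t v)).2

/-- The status at time `t` after the arrival and the invocation that may take place at this pulse,
before the scheduling decisions of the pulse. -/
noncomputable def midStatus (P : Protocol n k) (N : Network n) (p : Fin k ↪ Fin n)
    (A : Adversary n k) (w : ℕ → Fin n → P.Coin) (t : ℕ) : Status n k :=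
  match P.reqAt N p A w t with
    | some (u, _) => .waiting u t
    | none => afterArrival t (P.conf N p A w t).status

/-- Processor `u` sends a message to its neighbour `v` at time `t`. -/
def Sends (P : Protocol n k) (N : Network n) (p : Fin k ↪ Fin n) (A : Adversary n k)
    (w : ℕ → Fin n → P.Coin) (t : ℕ) (u v : Fin n) : Prop :=
  N.graph.Adj u v ∧ ((P.outAt N p A w t u).outbox v).isSome

variable (P : Protocol n k) (N : Network n) (p : Fin k ↪ Fin n) (A B : Adversary n k)
  (w : ℕ → Fin n → P.Coin)

@[simp] theorem conf_time (t : ℕ) : (P.conf N p A w t).time = t := by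
  induction t with
  | zero => rfl
  | succ t ih => change (P.conf N p A w t).time + 1 = t + 1; rw [ih]

theorem conf_views_succ (t : ℕ) : (P.conf N p A w (t + 1)).views =
    ⟨(P.conf N p A w t).tail, afterArrival t (P.conf N p A w t).status⟩ ::
      (P.conf N p A w t).views := by
  conv_rhs => rw [← conf_time P N p A w t]
  rw [conf_time P N p A w t]
  change (⟨(P.conf N p A w t).tail, afterArrival (P.conf N p A w t).time
    (P.conf N p A w t).status⟩ : View n k) :: _ = _
  rw [conf_time]

@[simp] theorem conf_views_length (t : ℕ) : (P.conf N p A w t).views.length = t := by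
  induction t with
  | zero => rfl
  | succ t ih => rw [conf_views_succ, List.length_cons, ih]

open scoped Classical in
theorem reqAt_eq (t : ℕ) : P.reqAt N p A w t =
    if afterArrival t (P.conf N p A w t).status = .idle then
      A (⟨(P.conf N p A w t).tail, afterArrival t (P.conf N p A w t).status⟩ ::
        (P.conf N p A w t).views) else none := by
  unfold reqAt reqOf
  rw [conf_time]

theorem conf_state_succ (t : ℕ) (v : Fin n) : (P.conf N p A w (t + 1)).state v =
    (P.step v ((P.conf N p A w t).state v) (P.inAt N p A w t v) (w t v)).1 := rfl

theorem conf_sent_succ (t : ℕ) : (P.conf N p A w (t + 1)).sent =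
    Function.update (P.conf N p A w t).sent t (fun v u => (P.outAt N p A w t v).outbox u) := by
  conv_rhs => arg 2; rw [← conf_time P N p A w t]
  rfl

theorem conf_sent (t s : ℕ) (u v : Fin n) : (P.conf N p A w t).sent s u v =
    if s < t then (P.outAt N p A w s u).outbox v else none := by
  induction t with
  | zero => rfl
  | succ t ih =>
    rw [conf_sent_succ]
    by_cases h : s = t
    · subst h; simp
    · rw [Function.update_of_ne h, ih]
      have : s < t + 1 ↔ s < t := by omega
      simp [this]

open scoped Classical in
theorem inAt_inbox (t : ℕ) (u v : Fin n) : (P.inAt N p A w t v).inbox u =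
    if N.graph.Adj u v ∧ N.weight s(u, v) ≤ t then
      (P.outAt N p A w (t - N.weight s(u, v)) u).outbox v else none := by
  unfold inAt inputOf
  simp only [conf_time]
  split_ifs with h
  · have : 1 ≤ N.weight s(u, v) := N.one_le_weight _ h.1
    rw [conf_sent, if_pos (by omega)]
  · rfl

open scoped Classical in
theorem inAt_request (t : ℕ) (v : Fin n) : (P.inAt N p A w t v).request =
    decide (∃ z, P.reqAt N p A w t = some (v, z)) := rfl

theorem inAt_arrival (t : ℕ) (v : Fin n) : (P.inAt N p A w t v).arrival =
    match arrivalAt t (P.conf N p A w t).status with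
    | some (z, u) => if u = v then some z else none
    | none => none := by
  unfold inAt inputOf
  simp only [conf_time]

open scoped Classical in
theorem conf_cost_succ (t : ℕ) : (P.conf N p A w (t + 1)).cost = (P.conf N p A w t).cost +
    ∑ v, ∑ u, if P.Sends N p A w t v u then N.weight s(v, u) else 0 := by
  change (P.conf N p A w t).cost + (∑ v, ∑ u, if N.graph.Adj v u ∧
    ((P.outAt N p A w t v).outbox u).isSome then N.weight s(v, u) else 0) = _
  congr 1
  refine Finset.sum_congr rfl fun v _ => Finset.sum_congr rfl fun u _ => ?_
  unfold Sends
  congr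

theorem conf_advCost_succ (t : ℕ) : (P.conf N p A w (t + 1)).advCost =
    match P.reqAt N p A w t with
    | some (u, z) => (P.conf N p A w t).advCost + N.dist ((P.conf N p A w t).advPos z) u
    | none => (P.conf N p A w t).advCost := rfl

theorem conf_advPos_succ (t : ℕ) : (P.conf N p A w (t + 1)).advPos =
    match P.reqAt N p A w t with
    | some (u, z) => Function.update (P.conf N p A w t).advPos z u
    | none => (P.conf N p A w t).advPos := rfl

theorem cost_mono : Monotone fun t => (P.conf N p A w t).cost :=
  monotone_nat_of_le_succ fun t => by rw [conf_cost_succ]; omega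

/-- The scheduling decisions taken at time `t`, resolved. -/
noncomputable def resolvedAt (t : ℕ) : Option ((Fin k → Fin n) × Status n k) :=
  resolve N t (P.conf N p A w t).tail (P.midStatus N p A w t)
    fun v => (P.outAt N p A w t v).assign

theorem conf_succ_resolved (t : ℕ) :
    (P.conf N p A w (t + 1)).tail = (match P.resolvedAt N p A w t with
      | some r => r.1
      | none => (P.conf N p A w t).tail) ∧
    (P.conf N p A w (t + 1)).status = (match P.resolvedAt N p A w t with
      | some r => r.2
      | none => P.midStatus N p A w t) ∧
    (P.conf N p A w (t + 1)).faulty =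
      ((P.conf N p A w t).faulty || (P.resolvedAt N p A w t).isNone) := by
  have e : P.resolvedAt N p A w t =
      resolve N (P.conf N p A w t).time (P.conf N p A w t).tail
        (match reqOf A (P.conf N p A w t) with
          | some (u, _) => .waiting u (P.conf N p A w t).time
          | none => afterArrival (P.conf N p A w t).time (P.conf N p A w t).status)
        fun v => (P.outAt N p A w t v).assign := by
    unfold resolvedAt midStatus
    rw [conf_time]
    rfl
  have e' : P.midStatus N p A w t = (match reqOf A (P.conf N p A w t) with
          | some (u, _) => .waiting u (P.conf N p A w t).time
          | none => afterArrival (P.conf N p A w t).time (P.conf N p A w t).status) := by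
    unfold midStatus
    rw [conf_time]
    rfl
  rw [e, e']
  exact ⟨rfl, rfl, rfl⟩

/-- The possible outcomes of a pulse without an illegal decision: no decision is taken, or exactly
one legal decision. -/
theorem pulse_cases {t : ℕ} (hf : (P.conf N p A w (t + 1)).faulty = false) :
    ((∀ v, (P.outAt N p A w t v).assign = none) ∧
      (P.conf N p A w (t + 1)).status = P.midStatus N p A w t ∧
      (P.conf N p A w (t + 1)).tail = (P.conf N p A w t).tail) ∨
    ∃ v z u s, (P.outAt N p A w t v).assign = some (z, u) ∧
      P.midStatus N p A w t = .waiting u s ∧ (P.conf N p A w t).tail z = v ∧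
      (P.conf N p A w (t + 1)).tail = Function.update (P.conf N p A w t).tail z u ∧
      (P.conf N p A w (t + 1)).status = .moving z u (t + N.dist v u) := by
  obtain ⟨h1, h2, h3⟩ := conf_succ_resolved P N p A w t
  rw [h3, Bool.or_eq_false_iff] at hf
  obtain ⟨r, hr⟩ := Option.isSome_iff_exists.1 (by simpa using hf.2)
  rw [hr] at h1 h2
  simp only at h1 h2
  unfold resolvedAt resolve at hr
  split at hr
  next hl =>
    left
    obtain rfl := Option.some.inj hr
    refine ⟨fun v => ?_, h2, h1⟩
    rw [List.filterMap_eq_nil_iff] at hl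
    simpa using hl v (List.mem_finRange v)
  next v z u hl =>
    right
    split_ifs at hr with hc
    obtain rfl := Option.some.inj hr
    obtain ⟨⟨s, hs⟩, hz⟩ := hc
    have hm : (v, (z, u)) ∈ (List.finRange n).filterMap
        (fun v => ((P.outAt N p A w t v).assign).map fun a => (v, a)) := by rw [hl]; simp
    rw [List.mem_filterMap] at hm
    obtain ⟨v', -, hv'⟩ := hm
    rw [Option.map_eq_some_iff] at hv'
    obtain ⟨a, ha, hav⟩ := hv'
    obtain ⟨rfl, rfl⟩ := Prod.mk.inj hav
    exact ⟨_, _, _, _, ha, hs, hz, h1, h2⟩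
  next => simp at hr

/-- Two adversaries that answer short histories alike lead to the same configurations early on. -/
theorem conf_congr {T : ℕ} (h : ∀ l : List (View n k), l.length ≤ T → A l = B l) {t : ℕ}
    (ht : t ≤ T) : P.conf N p A w t = P.conf N p B w t := by
  induction t with
  | zero => rfl
  | succ t ih =>
    have e := ih (by omega)
    have hl : (P.conf N p A w t).views.length = t := conf_views_length ..
    change P.pulse N A _ _ = P.pulse N B _ _
    rw [← e]
    unfold pulse
    simp only
    rw [h _ (by simp [hl]; omega)]

/-- The configurations early on do not depend on later coins. -/
theorem conf_congr_coins {w w' : ℕ → Fin n → P.Coin} {T : ℕ} (h : ∀ t < T, w t = w' t) {t : ℕ}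
    (ht : t ≤ T) : P.conf N p A w t = P.conf N p A w' t := by
  induction t with
  | zero => rfl
  | succ t ih =>
    change P.pulse N A _ _ = P.pulse N A _ _
    rw [ih (by omega), h t (by omega)]

end Protocol

/-! ### Causality: how differences between coupled executions spread -/

namespace Protocol

variable {n k : ℕ}

/-- The executions against `A` and `B` look the same to processor `u` before time `t`. -/
def Agree (P : Protocol n k) (N : Network n) (p : Fin k ↪ Fin n) (A B : Adversary n k)
    (w : ℕ → Fin n → P.Coin) (u : Fin n) (t : ℕ) : Prop :=
  ∀ s < t, P.inAt N p A w s u = P.inAt N p B w s u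

open scoped Classical in
/-- The edges over which a message is sent at a time `t` with `a ≤ t < b`. -/
noncomputable def usedEdges (P : Protocol n k) (N : Network n) (p : Fin k ↪ Fin n)
    (A : Adversary n k) (w : ℕ → Fin n → P.Coin) (a b : ℕ) : Finset (Sym2 (Fin n)) :=
  Finset.univ.filter fun e => ∃ t u v, a ≤ t ∧ t < b ∧ P.Sends N p A w t u v ∧ e = s(u, v)

open scoped Classical in
/-- The processors to which a message is sent at a time `t` with `a ≤ t < b`. -/
noncomputable def receivers (P : Protocol n k) (N : Network n) (p : Fin k ↪ Fin n)
    (A : Adversary n k) (w : ℕ → Fin n → P.Coin) (a b : ℕ) : Finset (Fin n) :=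
  Finset.univ.filter fun v => ∃ t u, a ≤ t ∧ t < b ∧ P.Sends N p A w t u v

/-- The node of the pending request, if there is one. -/
def pendingNode : Status n k → Option (Fin n)
  | .idle => none
  | .waiting u _ => some u
  | .moving _ u _ => some u

variable {P : Protocol n k} {N : Network n} {p : Fin k ↪ Fin n} {A B : Adversary n k}
  {w : ℕ → Fin n → P.Coin}

theorem Agree.mono {u : Fin n} {s t : ℕ} (h : P.Agree N p A B w u t) (hst : s ≤ t) :
    P.Agree N p A B w u s := fun r hr => h r (hr.trans_le hst)

theorem Agree.symm {u : Fin n} {t : ℕ} (h : P.Agree N p A B w u t) :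
    P.Agree N p B A w u t := fun r hr => (h r hr).symm

theorem Agree.trans {C : Adversary n k} {u : Fin n} {t : ℕ} (h : P.Agree N p A B w u t)
    (h' : P.Agree N p B C w u t) : P.Agree N p A C w u t :=
  fun r hr => (h r hr).trans (h' r hr)

theorem Agree.state_eq {u : Fin n} {t : ℕ} (h : P.Agree N p A B w u t) :
    (P.conf N p A w t).state u = (P.conf N p B w t).state u := by
  induction t with
  | zero => rfl
  | succ t ih =>
    rw [conf_state_succ, conf_state_succ, ih (h.mono (Nat.le_succ t)), h t (Nat.lt_succ_self t)]

theorem Agree.outAt_eq {u : Fin n} {s t : ℕ} (h : P.Agree N p A B w u t) (hs : s < t) :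
    P.outAt N p A w s u = P.outAt N p B w s u := by
  unfold outAt
  rw [(h.mono hs.le).state_eq, h s hs]

theorem agree_of_conf_eq {T : ℕ} (h : ∀ l : List (View n k), l.length ≤ T → A l = B l)
    (u : Fin n) : P.Agree N p A B w u T := by
  intro s hs
  unfold inAt inputOf
  have e : P.conf N p A w s = P.conf N p B w s := conf_congr P N p A B w h hs.le
  have e' : reqOf A (P.conf N p B w s) = reqOf B (P.conf N p B w s) := by
    unfold reqOf
    rw [h]
    rw [List.length_cons, conf_views_length]
    omega
  rw [e, e']

/-- Two inputs agree if the requests and arrivals do, and no message sent since `T` is a reason for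
a difference. -/
theorem inAt_ext {T t : ℕ} {u : Fin n} (h0 : ∀ v, P.Agree N p A B w v T)
    (hr : (P.inAt N p A w t u).request = (P.inAt N p B w t u).request)
    (ha : (P.inAt N p A w t u).arrival = (P.inAt N p B w t u).arrival)
    (hm : ∀ s v, T ≤ s → s < t → N.graph.Adj v u →
      (P.outAt N p A w s v).outbox u = (P.outAt N p B w s v).outbox u) :
    P.inAt N p A w t u = P.inAt N p B w t u := by
  have hi : (P.inAt N p A w t u).inbox = (P.inAt N p B w t u).inbox := by
    funext v
    rw [inAt_inbox, inAt_inbox]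
    split_ifs with h
    · have hw : 1 ≤ N.weight s(v, u) := N.one_le_weight _ h.1
      by_cases hs : T ≤ t - N.weight s(v, u)
      · exact hm _ v hs (by omega) h.1
      · rw [(h0 v).outAt_eq (by omega)]
    · rfl
  revert hr ha hi
  rcases P.inAt N p A w t u with ⟨i, r, a⟩
  rcases P.inAt N p B w t u with ⟨i', r', a'⟩
  rintro ⟨⟩ ⟨⟩ ⟨⟩
  rfl

/-- A set of processors that contains those with different requests or arrivals, and that no
message leaves, contains all processors to which two executions look different. -/
theorem agree_of_notMem (C : Set (Fin n)) {T t : ℕ} (h0 : ∀ v, P.Agree N p A B w v T)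
    (hext : ∀ s, T ≤ s → s ≤ t → ∀ u ∉ C,
      (P.inAt N p A w s u).request = (P.inAt N p B w s u).request ∧
      (P.inAt N p A w s u).arrival = (P.inAt N p B w s u).arrival)
    (hC : ∀ s u v, T ≤ s → s < t → u ∈ C →
      P.Sends N p A w s u v ∨ P.Sends N p B w s u v → v ∈ C) :
    ∀ u ∉ C, P.Agree N p A B w u (t + 1) := by
  have key : ∀ r, r ≤ t + 1 → ∀ u ∉ C, P.Agree N p A B w u r := by
    intro r
    induction r with
    | zero => exact fun _ u _ s hs => absurd hs (Nat.not_lt_zero s)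
    | succ r ih =>
      intro hr u hu s hs
      rcases Nat.lt_succ_iff_lt_or_eq.1 hs with hs | rfl
      · exact ih (by omega) u hu s hs
      by_cases hT : s < T
      · exact h0 u s hT
      obtain ⟨h1, h2⟩ := hext s (by omega) (by omega) u hu
      refine inAt_ext h0 h1 h2 fun a v hTa ha hadj => ?_
      by_cases hv : v ∈ C
      · have hA : ¬ P.Sends N p A w a v u :=
          fun h => hu (hC a v u hTa (by omega) hv (Or.inl h))
        have hB : ¬ P.Sends N p B w a v u :=
          fun h => hu (hC a v u hTa (by omega) hv (Or.inr h))
        have hA' : (P.outAt N p A w a v).outbox u = none := by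
          simpa [Sends, hadj] using hA
        have hB' : (P.outAt N p B w a v).outbox u = none := by
          simpa [Sends, hadj] using hB
        rw [hA', hB']
      · rw [(ih (by omega) v hv).outAt_eq ha]
  exact key _ le_rfl

theorem mem_usedEdges {a b : ℕ} {e : Sym2 (Fin n)} : e ∈ P.usedEdges N p A w a b ↔
    ∃ t u v, a ≤ t ∧ t < b ∧ P.Sends N p A w t u v ∧ e = s(u, v) := by
  simp [usedEdges]

theorem usedEdges_subset_edgeSet {a b : ℕ} {e : Sym2 (Fin n)}
    (he : e ∈ P.usedEdges N p A w a b) : e ∈ N.graph.edgeSet := by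
  obtain ⟨t, u, v, -, -, h, rfl⟩ := mem_usedEdges.1 he
  exact h.1

theorem sum_weight_usedEdges_le {a b : ℕ} (hab : a ≤ b) :
    (P.conf N p A w a).cost + ∑ e ∈ P.usedEdges N p A w a b, N.weight e ≤
      (P.conf N p A w b).cost := by
  classical
  induction b, hab using Nat.le_induction with
  | base =>
    have : P.usedEdges N p A w a a = ∅ := by
      ext e; simp [mem_usedEdges]; intros; omega
    simp [this]
  | succ b hab ih =>
    have hsub : P.usedEdges N p A w a (b + 1) ⊆ P.usedEdges N p A w a b ∪
        (Finset.univ.filter fun q : Fin n × Fin n => P.Sends N p A w b q.1 q.2).image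
          (fun q => s(q.1, q.2)) := by
      intro e he
      obtain ⟨t, u, v, h1, h2, h3, rfl⟩ := mem_usedEdges.1 he
      rw [Finset.mem_union]
      rcases Nat.lt_succ_iff_lt_or_eq.1 h2 with h | rfl
      · exact Or.inl (mem_usedEdges.2 ⟨t, u, v, h1, h, h3, rfl⟩)
      · exact Or.inr (Finset.mem_image.2 ⟨(u, v), by simpa using h3, rfl⟩)
    have himg : ∑ e ∈ (Finset.univ.filter fun q : Fin n × Fin n =>
        P.Sends N p A w b q.1 q.2).image (fun q => s(q.1, q.2)), N.weight e ≤
        ∑ q ∈ Finset.univ.filter fun q : Fin n × Fin n => P.Sends N p A w b q.1 q.2,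
          N.weight s(q.1, q.2) :=
      Finset.sum_image_le_of_nonneg (fun _ _ => Nat.zero_le _)
    rw [Finset.sum_filter, Fintype.sum_prod_type] at himg
    simp only at himg
    rw [conf_cost_succ]
    have hU : ∑ e ∈ P.usedEdges N p A w a (b + 1), N.weight e ≤ _ :=
      (Finset.sum_le_sum_of_subset hsub).trans (Finset.sum_union_inter.le.trans' (Nat.le_add_right _ _))
    omega

theorem card_receivers_le {a b : ℕ} (hab : a ≤ b) :
    (P.conf N p A w a).cost + (P.receivers N p A w a b).card ≤ (P.conf N p A w b).cost := by
  classical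
  induction b, hab using Nat.le_induction with
  | base =>
    have : P.receivers N p A w a a = ∅ := by
      ext e; simp [receivers]; intros; omega
    simp [this]
  | succ b hab ih =>
    have hsub : P.receivers N p A w a (b + 1) ⊆ P.receivers N p A w a b ∪
        (Finset.univ.filter fun q : Fin n × Fin n => P.Sends N p A w b q.1 q.2).image
          Prod.snd := by
      intro v hv
      obtain ⟨t, u, h1, h2, h3⟩ := (Finset.mem_filter.1 hv).2
      rw [Finset.mem_union]
      rcases Nat.lt_succ_iff_lt_or_eq.1 h2 with h | rfl
      · exact Or.inl (Finset.mem_filter.2 ⟨Finset.mem_univ _, t, u, h1, h, h3⟩)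
      · exact Or.inr (Finset.mem_image.2 ⟨(u, v), by simpa using h3, rfl⟩)
    have hc := (Finset.card_le_card hsub).trans (Finset.card_union_le _ _)
    have hi : ((Finset.univ.filter fun q : Fin n × Fin n => P.Sends N p A w b q.1 q.2).image
        Prod.snd).card ≤ ∑ v, ∑ u, if P.Sends N p A w b v u then N.weight s(v, u) else 0 := by
      refine Finset.card_image_le.trans ?_
      rw [Finset.card_filter, Fintype.sum_prod_type]
      refine Finset.sum_le_sum fun v _ => Finset.sum_le_sum fun u _ => ?_
      split_ifs with h
      · exact N.one_le_weight _ h.1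
      · exact le_rfl
    rw [conf_cost_succ]
    omega

theorem not_sends_of_cost_eq {a b t : ℕ}
    (h : (P.conf N p A w b).cost = (P.conf N p A w a).cost) (ha : a ≤ t) (hb : t < b)
    (u v : Fin n) : ¬ P.Sends N p A w t u v := by
  classical
  intro hs
  have hc := card_receivers_le (P := P) (N := N) (p := p) (A := A) (w := w) (ha.trans hb.le)
  have : 0 < (P.receivers N p A w a b).card :=
    Finset.card_pos.2 ⟨v, Finset.mem_filter.2 ⟨Finset.mem_univ _, t, u, ha, hb, hs⟩⟩
  omega

/-- The cost of one execution over a period is at most that of another one that sends all of its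
messages. -/
theorem cost_le_of_sends {a b : ℕ} (hab : a ≤ b)
    (h : ∀ t u v, a ≤ t → t < b → P.Sends N p A w t u v → P.Sends N p B w t u v) :
    (P.conf N p A w b).cost + (P.conf N p B w a).cost ≤
      (P.conf N p B w b).cost + (P.conf N p A w a).cost := by
  classical
  induction b, hab using Nat.le_induction with
  | base => omega
  | succ b hab ih =>
    have := ih fun t u v h1 h2 => h t u v h1 (by omega)
    rw [conf_cost_succ, conf_cost_succ]
    have : (∑ v, ∑ u, if P.Sends N p A w b v u then N.weight s(v, u) else 0) ≤
        ∑ v, ∑ u, if P.Sends N p B w b v u then N.weight s(v, u) else 0 := by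
      refine Finset.sum_le_sum fun v _ => Finset.sum_le_sum fun u _ => ?_
      split_ifs with h1 h2
      · exact le_rfl
      · exact absurd (h b v u hab (by omega) h1) h2
      · exact Nat.zero_le _
      · exact le_rfl
    omega

theorem _root_.Network.dist_le_walk (N : Network n) {u v : Fin n} (q : N.graph.Walk u v) :
    N.dist u v ≤ (q.edges.map N.weight).sum := Nat.sInf_le ⟨q, rfl⟩

/-- Within a set of edges, a node can be reached at a distance of at most the total weight. -/
theorem _root_.Network.dist_le_sum_weight (N : Network n) {E : Finset (Sym2 (Fin n))}
    (hE : ∀ e ∈ E, e ∈ N.graph.edgeSet) {u v : Fin n}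
    (h : (SimpleGraph.fromEdgeSet (E : Set (Sym2 (Fin n)))).Reachable u v) :
    N.dist u v ≤ ∑ e ∈ E, N.weight e := by
  classical
  obtain ⟨q, hq⟩ := h.exists_isPath
  have hle : SimpleGraph.fromEdgeSet (E : Set (Sym2 (Fin n))) ≤ N.graph := by
    intro a b hab
    rw [SimpleGraph.fromEdgeSet_adj] at hab
    exact hE _ hab.1
  refine (N.dist_le_walk (q.mapLe hle)).trans ?_
  have hed : (q.mapLe hle).edges = q.edges := by simp
  rw [hed, ← List.sum_toFinset _ hq.isTrail.edges_nodup]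
  refine Finset.sum_le_sum_of_subset fun e he => ?_
  have := q.edges_subset_edgeSet (List.mem_toFinset.1 he)
  rw [SimpleGraph.edgeSet_fromEdgeSet] at this
  exact this.1

/-! ### The status of the current request -/

theorem reqAt_eq_none_of_waiting {t s : ℕ} {u : Fin n}
    (h : (P.conf N p A w t).status = .waiting u s) : P.reqAt N p A w t = none := by
  rw [reqAt_eq, h]; simp [afterArrival]

theorem midStatus_of_waiting {t s : ℕ} {u : Fin n}
    (h : (P.conf N p A w t).status = .waiting u s) : P.midStatus N p A w t = .waiting u s := by
  unfold midStatus
  rw [reqAt_eq_none_of_waiting h, h]; rfl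

theorem midStatus_of_req {t : ℕ} {u : Fin n} {z : Fin k}
    (h : P.reqAt N p A w t = some (u, z)) : P.midStatus N p A w t = .waiting u t := by
  unfold midStatus; rw [h]

theorem midStatus_of_idle {t : ℕ} (h : (P.conf N p A w t).status = .idle)
    (hr : P.reqAt N p A w t = none) : P.midStatus N p A w t = .idle := by
  unfold midStatus; rw [hr, h]; rfl

theorem pulse_of_not_waiting {t : ℕ} (hf : (P.conf N p A w (t + 1)).faulty = false)
    (h : ∀ u s, P.midStatus N p A w t ≠ .waiting u s) :
    (∀ v, (P.outAt N p A w t v).assign = none) ∧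
      (P.conf N p A w (t + 1)).status = P.midStatus N p A w t ∧
      (P.conf N p A w (t + 1)).tail = (P.conf N p A w t).tail := by
  rcases pulse_cases P N p A w hf with h' | ⟨v, z, u, s, -, hs, -⟩
  · exact h'
  · exact absurd hs (h u s)

/-- Without requests, an idle network stays idle and takes no decisions. -/
theorem idle_of_no_req (hf : ∀ t, (P.conf N p A w t).faulty = false) {T t : ℕ} (hTt : T ≤ t)
    (hT : (P.conf N p A w T).status = .idle)
    (hr : ∀ s, T ≤ s → s < t → P.reqAt N p A w s = none) :
    (P.conf N p A w t).status = .idle ∧ (P.conf N p A w t).tail = (P.conf N p A w T).tail ∧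
      ∀ s, T ≤ s → s < t → ∀ v, (P.outAt N p A w s v).assign = none := by
  induction t, hTt using Nat.le_induction with
  | base => exact ⟨hT, rfl, fun s h1 h2 => by omega⟩
  | succ t hTt ih =>
    obtain ⟨h1, h2, h3⟩ := ih fun s a b => hr s a (by omega)
    have hm := midStatus_of_idle h1 (hr t hTt (by omega))
    obtain ⟨a, b, c⟩ := pulse_of_not_waiting (hf (t + 1)) (by simp [hm])
    refine ⟨b.trans hm, c.trans h2, fun s hs hst => ?_⟩
    rcases Nat.lt_succ_iff_lt_or_eq.1 hst with h | rfl
    · exact h3 s hs h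
    · exact a

theorem arrival_of_pendingNode_ne {t : ℕ} {v : Fin n}
    (h : pendingNode (P.conf N p A w t).status ≠ some v) :
    (P.inAt N p A w t v).arrival = none := by
  rw [inAt_arrival]
  revert h
  cases (P.conf N p A w t).status with
  | idle => simp [arrivalAt]
  | waiting u s => simp [arrivalAt]
  | moving z u a =>
    intro h
    have : u ≠ v := fun e => h (by rw [e]; rfl)
    simp only [arrivalAt]
    split_ifs <;> simp [this]

theorem arrival_of_idle {t : ℕ} (v : Fin n) (h : (P.conf N p A w t).status = .idle) :
    (P.inAt N p A w t v).arrival = none :=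
  arrival_of_pendingNode_ne (by rw [h]; simp [pendingNode])

theorem arrival_of_waiting {t s : ℕ} {u : Fin n} (v : Fin n)
    (h : (P.conf N p A w t).status = .waiting u s) : (P.inAt N p A w t v).arrival = none := by
  rw [inAt_arrival, h]; rfl

theorem request_of_none {t : ℕ} (v : Fin n) (h : P.reqAt N p A w t = none) :
    (P.inAt N p A w t v).request = false := by
  rw [inAt_request, h]; simp

theorem request_of_ne {t : ℕ} {u v : Fin n} {z : Fin k} (h : P.reqAt N p A w t = some (u, z))
    (huv : u ≠ v) : (P.inAt N p A w t v).request = false := by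
  rw [inAt_request, h]; simp [huv]

theorem request_self {t : ℕ} {u : Fin n} {z : Fin k} (h : P.reqAt N p A w t = some (u, z)) :
    (P.inAt N p A w t u).request = true := by
  rw [inAt_request, h]; simp

theorem pendingNode_afterArrival {t : ℕ} {σ : Status n k} {v : Fin n}
    (h : pendingNode (afterArrival t σ) = some v) : pendingNode σ = some v := by
  cases σ with
  | idle => exact h
  | waiting u s => exact h
  | moving z u a =>
    simp only [afterArrival] at h
    split_ifs at h
    · exact absurd h (by simp [pendingNode])
    · exact h

/-- If all requests since an idle time are at nodes of `C`, so is the pending one. -/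
theorem pendingNode_mem (hf : ∀ t, (P.conf N p A w t).faulty = false) {C : Set (Fin n)}
    {T t : ℕ} (hTt : T ≤ t) (hT : (P.conf N p A w T).status = .idle)
    (hr : ∀ s u z, T ≤ s → s < t → P.reqAt N p A w s = some (u, z) → u ∈ C) {v : Fin n}
    (hv : pendingNode (P.conf N p A w t).status = some v) : v ∈ C := by
  induction t, hTt using Nat.le_induction generalizing v with
  | base => rw [hT] at hv; simp [pendingNode] at hv
  | succ t hTt ih =>
    have ih' : ∀ v, pendingNode (P.conf N p A w t).status = some v → v ∈ C :=
      fun v hv => ih (fun s u z a b => hr s u z a (by omega)) hv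
    have hmid : ∀ v, pendingNode (P.midStatus N p A w t) = some v → v ∈ C := by
      intro v hv
      rcases hq : P.reqAt N p A w t with _ | ⟨u, z⟩
      · unfold midStatus at hv
        rw [hq] at hv
        exact ih' v (pendingNode_afterArrival hv)
      · rw [midStatus_of_req hq] at hv
        obtain rfl : u = v := by simpa [pendingNode] using hv
        exact hr t u z hTt (by omega) hq
    rcases pulse_cases P N p A w (hf (t + 1)) with ⟨-, h, -⟩ | ⟨τ, z, u, s, -, hs, -, -, h⟩
    · rw [h] at hv; exact hmid v hv
    · rw [h] at hv
      apply hmid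
      rw [hs]
      simpa [pendingNode] using hv

end Protocol

/-! ### One additional request -/

namespace Protocol

variable {n k : ℕ}

/-- The adversaries `O` and `S` behave alike before time `T`, at which the network is idle; in the
period from `T` to `T'`, `O` makes no request, and `S` makes exactly one, at node `v` and
time `T`. -/
structure ExtraRequest (P : Protocol n k) (N : Network n) (p : Fin k ↪ Fin n)
    (O S : Adversary n k) (w : ℕ → Fin n → P.Coin) (T T' : ℕ) (v : Fin n) : Prop where
  eq_before : ∀ l : List (View n k), l.length ≤ T → O l = S l
  lt : T < T'
  idle : (P.conf N p O w T).status = .idle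
  noReq : ∀ t, T ≤ t → t < T' → P.reqAt N p O w t = none
  req : ∃ z, P.reqAt N p S w T = some (v, z)
  noReq' : ∀ t, T < t → t < T' → P.reqAt N p S w t = none

variable {P : Protocol n k} {N : Network n} {p : Fin k ↪ Fin n} {O S : Adversary n k}
  {w : ℕ → Fin n → P.Coin} {T T' : ℕ} {v : Fin n}

namespace ExtraRequest

theorem conf_eq (h : P.ExtraRequest N p O S w T T' v) {t : ℕ} (ht : t ≤ T) :
    P.conf N p O w t = P.conf N p S w t := conf_congr P N p O S w h.eq_before ht

theorem agree_before (h : P.ExtraRequest N p O S w T T' v) (u : Fin n) :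
    P.Agree N p S O w u T := (agree_of_conf_eq h.eq_before u).symm

theorem idle' (h : P.ExtraRequest N p O S w T T' v) : (P.conf N p S w T).status = .idle := by
  rw [← h.conf_eq le_rfl]; exact h.idle

theorem idle_O (h : P.ExtraRequest N p O S w T T' v)
    (hf : ∀ t, (P.conf N p O w t).faulty = false) {t : ℕ} (h1 : T ≤ t) (h2 : t ≤ T') :
    (P.conf N p O w t).status = .idle :=
  (idle_of_no_req hf h1 h.idle fun s a b => h.noReq s a (by omega)).1

theorem assign_O (h : P.ExtraRequest N p O S w T T' v)
    (hf : ∀ t, (P.conf N p O w t).faulty = false) {t : ℕ} (h1 : T ≤ t) (h2 : t < T') (u : Fin n) :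
    (P.outAt N p O w t u).assign = none :=
  (idle_of_no_req hf (Nat.le_succ_of_le h1) h.idle fun s a b => h.noReq s a (by omega)).2.2 t h1
    (Nat.lt_succ_self t) u

/-- The status in the middle of a pulse, as long as the additional request waits. -/
theorem midStatus_eq (h : P.ExtraRequest N p O S w T T' v) {t : ℕ} (h1 : T ≤ t)
    (hw : T < t → (P.conf N p S w t).status = .waiting v T) :
    P.midStatus N p S w t = .waiting v T := by
  rcases h1.eq_or_lt with rfl | h1
  · obtain ⟨z, hz⟩ := h.req
    exact midStatus_of_req hz
  · exact midStatus_of_waiting (hw h1)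

theorem no_arrival (h : P.ExtraRequest N p O S w T T' v) {t : ℕ} (h1 : T ≤ t)
    (hw : T < t → (P.conf N p S w t).status = .waiting v T) (u : Fin n) :
    (P.inAt N p S w t u).arrival = none := by
  rcases h1.eq_or_lt with rfl | h1
  · exact arrival_of_idle _ h.idle'
  · exact arrival_of_waiting _ (hw h1)

theorem request_eq_decide (h : P.ExtraRequest N p O S w T T' v) {t : ℕ} (h1 : T ≤ t)
    (h2 : t < T') (u : Fin n) :
    (P.inAt N p S w t u).request = decide (t = T ∧ u = v) := by
  obtain ⟨z, hz⟩ := h.req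
  rcases h1.eq_or_lt with rfl | h1
  · by_cases huv : u = v
    · subst huv; rw [request_self hz]; simp
    · rw [request_of_ne hz (Ne.symm huv)]; simp [huv]
  · rw [request_of_none _ (h.noReq' t h1 h2)]
    have : t ≠ T := by omega
    simp [this]

/-- As long as the additional request waits, the only external reason for a difference is the
request itself. -/
theorem ext_eq (h : P.ExtraRequest N p O S w T T' v)
    (hf : ∀ t, (P.conf N p O w t).faulty = false) {t : ℕ} (h1 : T ≤ t) (h2 : t < T')
    (hw : T < t → (P.conf N p S w t).status = .waiting v T) {u : Fin n} (hu : u ≠ v) :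
    (P.inAt N p S w t u).request = (P.inAt N p O w t u).request ∧
      (P.inAt N p S w t u).arrival = (P.inAt N p O w t u).arrival := by
  rw [h.no_arrival h1 hw, h.request_eq_decide h1 h2, request_of_none _ (h.noReq t h1 h2),
    arrival_of_idle _ (h.idle_O hf h1 h2.le)]
  simp [hu]

/-- As long as the additional request waits, only processors that can be reached from its node over
edges used since then perceive it. -/
theorem agree_of_notMem (h : P.ExtraRequest N p O S w T T' v)
    (hf : ∀ t, (P.conf N p O w t).faulty = false)
    (hsil : (P.conf N p O w T').cost = (P.conf N p O w T).cost) {t : ℕ} (h2 : t < T')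
    (hw : ∀ s, T < s → s ≤ t → (P.conf N p S w s).status = .waiting v T)
    {C : Set (Fin n)} (hv : v ∈ C)
    (hC : ∀ s a b, T ≤ s → s < t → a ∈ C → P.Sends N p S w s a b → b ∈ C) :
    ∀ u ∉ C, P.Agree N p S O w u (t + 1) := by
  refine Protocol.agree_of_notMem C h.agree_before (fun s hs hst u hu => ?_)
    (fun s a b hs hst ha hab => ?_)
  · exact h.ext_eq hf hs (by omega) (fun hs' => hw s hs' hst) fun e => hu (e ▸ hv)
  · rcases hab with hab | hab
    · exact hC s a b hs hst ha hab
    · exact absurd hab (not_sends_of_cost_eq hsil hs (by omega) a b)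

/-- The processors that can be reached from `v` over the edges used in the period from `T`
to `t`. -/
theorem reachable_closed {t s : ℕ} {a b : Fin n} (h1 : T ≤ s) (h2 : s < t)
    (ha : (SimpleGraph.fromEdgeSet (P.usedEdges N p S w T t : Set (Sym2 (Fin n)))).Reachable v a)
    (hs : P.Sends N p S w s a b) :
    (SimpleGraph.fromEdgeSet (P.usedEdges N p S w T t : Set (Sym2 (Fin n)))).Reachable v b := by
  refine ha.trans (SimpleGraph.Adj.reachable ?_)
  rw [SimpleGraph.fromEdgeSet_adj]
  exact ⟨mem_usedEdges.2 ⟨s, a, b, h1, h2, hs, rfl⟩, hs.1.ne⟩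

/-- A single request that gets served in a period in which the network would otherwise be silent:
the last request of exactly one schedule moves to `v`, and the protocol pays for a path from `v` to
the node of the previous last request of this schedule. -/
theorem served (h : P.ExtraRequest N p O S w T T' v)
    (hf : ∀ t, (P.conf N p O w t).faulty = false) (hfS : ∀ t, (P.conf N p S w t).faulty = false)
    (hsil : (P.conf N p O w T').cost = (P.conf N p O w T).cost)
    (hidle : (P.conf N p S w T').status = .idle) :
    ∃ z, (P.conf N p S w T').tail = Function.update (P.conf N p O w T).tail z v ∧
      N.dist v ((P.conf N p O w T).tail z) + (P.conf N p O w T).cost ≤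
        (P.conf N p S w T').cost := by
  have key : ∀ t, T < t → t ≤ T' →
      ((∀ s, T < s → s ≤ t → (P.conf N p S w s).status = .waiting v T) ∧
        (P.conf N p S w t).tail = (P.conf N p O w T).tail) ∨
      ((∀ a s, (P.conf N p S w t).status ≠ .waiting a s) ∧
        ∃ z, (P.conf N p S w t).tail = Function.update (P.conf N p O w T).tail z v ∧
        N.dist v ((P.conf N p O w T).tail z) + (P.conf N p O w T).cost ≤
          (P.conf N p S w t).cost) := by
    -- a pulse that starts while the request waits
    have wait : ∀ t, T ≤ t → t < T' →
        (∀ s, T < s → s ≤ t → (P.conf N p S w s).status = .waiting v T) →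
        (P.conf N p S w t).tail = (P.conf N p O w T).tail →
        ((∀ s, T < s → s ≤ t + 1 → (P.conf N p S w s).status = .waiting v T) ∧
          (P.conf N p S w (t + 1)).tail = (P.conf N p O w T).tail) ∨
        ((∀ a s, (P.conf N p S w (t + 1)).status ≠ .waiting a s) ∧
          ∃ z, (P.conf N p S w (t + 1)).tail =
              Function.update (P.conf N p O w T).tail z v ∧
            N.dist v ((P.conf N p O w T).tail z) + (P.conf N p O w T).cost ≤
              (P.conf N p S w (t + 1)).cost) := by
      intro t h1 h2 hw htail
      have hm := h.midStatus_eq h1 fun hs => hw t hs le_rfl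
      rcases pulse_cases P N p S w (hfS (t + 1)) with ⟨-, hst, htl⟩ |
        ⟨τ, z, u, s, hτ, hs, hz, htl, hst⟩
      · refine Or.inl ⟨fun s hs hst' => ?_, htl.trans htail⟩
        rcases Nat.le_succ_iff.1 hst' with hs' | rfl
        · exact hw s hs hs'
        · rw [hst, hm]
      · right
        obtain ⟨rfl, -⟩ : v = u ∧ T = s := by
          rw [hm] at hs; exact Status.waiting.inj hs
        refine ⟨fun a s => by rw [hst]; simp, z, by rw [htl, htail], ?_⟩
        have hreach : (SimpleGraph.fromEdgeSet
            (P.usedEdges N p S w T t : Set (Sym2 (Fin n)))).Reachable v τ := by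
          by_contra hn
          have hag := h.agree_of_notMem hf hsil h2 hw
            (C := {u | (SimpleGraph.fromEdgeSet
              (P.usedEdges N p S w T t : Set (Sym2 (Fin n)))).Reachable v u})
            (SimpleGraph.Reachable.refl v)
            (fun s a b hs hst ha hab => reachable_closed hs hst ha hab) τ hn
          have := hag.outAt_eq (Nat.lt_succ_self t)
          rw [this, h.assign_O hf h1 h2] at hτ
          exact absurd hτ (by simp)
        have hd := N.dist_le_sum_weight (fun e he => usedEdges_subset_edgeSet he) hreach
        have hc := sum_weight_usedEdges_le (P := P) (N := N) (p := p) (A := S) (w := w) h1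
        have hm' : (P.conf N p S w t).cost ≤ (P.conf N p S w (t + 1)).cost :=
          cost_mono P N p S w (Nat.le_succ t)
        rw [← htail, hz, h.conf_eq (le_refl T)]
        omega
    intro t ht
    induction t, ht using Nat.le_induction with
    | base =>
      intro h2
      exact wait T le_rfl h2 (fun s h1 h2 => by omega) (by rw [h.conf_eq le_rfl])
    | succ t ht ih =>
      intro h2
      have ht' : T < t := ht
      rcases ih (by omega) with ⟨h3, h4⟩ | ⟨h3, z, h4, h5⟩
      · exact wait t (by omega) h2 h3 h4
      · right
        have hm : P.midStatus N p S w t = afterArrival t (P.conf N p S w t).status := by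
          unfold midStatus; rw [h.noReq' t ht' h2]
        have hm' : ∀ a s, P.midStatus N p S w t ≠ .waiting a s := by
          intro a s e
          rw [hm] at e
          revert h3 e
          cases (P.conf N p S w t).status with
          | idle => intro _ e; exact absurd e (by simp [afterArrival])
          | waiting b c => intro h3; exact absurd rfl (h3 b c)
          | moving z b c =>
            intro _ e
            simp only [afterArrival] at e
            split_ifs at e
        obtain ⟨-, h6, h7⟩ := pulse_of_not_waiting (hfS (t + 1)) hm'
        have hmono : (P.conf N p S w t).cost ≤ (P.conf N p S w (t + 1)).cost :=
          cost_mono P N p S w (Nat.le_succ t)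
        exact ⟨fun a s => by rw [h6]; exact hm' a s, z, h7.trans h4, h5.trans hmono⟩
  rcases key T' h.lt le_rfl with ⟨h1, -⟩ | ⟨-, h1⟩
  · rw [h1 T' h.lt le_rfl] at hidle
    exact absurd hidle (by simp)
  · exact h1

end ExtraRequest

/-- The last time up to `T'` until which the execution against `S` has paid less than `r`
since `T`. -/
noncomputable def horizon (P : Protocol n k) (N : Network n) (p : Fin k ↪ Fin n)
    (S : Adversary n k) (w : ℕ → Fin n → P.Coin) (T T' r : ℕ) : ℕ :=
  Nat.findGreatest (fun t => (P.conf N p S w t).cost < (P.conf N p S w T).cost + r) T'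

/-- The edges that the execution against `S` uses since `T`, up to a cost of `r`. -/
noncomputable def exploredEdges (P : Protocol n k) (N : Network n) (p : Fin k ↪ Fin n)
    (S : Adversary n k) (w : ℕ → Fin n → P.Coin) (T T' r : ℕ) : Finset (Sym2 (Fin n)) :=
  P.usedEdges N p S w T (P.horizon N p S w T T' r)

/-- The nodes that can be reached from `v` over the edges that the execution against `S` uses
since `T`, up to a cost of `r`. -/
def explored (P : Protocol n k) (N : Network n) (p : Fin k ↪ Fin n)
    (S : Adversary n k) (w : ℕ → Fin n → P.Coin) (T T' r : ℕ) (v : Fin n) : Set (Fin n) :=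
  {u | (SimpleGraph.fromEdgeSet
    (P.exploredEdges N p S w T T' r : Set (Sym2 (Fin n)))).Reachable v u}

theorem horizon_spec {r : ℕ} (hr : 0 < r) (hT : T ≤ T') :
    T ≤ P.horizon N p S w T T' r ∧ P.horizon N p S w T T' r ≤ T' ∧
      (P.conf N p S w (P.horizon N p S w T T' r)).cost < (P.conf N p S w T).cost + r :=
  ⟨Nat.le_findGreatest hT (by omega), Nat.findGreatest_le _,
    Nat.findGreatest_spec (P := fun t => (P.conf N p S w t).cost < (P.conf N p S w T).cost + r)
      hT (by omega)⟩

theorem sum_weight_exploredEdges_lt {r : ℕ} (hr : 0 < r) (hT : T ≤ T') :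
    ∑ e ∈ P.exploredEdges N p S w T T' r, N.weight e < r := by
  obtain ⟨h1, h2, h3⟩ := horizon_spec (P := P) (N := N) (p := p) (S := S) (w := w) hr hT
  have := sum_weight_usedEdges_le (P := P) (N := N) (p := p) (A := S) (w := w) h1
  unfold exploredEdges
  omega

/-- The additional request at `v` is made both after the execution against `O` and after the
execution against `Q`, which are silent without it.  If it is served at a cost below `r` in the
latter case, then the part of the network that `v` explores at this cost in the former case,
where nothing has happened before, contains a processor that can tell `O` and `Q` apart, or the
last request of a schedule before anything happened.  Otherwise no processor that has noticed `v`
could learn where the request must be scheduled. -/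
theorem exists_mem_explored {Q A : Adversary n k} {r : ℕ} (hr : 0 < r)
    (hS : P.ExtraRequest N p O S w T T' v) (hA : P.ExtraRequest N p Q A w T T' v)
    (hf : ∀ (B : Adversary n k) t, (P.conf N p B w t).faulty = false)
    (hsilO : (P.conf N p O w T').cost = (P.conf N p O w T).cost)
    (hsilQ : (P.conf N p Q w T').cost = (P.conf N p Q w T).cost)
    (hidle : (P.conf N p A w T').status = .idle)
    (hcost : (P.conf N p A w T').cost < (P.conf N p Q w T).cost + r) :
    ∃ u ∈ P.explored N p S w T T' r v, ¬ P.Agree N p O Q w u T' ∨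
      ∃ z, (P.conf N p O w T).tail z = u := by
  by_contra! hcon
  obtain ⟨hh1, hh2, hh3⟩ := horizon_spec (P := P) (N := N) (p := p) (S := S) (w := w) hr hS.lt.le
  set t₀ := P.horizon N p S w T T' r with ht₀
  set V := P.explored N p S w T T' r v with hV
  have hvV : v ∈ V := SimpleGraph.Reachable.refl v
  have hVclosed : ∀ s a b, T ≤ s → s < t₀ → a ∈ V → P.Sends N p S w s a b → b ∈ V :=
    fun s a b h1 h2 ha hs => ExtraRequest.reachable_closed h1 h2 ha hs
  have agrOQ : ∀ u ∈ V, P.Agree N p O Q w u T' := fun u hu => (hcon u hu).1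
  have vI : P.Agree N p O Q w v T' := agrOQ v hvV
  -- the execution against `S` takes no decision before `t₀`
  have hSwait : ∀ t, T ≤ t → t ≤ t₀ →
      (∀ s, T < s → s ≤ t → (P.conf N p S w s).status = .waiting v T) ∧
        (P.conf N p S w t).tail = (P.conf N p O w T).tail ∧
        ∀ s, T ≤ s → s < t → ∀ u, (P.outAt N p S w s u).assign = none := by
    intro t ht
    induction t, ht using Nat.le_induction with
    | base =>
      exact fun _ => ⟨fun s h1 h2 => by omega, by rw [hS.conf_eq le_rfl],
        fun s h1 h2 => by omega⟩
    | succ t ht ih =>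
      intro ht'
      obtain ⟨h1, h2, h3⟩ := ih (by omega)
      have hm := hS.midStatus_eq ht fun hs => h1 t hs le_rfl
      rcases pulse_cases P N p S w (hf S (t + 1)) with ⟨hno, hst, htl⟩ |
        ⟨τ, z, u, s, hτ, hs, hz, htl, hst⟩
      · refine ⟨fun s hs hst' => ?_, htl.trans h2, fun s hs hst' => ?_⟩
        · rcases Nat.le_succ_iff.1 hst' with hs' | rfl
          · exact h1 s hs hs'
          · rw [hst, hm]
        · rcases Nat.lt_succ_iff_lt_or_eq.1 hst' with hs' | rfl
          · exact h3 s hs hs'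
          · exact hno
      · exfalso
        have hτV : τ ∈ V := by
          by_contra hn
          have hag := hS.agree_of_notMem (hf O) hsilO (by omega) h1 hvV
            (fun s a b hs hst => hVclosed s a b hs (by omega)) τ hn
          rw [hag.outAt_eq (Nat.lt_succ_self t), hS.assign_O (hf O) ht (by omega)] at hτ
          exact absurd hτ (by simp)
        exact (hcon τ hτV).2 z (by rw [← h2, hz])
  have hSO : ∀ t, T ≤ t → t ≤ t₀ → t < T' → ∀ u ∉ V, P.Agree N p S O w u (t + 1) :=
    fun t h1 h2 h3 => hS.agree_of_notMem (hf O) hsilO h3 (hSwait t h1 h2).1 hvV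
      fun s a b hs hst => hVclosed s a b hs (by omega)
  have hsendO : ∀ s a b, T ≤ s → s < T' → ¬ P.Sends N p O w s a b :=
    fun s a b h1 h2 => not_sends_of_cost_eq hsilO h1 h2 a b
  have hsendQ : ∀ s a b, T ≤ s → s < T' → ¬ P.Sends N p Q w s a b :=
    fun s a b h1 h2 => not_sends_of_cost_eq hsilQ h1 h2 a b
  have none_of : ∀ {B : Adversary n k} {s : ℕ} {a b : Fin n}, ¬ P.Sends N p B w s a b →
      N.graph.Adj a b → (P.outAt N p B w s a).outbox b = none := by
    intro B s a b h hadj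
    simpa [Sends, hadj] using h
  -- processors outside `V` send nothing against `S`
  have hSsil : ∀ s a b, T ≤ s → s ≤ t₀ → s < T' → a ∉ V → ¬ P.Sends N p S w s a b := by
    intro s a b h1 h2 h3 ha hs
    refine hsendO s a b h1 h3 ⟨hs.1, ?_⟩
    rw [← (hSO s h1 h2 h3 a ha).outAt_eq (Nat.lt_succ_self s)]
    exact hs.2
  -- one more pulse of agreement
  have hpulse : ∀ t, T ≤ t → t ≤ t₀ → t < T' →
      (T < t → (P.conf N p A w t).status = .waiting v T) →
      (∀ u, P.Agree N p O Q w u T' → P.Agree N p A S w u t) →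
      (∀ u, ¬ P.Agree N p O Q w u T' → P.Agree N p A Q w u t) →
      (∀ u, P.Agree N p O Q w u T' → P.Agree N p A S w u (t + 1)) ∧
      (∀ u, ¬ P.Agree N p O Q w u T' → P.Agree N p A Q w u (t + 1)) := by
    intro t h1 h2 h3 hAw hAS hAQ
    have succ_of : ∀ {B C : Adversary n k} {u : Fin n}, P.Agree N p B C w u t →
        P.inAt N p B w t u = P.inAt N p C w t u → P.Agree N p B C w u (t + 1) := by
      intro B C u h e s hs
      rcases Nat.lt_succ_iff_lt_or_eq.1 hs with hs | rfl
      · exact h s hs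
      · exact e
    have hSw : T < t → (P.conf N p S w t).status = .waiting v T :=
      fun h => (hSwait t h1 h2).1 t h le_rfl
    have hAO : ∀ u, P.Agree N p A Q w u T := hA.agree_before
    refine ⟨fun u hu => succ_of (hAS u hu) ?_, fun u hu => succ_of (hAQ u hu) ?_⟩
    · -- compare with `S`, input by input: old messages are those against `Q` and `O`
      have hi : (P.inAt N p A w t u).inbox = (P.inAt N p S w t u).inbox := by
        funext a
        rw [inAt_inbox, inAt_inbox]
        split_ifs with h
        · have hw : 1 ≤ N.weight s(a, u) := N.one_le_weight _ h.1
          set s := t - N.weight s(a, u) with hs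
          by_cases hsT : T ≤ s
          · by_cases ha : P.Agree N p O Q w a T'
            · rw [(hAS a ha).outAt_eq (by omega)]
            · have haV : a ∉ V := fun hc => ha (agrOQ a hc)
              rw [(hAQ a ha).outAt_eq (by omega),
                none_of (hsendQ s a u hsT (by omega)) h.1,
                none_of (hSsil s a u hsT (by omega) (by omega) haV) h.1]
          · have e := congrArg (fun i => i.inbox a) (hu t h3)
            simp only [inAt_inbox, if_pos h] at e
            rw [(hA.agree_before a).outAt_eq (by omega), (hS.agree_before a).outAt_eq (by omega)]
            exact e.symm
        · rfl
      have e1 := hA.request_eq_decide h1 h3 u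
      have e2 := hS.request_eq_decide h1 h3 u
      have e3 := hA.no_arrival h1 hAw u
      have e4 := hS.no_arrival h1 hSw u
      revert hi e1 e2 e3 e4
      rcases P.inAt N p A w t u with ⟨i, r, a⟩
      rcases P.inAt N p S w t u with ⟨i', r', a'⟩
      rintro ⟨⟩ ⟨⟩ ⟨⟩ ⟨⟩ ⟨⟩
      rfl
    · refine inAt_ext hAO ?_ ?_ fun s a hsT hst hadj => ?_
      · have huv : u ≠ v := fun e => hu (e ▸ vI)
        exact (hA.ext_eq (hf Q) h1 h3 hAw huv).1
      · have huv : u ≠ v := fun e => hu (e ▸ vI)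
        exact (hA.ext_eq (hf Q) h1 h3 hAw huv).2
      · rw [none_of (hsendQ s a u hsT (by omega)) hadj]
        by_cases ha : P.Agree N p O Q w a T'
        · rw [(hAS a ha).outAt_eq hst]
          apply none_of _ hadj
          intro hsend
          by_cases haV : a ∈ V
          · exact hu (agrOQ u (hVclosed s a u hsT (by omega) haV hsend))
          · exact hSsil s a u hsT (by omega) (by omega) haV hsend
        · rw [(hAQ a ha).outAt_eq hst]
          exact none_of (hsendQ s a u hsT (by omega)) hadj
  -- up to `t₀`, each processor behaves against `A` as against `S` or as against `Q`
  have main : ∀ t, T ≤ t → t ≤ t₀ →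
      (T < t → (P.conf N p A w t).status = .waiting v T) ∧
      (∀ u, P.Agree N p O Q w u T' → P.Agree N p A S w u t) ∧
      (∀ u, ¬ P.Agree N p O Q w u T' → P.Agree N p A Q w u t) := by
    intro t ht
    induction t, ht using Nat.le_induction with
    | base =>
      refine fun _ => ⟨fun h => absurd h (lt_irrefl _), fun u hu => ?_, fun u _ => hA.agree_before u⟩
      exact ((hA.agree_before u).trans (hu.mono hS.lt.le).symm).trans (hS.agree_before u).symm
    | succ t ht ih =>
      intro ht'
      obtain ⟨h1, h2, h3⟩ := ih (by omega)
      obtain ⟨h4, h5⟩ := hpulse t ht (by omega) (by omega) h1 h2 h3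
      refine ⟨fun _ => ?_, h4, h5⟩
      have hno : ∀ u, (P.outAt N p A w t u).assign = none := by
        intro u
        by_cases hu : P.Agree N p O Q w u T'
        · rw [(h4 u hu).outAt_eq (Nat.lt_succ_self t)]
          exact (hSwait (t + 1) (by omega) ht').2.2 t ht (Nat.lt_succ_self t) u
        · rw [(h5 u hu).outAt_eq (Nat.lt_succ_self t)]
          exact hA.assign_O (hf Q) ht (by omega) u
      rcases pulse_cases P N p A w (hf A (t + 1)) with ⟨-, hst, -⟩ | ⟨τ, z, u, s, hτ, -⟩
      · rw [hst]; exact hA.midStatus_eq ht h1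
      · rw [hno] at hτ; exact absurd hτ (by simp)
  obtain ⟨m1, m2, m3⟩ := main t₀ hh1 le_rfl
  have hlt : t₀ < T' := by
    refine lt_of_le_of_ne hh2 fun e => ?_
    rw [← e] at hidle
    rw [m1 (by rw [e]; exact hS.lt)] at hidle
    exact absurd hidle (by simp)
  obtain ⟨h4, h5⟩ := hpulse t₀ hh1 le_rfl hlt m1 m2 m3
  have hle := cost_le_of_sends (P := P) (N := N) (p := p) (A := S) (B := A) (w := w)
    (a := T) (b := t₀ + 1) (by omega) (by
      intro s a b h1 h2 hs
      by_cases ha : a ∈ V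
      · refine ⟨hs.1, ?_⟩
        rw [(h4 a (agrOQ a ha)).outAt_eq h2]
        exact hs.2
      · exact absurd hs (hSsil s a b h1 (by omega) (by omega) ha))
  have hmono := cost_mono P N p A w (show t₀ + 1 ≤ T' by omega)
  simp only at hmono
  have hQA : (P.conf N p Q w T).cost = (P.conf N p A w T).cost := by rw [hA.conf_eq le_rfl]
  have := Nat.le_findGreatest (P := fun t => (P.conf N p S w t).cost <
    (P.conf N p S w T).cost + r) (show t₀ + 1 ≤ T' by omega) (by omega)
  change t₀ + 1 ≤ t₀ at this
  omega

end Protocol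

/-! ### Expectations over the coins -/

namespace Protocol

variable {n k : ℕ}

/-- A sequence of coin vectors each of which has positive probability. -/
def Possible (P : Protocol n k) (w : ℕ → Fin n → P.Coin) : Prop :=
  ∀ t, w t ∈ P.coinLaw.support

/-- The list of the first `t` coin vectors, the latest first. -/
def coinPrefix (P : Protocol n k) (w : ℕ → Fin n → P.Coin) : ℕ → List (Fin n → P.Coin)
  | 0 => []
  | t + 1 => w t :: P.coinPrefix w t

/-- A list of coin vectors (the latest first), continued to an infinite sequence by a fixed coin
vector of positive probability. -/
noncomputable def coinSeq (P : Protocol n k) (l : List (Fin n → P.Coin)) (t : ℕ) :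
    Fin n → P.Coin :=
  l.reverse.getD t P.coinLaw.support_nonempty.some

/-- The expectation of a quantity that is determined by the coins of the first `T` pulses. -/
noncomputable def mean (P : Protocol n k) (T : ℕ) (F : (ℕ → Fin n → P.Coin) → ℝ≥0∞) : ℝ≥0∞ :=
  ∑' l, P.coins T l * F (P.coinSeq l)

open scoped Classical in
/-- The indicator of a proposition. -/
noncomputable def ind (q : Prop) : ℝ≥0∞ := if q then 1 else 0

theorem ind_le_one (q : Prop) : ind q ≤ 1 := by unfold ind; split_ifs <;> simp

theorem ind_of_true {q : Prop} (h : q) : ind q = 1 := by simp [ind, h]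

theorem ind_of_false {q : Prop} (h : ¬ q) : ind q = 0 := by simp [ind, h]

theorem ind_mono {q q' : Prop} (h : q → q') : ind q ≤ ind q' := by
  by_cases hq : q
  · rw [ind_of_true hq, ind_of_true (h hq)]
  · rw [ind_of_false hq]; exact zero_le

variable (P : Protocol n k) (N : Network n) (p : Fin k ↪ Fin n) (A : Adversary n k)

theorem coinSeq_cons_of_lt (ω : Fin n → P.Coin) {l : List (Fin n → P.Coin)} {t : ℕ}
    (ht : t < l.length) : P.coinSeq (ω :: l) t = P.coinSeq l t := by
  unfold coinSeq
  rw [List.reverse_cons, List.getD_append _ _ _ _ (by simpa using ht)]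

theorem coinSeq_cons_length (ω : Fin n → P.Coin) (l : List (Fin n → P.Coin)) :
    P.coinSeq (ω :: l) l.length = ω := by
  unfold coinSeq
  rw [List.reverse_cons, List.getD_append_right _ _ _ _ (by simp)]
  simp

theorem run_eq_conf (l : List (Fin n → P.Coin)) :
    P.run N p A l = P.conf N p A (P.coinSeq l) l.length := by
  induction l with
  | nil => rfl
  | cons ω l ih =>
    rw [List.length_cons]
    change P.pulse N A (P.run N p A l) ω = P.pulse N A _ (P.coinSeq (ω :: l) l.length)
    rw [coinSeq_cons_length, ih,
      conf_congr_coins P N p A (fun t ht => P.coinSeq_cons_of_lt ω ht) le_rfl]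

theorem run_coinPrefix (w : ℕ → Fin n → P.Coin) (t : ℕ) :
    P.run N p A (P.coinPrefix w t) = P.conf N p A w t := by
  induction t with
  | zero => rfl
  | succ t ih =>
    change P.pulse N A (P.run N p A (P.coinPrefix w t)) (w t) = _
    rw [ih]; rfl

theorem mem_support_coins_succ {T : ℕ} {l : List (Fin n → P.Coin)} :
    l ∈ (P.coins (T + 1)).support ↔
      ∃ l' ∈ (P.coins T).support, ∃ ω ∈ P.coinLaw.support, ω :: l' = l := by
  change l ∈ ((P.coins T).bind fun l => P.coinLaw.map fun ω => ω :: l).support ↔ _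
  simp

theorem coinPrefix_mem_support {w : ℕ → Fin n → P.Coin} (hw : P.Possible w) (t : ℕ) :
    P.coinPrefix w t ∈ (P.coins t).support := by
  induction t with
  | zero => simp [coinPrefix, coins]
  | succ t ih => exact (P.mem_support_coins_succ).2 ⟨_, ih, _, hw t, rfl⟩

theorem of_mem_support_coins {T : ℕ} {l : List (Fin n → P.Coin)} (hl : l ∈ (P.coins T).support) :
    l.length = T ∧ P.Possible (P.coinSeq l) := by
  have : l.length = T ∧ ∀ ω ∈ l, ω ∈ P.coinLaw.support := by
    induction T generalizing l with
    | zero =>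
      obtain rfl : l = [] := by simpa [coins] using hl
      simp
    | succ T ih =>
      obtain ⟨l', hl', ω, hω, rfl⟩ := (P.mem_support_coins_succ).1 hl
      obtain ⟨h1, h2⟩ := ih hl'
      refine ⟨by simp [h1], fun ω' h => ?_⟩
      rcases List.mem_cons.1 h with rfl | h
      · exact hω
      · exact h2 _ h
  refine ⟨this.1, fun t => ?_⟩
  unfold coinSeq
  rcases lt_or_ge t l.reverse.length with h | h
  · rw [List.getD_eq_getElem _ _ h]
    exact this.2 _ (List.mem_reverse.1 (List.getElem_mem h))
  · rw [List.getD_eq_default _ _ h]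
    exact P.coinLaw.support_nonempty.some_mem

theorem not_faulty_of_solves {P : Protocol n k} {N : Network n} (h : P.Solves N)
    (p : Fin k ↪ Fin n) {w : ℕ → Fin n → P.Coin}
    (hw : P.Possible w) (A : Adversary n k) (t : ℕ) : (P.conf N p A w t).faulty = false := by
  rw [← run_coinPrefix]
  exact (h p A).1 t _ (P.coinPrefix_mem_support hw t)

theorem mean_mono {T : ℕ} {F G : (ℕ → Fin n → P.Coin) → ℝ≥0∞}
    (h : ∀ w, P.Possible w → F w ≤ G w) : P.mean T F ≤ P.mean T G := by
  refine ENNReal.tsum_le_tsum fun l => ?_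
  by_cases hl : l ∈ (P.coins T).support
  · exact mul_le_mul_right (h _ (P.of_mem_support_coins hl).2) _
  · rw [PMF.mem_support_iff, not_not] at hl
    simp [hl]

theorem mean_add (T : ℕ) (F G : (ℕ → Fin n → P.Coin) → ℝ≥0∞) :
    P.mean T (fun w => F w + G w) = P.mean T F + P.mean T G := by
  unfold mean
  rw [← ENNReal.tsum_add]
  exact tsum_congr fun l => mul_add _ _ _

theorem mean_const_mul (T : ℕ) (c : ℝ≥0∞) (F : (ℕ → Fin n → P.Coin) → ℝ≥0∞) :
    P.mean T (fun w => c * F w) = c * P.mean T F := by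
  unfold mean
  rw [← ENNReal.tsum_mul_left]
  exact tsum_congr fun l => mul_left_comm _ _ _

theorem mean_const (T : ℕ) (c : ℝ≥0∞) : P.mean T (fun _ => c) = c := by
  unfold mean
  rw [ENNReal.tsum_mul_right, PMF.tsum_coe, one_mul]

theorem mean_sum {ι : Type*} (s : Finset ι) (T : ℕ) (F : ι → (ℕ → Fin n → P.Coin) → ℝ≥0∞) :
    P.mean T (fun w => ∑ i ∈ s, F i w) = ∑ i ∈ s, P.mean T (F i) := by
  classical
  induction s using Finset.induction_on with
  | empty => simpa using P.mean_const T 0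
  | insert a s ha ih =>
    simp only [Finset.sum_insert ha]
    rw [mean_add, ih]

theorem mean_succ {T : ℕ} {F : (ℕ → Fin n → P.Coin) → ℝ≥0∞}
    (hF : ∀ w w', (∀ s < T, w s = w' s) → F w = F w') : P.mean (T + 1) F = P.mean T F := by
  unfold mean
  have e : ∀ l, P.coins (T + 1) l =
      ∑' l', P.coins T l' * ∑' ω, P.coinLaw ω * PMF.pure (ω :: l') l := by
    intro l
    change ((P.coins T).bind fun l => P.coinLaw.map fun ω => ω :: l) l = _
    rw [PMF.bind_apply]
    refine tsum_congr fun l' => ?_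
    congr 1
  calc ∑' l, P.coins (T + 1) l * F (P.coinSeq l)
      = ∑' l, ∑' l', ∑' ω, P.coins T l' * (P.coinLaw ω * (PMF.pure (ω :: l') l *
          F (P.coinSeq l))) := by
        refine tsum_congr fun l => ?_
        rw [e, ← ENNReal.tsum_mul_right]
        refine tsum_congr fun l' => ?_
        rw [mul_assoc, ← ENNReal.tsum_mul_right, ← ENNReal.tsum_mul_left]
        exact tsum_congr fun ω => by rw [mul_assoc]
    _ = ∑' l', ∑' ω, ∑' l, P.coins T l' * (P.coinLaw ω * (PMF.pure (ω :: l') l *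
          F (P.coinSeq l))) := by
        rw [ENNReal.tsum_comm]
        exact tsum_congr fun l' => ENNReal.tsum_comm
    _ = ∑' l', P.coins T l' * F (P.coinSeq l') := by
        refine tsum_congr fun l' => ?_
        by_cases hl : l' ∈ (P.coins T).support
        · have h1 : ∀ ω, ∑' l, P.coins T l' * (P.coinLaw ω * (PMF.pure (ω :: l') l *
              F (P.coinSeq l))) = P.coinLaw ω * (P.coins T l' * F (P.coinSeq l')) := by
            intro ω
            rw [tsum_eq_single (ω :: l')]
            · have hlen := (P.of_mem_support_coins hl).1
              rw [hF (P.coinSeq (ω :: l')) (P.coinSeq l')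
                fun s hs => P.coinSeq_cons_of_lt ω (by omega)]
              simp only [PMF.pure_apply, if_true, one_mul]
              ring
            · intro l hne
              simp [PMF.pure_apply, hne]
          simp_rw [h1]
          rw [ENNReal.tsum_mul_right, PMF.tsum_coe, one_mul]
        · rw [PMF.mem_support_iff, not_not] at hl
          simp [hl]

/-- The expectation does not depend on how many further coins are taken into account. -/
theorem mean_eq {t T : ℕ} (h : t ≤ T) {F : (ℕ → Fin n → P.Coin) → ℝ≥0∞}
    (hF : ∀ w w', (∀ s < t, w s = w' s) → F w = F w') : P.mean T F = P.mean t F := by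
  induction T, h using Nat.le_induction with
  | base => rfl
  | succ T hT ih =>
    rw [mean_succ P fun w w' h => hF w w' fun s hs => h s (by omega), ih]

theorem mean_conf_eq {t T : ℕ} (h : t ≤ T) (f : Config P → ℝ≥0∞) :
    P.mean T (fun w => f (P.conf N p A w t)) = P.mean t (fun w => f (P.conf N p A w t)) :=
  P.mean_eq h fun w w' hw => by rw [conf_congr_coins P N p A hw le_rfl]

theorem expect_eq_mean (T : ℕ) (f : Config P → ℝ≥0∞) :
    P.expect N p A T f = P.mean T (fun w => f (P.conf N p A w T)) := by
  refine tsum_congr fun l => ?_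
  by_cases hl : l ∈ (P.coins T).support
  · rw [run_eq_conf, (P.of_mem_support_coins hl).1]
  · rw [PMF.mem_support_iff, not_not] at hl
    simp [hl]

/-! ### Waiting until the network is quiet -/

/-- The largest distance of two processors. -/
noncomputable def _root_.Network.diam (N : Network n) : ℕ :=
  Finset.univ.sup fun q : Fin n × Fin n => N.dist q.1 q.2

theorem _root_.Network.dist_le_diam (N : Network n) (u v : Fin n) : N.dist u v ≤ N.diam :=
  Finset.le_sup (f := fun q : Fin n × Fin n => N.dist q.1 q.2) (Finset.mem_univ (u, v))

/-- The adversary makes no request from time `T` on. -/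
def QuietFrom (A : Adversary n k) (T : ℕ) : Prop :=
  ∀ l : List (View n k), T < l.length → A l = none

variable {P N p A} {w : ℕ → Fin n → P.Coin}

theorem QuietFrom.reqAt_eq_none {T t : ℕ} (h : QuietFrom A T) (ht : T ≤ t) :
    P.reqAt N p A w t = none := by
  rw [reqAt_eq, h]
  · simp
  · rw [List.length_cons, conf_views_length]; omega

theorem waiting_time_lt {T t s : ℕ} {u : Fin n} (h : QuietFrom A T)
    (hf : ∀ t, (P.conf N p A w t).faulty = false)
    (hs : (P.conf N p A w t).status = .waiting u s) : s < T := by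
  induction t with
  | zero => exact absurd hs (by simp [conf, initConfig])
  | succ t ih =>
    rcases pulse_cases P N p A w (hf (t + 1)) with ⟨-, e, -⟩ | ⟨_, _, _, _, -, -, -, -, e⟩
    · rw [e] at hs
      rcases hq : P.reqAt N p A w t with _ | ⟨v, z⟩
      · unfold midStatus at hs
        rw [hq] at hs
        apply ih
        revert hs
        cases (P.conf N p A w t).status with
        | idle => exact id
        | waiting a b => exact id
        | moving z a b =>
          intro hs
          simp only [afterArrival] at hs
          split_ifs at hs
      · rw [midStatus_of_req hq] at hs
        obtain ⟨-, rfl⟩ := Status.waiting.inj hs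
        by_contra hc
        rw [h.reqAt_eq_none (by omega)] at hq
        exact absurd hq (by simp)
    · rw [e] at hs; exact absurd hs (by simp)

theorem midStatus_moving {t a : ℕ} {z : Fin k} {u : Fin n}
    (h : P.midStatus N p A w t = .moving z u a) :
    (P.conf N p A w t).status = .moving z u a ∧ t < a := by
  unfold midStatus at h
  rcases hq : P.reqAt N p A w t with _ | ⟨v, y⟩
  · rw [hq] at h
    revert h
    cases (P.conf N p A w t).status with
    | idle => simp [afterArrival]
    | waiting a b => simp [afterArrival]
    | moving z a b =>
      simp only [afterArrival]
      split_ifs with hb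
      · simp
      · intro e
        obtain ⟨rfl, rfl, rfl⟩ := Status.moving.inj e
        exact ⟨rfl, by omega⟩
  · rw [hq] at h; exact absurd h (by simp)

theorem moving_time_le {t a : ℕ} {z : Fin k} {u : Fin n}
    (hf : ∀ t, (P.conf N p A w t).faulty = false)
    (h : (P.conf N p A w t).status = .moving z u a) : a ≤ t + N.diam := by
  induction t with
  | zero => exact absurd h (by simp [conf, initConfig])
  | succ t ih =>
    rcases pulse_cases P N p A w (hf (t + 1)) with ⟨-, e, -⟩ | ⟨v, _, b, _, -, -, -, -, e⟩
    · rw [e] at h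
      have := ih (midStatus_moving h).1
      omega
    · rw [e] at h
      obtain ⟨-, -, rfl⟩ := Status.moving.inj h
      have := N.dist_le_diam v b
      omega

theorem idle_of_not_waiting {T t s : ℕ} (hq : QuietFrom A T)
    (hf : ∀ t, (P.conf N p A w t).faulty = false) (hT : T ≤ t)
    (h : ∀ u r, (P.conf N p A w t).status ≠ .waiting u r) (hs : t + N.diam + 1 ≤ s) :
    (P.conf N p A w s).status = .idle := by
  have key : ∀ r, t ≤ r → (P.conf N p A w r).status = .idle ∨
      ∃ z u a, (P.conf N p A w r).status = .moving z u a ∧ a ≤ t + N.diam ∧ (r ≤ a ∨ r = t) := by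
    intro r hr
    induction r, hr using Nat.le_induction with
    | base =>
      rcases hst : (P.conf N p A w t).status with _ | ⟨u, r⟩ | ⟨z, u, a⟩
      · exact Or.inl rfl
      · exact absurd hst (h u r)
      · exact Or.inr ⟨z, u, a, rfl, moving_time_le hf hst, Or.inr rfl⟩
    | succ r hr ih =>
      have hreq : P.reqAt N p A w r = none := hq.reqAt_eq_none (by omega)
      have hm : P.midStatus N p A w r = afterArrival r (P.conf N p A w r).status := by
        unfold midStatus; rw [hreq]
      rcases ih with ih | ⟨z, u, a, h1, h2, h3⟩
      · have hm' := midStatus_of_idle ih hreq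
        obtain ⟨-, e, -⟩ := pulse_of_not_waiting (hf (r + 1)) (by simp [hm'])
        exact Or.inl (e.trans hm')
      · rw [h1] at hm
        simp only [afterArrival] at hm
        split_ifs at hm with har
        · obtain ⟨-, e, -⟩ := pulse_of_not_waiting (hf (r + 1)) (by simp [hm])
          exact Or.inl (e.trans hm)
        · obtain ⟨-, e, -⟩ := pulse_of_not_waiting (hf (r + 1)) (by simp [hm])
          exact Or.inr ⟨z, u, a, e.trans hm, h2, Or.inl (by omega)⟩
  rcases key s (by omega) with h | ⟨_, _, _, _, h2, h3⟩
  · exact h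
  · omega

theorem advCost_le {T : ℕ} (hq : QuietFrom A T) (t : ℕ) :
    (P.conf N p A w t).advCost ≤ T * N.diam := by
  have : ∀ t, (P.conf N p A w t).advCost ≤ min t T * N.diam := by
    intro t
    induction t with
    | zero => exact Nat.zero_le _
    | succ t ih =>
      rw [conf_advCost_succ]
      rcases lt_or_ge t T with h | h
      · have e : min (t + 1) T = min t T + 1 := by omega
        rw [e, Nat.add_mul, Nat.one_mul]
        rcases P.reqAt N p A w t with _ | ⟨u, z⟩
        · exact ih.trans (Nat.le_add_right _ _)
        · exact Nat.add_le_add ih (N.dist_le_diam _ _)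
      · rw [hq.reqAt_eq_none h]
        have e : min (t + 1) T = min t T := by omega
        rw [e]; exact ih
  exact (this t).trans (Nat.mul_le_mul_right _ (min_le_right _ _))

/-- Up to probability `ε`, the network is idle at each time from `T` on, and no messages are sent
from time `T` on. -/
def QuietTime (P : Protocol n k) (N : Network n) (p : Fin k ↪ Fin n) (A : Adversary n k) (T : ℕ)
    (ε : ℝ≥0∞) : Prop :=
  ∀ t, T ≤ t → ∀ T', t ≤ T' →
    P.mean T' (fun w => ind ((P.conf N p A w t).status ≠ .idle)) ≤ ε ∧
    P.mean T' (fun w => ind ((P.conf N p A w t).cost ≠ (P.conf N p A w T).cost)) ≤ ε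

theorem QuietTime.mono {T T' : ℕ} {ε : ℝ≥0∞} (h : P.QuietTime N p A T ε) (hT : T ≤ T') :
    P.QuietTime N p A T' ε := by
  intro t ht t' ht'
  obtain ⟨h1, h2⟩ := h t (hT.trans ht) t' ht'
  refine ⟨h1, le_trans (P.mean_mono fun w _ => ind_mono fun hne => ?_) h2⟩
  have e1 := cost_mono P N p A w hT
  have e2 := cost_mono P N p A w ht
  simp only at e1 e2
  omega

/-- A protocol that solves the problem and is competitive becomes quiet after the last request:
the request gets served, and the expected total cost is finite. -/
theorem exists_quietTime {ρ : ℝ≥0} (hsol : P.Solves N) (hcomp : P.Competitive N ρ)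
    (p : Fin k ↪ Fin n) {T : ℕ} (hq : QuietFrom A T) {ε : ℝ≥0∞} (hε : ε ≠ 0) :
    ∃ T' ≥ T, P.QuietTime N p A T' ε := by
  have hf := fun w hw => not_faulty_of_solves (P := P) (N := N) hsol p (w := w) hw A
  -- the current request gets scheduled
  obtain ⟨T₁, hT₁⟩ : ∃ T₁, ∀ t ≥ T₁, P.mean t (fun w => ind (∃ u s, s ≤ T ∧
      (P.conf N p A w t).status = .waiting u s)) ≤ ε := by
    have := (hsol p A).2 T
    rw [ENNReal.tendsto_atTop_zero] at this
    obtain ⟨T₁, h⟩ := this ε (pos_iff_ne_zero.2 hε)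
    refine ⟨T₁, fun t ht => le_trans (le_of_eq ?_) (h t ht)⟩
    rw [PMF.toOuterMeasure_apply]
    refine tsum_congr fun l => ?_
    by_cases hl : l ∈ (P.coins t).support
    · have e : P.conf N p A (P.coinSeq l) t = P.run N p A l := by
        rw [run_eq_conf, (P.of_mem_support_coins hl).1]
      simp only [e]
      by_cases hc : ∃ u s, s ≤ T ∧ (P.run N p A l).status = .waiting u s
      · rw [ind_of_true hc, mul_one, Set.indicator_of_mem]; exact hc
      · rw [ind_of_false hc, mul_zero, Set.indicator_of_notMem]; exact hc
    · rw [PMF.mem_support_iff, not_not] at hl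
      simp only [hl, zero_mul]
      symm
      apply Set.indicator_apply_eq_zero.2
      intro; exact hl
  -- the expected cost converges
  set f : ℕ → ℝ≥0∞ := fun t => P.mean t fun w => ((P.conf N p A w t).cost : ℝ≥0∞) with hfdef
  have hfT : ∀ {t t'}, t ≤ t' →
      P.mean t' (fun w => ((P.conf N p A w t).cost : ℝ≥0∞)) = f t := fun h =>
    mean_conf_eq P N p A h fun c => (c.cost : ℝ≥0∞)
  have hmono : Monotone f := by
    intro s t hst
    rw [← hfT hst]
    exact P.mean_mono fun w _ => by exact_mod_cast cost_mono P N p A w hst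
  obtain ⟨b, hb⟩ := hcomp p
  have hbound : ∀ t, f t ≤ (ρ : ℝ≥0∞) * ((T * N.diam : ℕ) : ℝ≥0∞) + b := by
    intro t
    have := hb A t
    rw [expect_eq_mean, expect_eq_mean] at this
    refine this.trans (add_le_add_left (mul_le_mul_right ?_ _) _)
    calc _ ≤ P.mean t (fun _ => ((T * N.diam : ℕ) : ℝ≥0∞)) :=
          P.mean_mono fun w _ => by exact_mod_cast advCost_le hq t
      _ = _ := P.mean_const t _
  have hfin : ∀ t, f t ≠ ∞ := fun t =>
    ne_top_of_le_ne_top (ENNReal.add_ne_top.2 ⟨ENNReal.mul_ne_top ENNReal.coe_ne_top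
      (ENNReal.natCast_ne_top _), ENNReal.coe_ne_top⟩) (hbound t)
  have hsup : (⨆ t, f t) ≠ ∞ :=
    ne_top_of_le_ne_top (ENNReal.add_ne_top.2 ⟨ENNReal.mul_ne_top ENNReal.coe_ne_top
      (ENNReal.natCast_ne_top _), ENNReal.coe_ne_top⟩) (iSup_le hbound)
  obtain ⟨T₂, hT₂⟩ : ∃ T₂, (⨆ t, f t) ≤ f T₂ + ε := by
    have h1 := tendsto_atTop_iSup hmono
    have h2 := (ENNReal.tendsto_nhds hsup).1 h1 ε (pos_iff_ne_zero.2 hε)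
    obtain ⟨T₂, h3⟩ := h2.exists
    exact ⟨T₂, tsub_le_iff_right.1 h3.1⟩
  refine ⟨max (max T T₁ + N.diam + 1) T₂, by omega, fun t ht t' ht' => ⟨?_, ?_⟩⟩
  · -- `diam` pulses after it got scheduled, the request is served
    have hle : max T T₁ ≤ t' := by omega
    refine le_trans (P.mean_mono (G := fun w => ind (∃ u s, s ≤ T ∧
      (P.conf N p A w (max T T₁)).status = .waiting u s)) fun w hw => ind_mono fun hne => ?_) ?_
    · by_contra hc
      refine hne (idle_of_not_waiting hq (hf w hw) (le_max_left T T₁) (fun u r e => hc ?_) (by omega))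
      exact ⟨u, r, (waiting_time_lt hq (hf w hw) e).le, e⟩
    · rw [mean_conf_eq P N p A hle fun c => ind (∃ u s, s ≤ T ∧ c.status = .waiting u s)]
      exact hT₁ _ (le_max_right _ _)
  · set T₃ := max (max T T₁ + N.diam + 1) T₂ with hT₃
    have h1 : P.mean t' (fun w => ind ((P.conf N p A w t).cost ≠ (P.conf N p A w T₃).cost)) +
        f T₃ ≤ f t := by
      rw [← hfT ht', ← hfT (ht.trans ht'), ← mean_add]
      refine P.mean_mono fun w _ => ?_
      have hm : (P.conf N p A w T₃).cost ≤ (P.conf N p A w t).cost := cost_mono P N p A w ht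
      by_cases he : (P.conf N p A w t).cost = (P.conf N p A w T₃).cost
      · rw [ind_of_false (not_not.2 he), zero_add, he]
      · rw [ind_of_true he]
        have : 1 + (P.conf N p A w T₃).cost ≤ (P.conf N p A w t).cost := by omega
        exact_mod_cast this
    have h2 : f t ≤ ε + f T₃ :=
      calc f t ≤ ⨆ t, f t := le_iSup f t
        _ ≤ f T₂ + ε := hT₂
        _ ≤ ε + f T₃ := by
          rw [add_comm]
          exact add_le_add_right (hmono (le_max_right _ _)) _
    exact (ENNReal.add_le_add_iff_right (hfin T₃)).1 (h1.trans h2)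

end Protocol

/-! ### The lower bound by the number of servers -/

namespace Protocol

variable {n k : ℕ}

/-- Two configurations that differ at most in the servers and the cost of the adversary. -/
def SameSystem {P : Protocol n k} (c c' : Config P) : Prop :=
  c.time = c'.time ∧ c.state = c'.state ∧ c.sent = c'.sent ∧ c.tail = c'.tail ∧
    c.status = c'.status ∧ c.faulty = c'.faulty ∧ c.cost = c'.cost ∧ c.views = c'.views

/-- The protocol does not notice with which servers the adversary serves its requests. -/
theorem sameSystem_conf (P : Protocol n k) (N : Network n) (p : Fin k ↪ Fin n)
    {A B : Adversary n k} (h : ∀ l, (A l).map Prod.fst = (B l).map Prod.fst)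
    (w : ℕ → Fin n → P.Coin) (t : ℕ) :
    SameSystem (P.conf N p A w t) (P.conf N p B w t) := by
  induction t with
  | zero => exact ⟨rfl, rfl, rfl, rfl, rfl, rfl, rfl, rfl⟩
  | succ t ih =>
    obtain ⟨h1, h2, h3, h4, h5, h6, h7, h8⟩ := ih
    have hreq : (P.reqAt N p A w t).map Prod.fst = (P.reqAt N p B w t).map Prod.fst := by
      rw [reqAt_eq, reqAt_eq, h4, h5, h8]
      split_ifs
      · exact h _
      · rfl
    have hex : ∀ (r : Option (Fin n × Fin k)) (v : Fin n),
        (∃ z, r = some (v, z)) ↔ r.map Prod.fst = some v := by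
      intro r v
      rcases r with _ | ⟨u, z⟩ <;> simp
    have hin : ∀ v, P.inAt N p A w t v = P.inAt N p B w t v := by
      intro v
      have e1 : (P.inAt N p A w t v).inbox = (P.inAt N p B w t v).inbox := by
        unfold inAt inputOf
        simp only [h3]
        funext u
        split_ifs with a b b
        · rw [h1]
        · exact absurd (h1 ▸ a) b
        · exact absurd (h1 ▸ b) a
        · rfl
      have e2 : (P.inAt N p A w t v).request = (P.inAt N p B w t v).request := by
        rw [inAt_request, inAt_request]
        simp only [hex, hreq]
      have e3 : (P.inAt N p A w t v).arrival = (P.inAt N p B w t v).arrival := by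
        rw [inAt_arrival, inAt_arrival, h5]
      revert e1 e2 e3
      rcases P.inAt N p A w t v with ⟨i, r, a⟩
      rcases P.inAt N p B w t v with ⟨i', r', a'⟩
      rintro ⟨⟩ ⟨⟩ ⟨⟩
      rfl
    have hout : ∀ v, P.outAt N p A w t v = P.outAt N p B w t v := by
      intro v
      unfold outAt
      rw [hin, h2]
    have hmid : P.midStatus N p A w t = P.midStatus N p B w t := by
      unfold midStatus
      rw [h5]
      revert hreq
      rcases P.reqAt N p A w t with _ | ⟨u, z⟩ <;> rcases P.reqAt N p B w t with _ | ⟨u', z'⟩ <;>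
        simp
    have hres : P.resolvedAt N p A w t = P.resolvedAt N p B w t := by
      unfold resolvedAt
      simp only [h4, hmid, hout]
    obtain ⟨a1, a2, a3⟩ := conf_succ_resolved P N p A w t
    obtain ⟨b1, b2, b3⟩ := conf_succ_resolved P N p B w t
    refine ⟨by simp, ?_, ?_, ?_, ?_, ?_, ?_, ?_⟩
    · funext v
      rw [conf_state_succ, conf_state_succ, hin, h2]
    · rw [conf_sent_succ, conf_sent_succ, h3]
      simp only [hout]
    · rw [a1, b1, hres, h4]
    · rw [a2, b2, hres, hmid]
    · rw [a3, b3, hres, h6]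
    · rw [conf_cost_succ, conf_cost_succ, h7]
      have hs : P.Sends N p A w t = P.Sends N p B w t := by
        unfold Sends
        simp only [hout]
      rw [hs]
    · rw [conf_views_succ, conf_views_succ, h4, h5, h8]

open scoped Classical in
/-- A point among the `k + 1` points `e` at which no schedule ends, given the nodes of the last
requests of the `k` schedules. -/
noncomputable def holeOf (e : Option (Fin k) ↪ Fin n) (tail : Fin k → Fin n) : Option (Fin k) :=
  if h : ∃ a, e a ∉ Set.range tail then h.choose else none

theorem holeOf_eq {e : Option (Fin k) ↪ Fin n} {tail : Fin k → Fin n}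
    {τ : Equiv.Perm (Option (Fin k))} (h : ∀ z, tail z = e (τ (some z))) :
    holeOf e tail = τ none := by
  have hex : ∃ a, e a ∉ Set.range tail := by
    refine ⟨τ none, ?_⟩
    rintro ⟨z, hz⟩
    rw [h] at hz
    exact absurd (τ.injective (e.injective hz)) (by simp)
  unfold holeOf
  rw [dif_pos hex]
  have hs := hex.choose_spec
  set a := hex.choose
  rcases ha : τ.symm a with _ | z
  · rw [← ha, Equiv.apply_symm_apply]
  · exact absurd ⟨z, by rw [h, ← ha, Equiv.apply_symm_apply]⟩ hs

/-- The state of an offline algorithm on `k + 1` points: a bijection between the `k` servers with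
the hole (`none`) and the points, and the point of the last request. -/
abbrev AlgState (k : ℕ) : Type := Equiv.Perm (Option (Fin k)) × Option (Fin k)

/-- The server with which a request at `u` is served: the one at `u` if there is one, and otherwise
the one at the last request. -/
def serverFor (j : Fin k) (s : AlgState k) (u : Option (Fin k)) : Fin k :=
  ((s.1.symm u).orElse fun _ => s.1.symm s.2).getD j

/-- The state after a request at `u`. -/
def serve (j : Fin k) (s : AlgState k) (u : Option (Fin k)) : AlgState k :=
  (if s.1.symm u = none then s.1 * Equiv.swap none (some (serverFor j s u)) else s.1, u)

/-- The states of the `k` algorithms have a common last request `r`, and their holes are the `k`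
points different from `r`. -/
def Spread (S : Fin k → AlgState k) (r : Option (Fin k)) : Prop :=
  (∀ j, (S j).2 = r) ∧ (∀ j, (S j).1 none ≠ r) ∧ Function.Injective fun j => (S j).1 none

theorem serverFor_of_hole {j : Fin k} {s : AlgState k} {u : Option (Fin k)} (h : s.1 none = u)
    (hr : s.1 none ≠ s.2) : s.1 (some (serverFor j s u)) = s.2 := by
  have h1 : s.1.symm u = none := by rw [← h, Equiv.symm_apply_apply]
  unfold serverFor
  rw [h1]
  rcases h2 : s.1.symm s.2 with _ | z
  · exact absurd (by rw [← h2, Equiv.apply_symm_apply]) hr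
  · rw [(Equiv.symm_apply_eq _).1 h2]
    simp

theorem serverFor_of_not_hole {j : Fin k} {s : AlgState k} {u : Option (Fin k)}
    (h : s.1 none ≠ u) : s.1 (some (serverFor j s u)) = u := by
  unfold serverFor
  rcases h2 : s.1.symm u with _ | z
  · exact absurd (by rw [← h2, Equiv.apply_symm_apply]) h
  · rw [(Equiv.symm_apply_eq _).1 h2]
    simp

theorem serve_none {j : Fin k} {s : AlgState k} {u : Option (Fin k)} (hr : s.1 none ≠ s.2) :
    (serve j s u).1 none = if s.1 none = u then s.2 else s.1 none := by
  unfold serve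
  by_cases h : s.1 none = u
  · have h1 : s.1.symm u = none := by rw [← h, Equiv.symm_apply_apply]
    rw [if_pos h1, if_pos h, Equiv.Perm.mul_apply, Equiv.swap_apply_left,
      serverFor_of_hole h hr]
  · have h1 : s.1.symm u ≠ none := fun h1 => h (by rw [← h1, Equiv.apply_symm_apply])
    rw [if_neg h1, if_neg h]

theorem serve_some (j : Fin k) (s : AlgState k) (u : Option (Fin k)) (z : Fin k) :
    (serve j s u).1 (some z) = if z = serverFor j s u then u else s.1 (some z) := by
  unfold serve
  by_cases h : s.1 none = u
  · have h1 : s.1.symm u = none := by rw [← h, Equiv.symm_apply_apply]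
    rw [if_pos h1, Equiv.Perm.mul_apply]
    split_ifs with hz
    · rw [hz, Equiv.swap_apply_right, h]
    · rw [Equiv.swap_apply_of_ne_of_ne (by simp) (by simpa using hz)]
  · have h1 : s.1.symm u ≠ none := fun h1 => h (by rw [← h1, Equiv.apply_symm_apply])
    rw [if_neg h1]
    split_ifs with hz
    · rw [hz, serverFor_of_not_hole h]
    · rfl

theorem Spread.serve {S : Fin k → AlgState k} {r : Option (Fin k)} (h : Spread S r)
    (u : Option (Fin k)) : Spread (fun j => Protocol.serve j (S j) u) u := by
  obtain ⟨h1, h2, h3⟩ := h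
  have e : ∀ j, (Protocol.serve j (S j) u).1 none =
      if (S j).1 none = u then r else (S j).1 none := by
    intro j
    rw [serve_none (by rw [h1]; exact h2 j), h1]
  refine ⟨fun j => rfl, fun j => ?_, fun i j hij => ?_⟩
  · simp only [e]
    split_ifs with h
    · rw [← h]; exact (h2 j).symm
    · exact h
  · simp only [e] at hij
    apply h3
    simp only
    split_ifs at hij with a b b
    · rw [a, b]
    · exact absurd hij.symm (h2 j)
    · exact absurd hij (h2 i)
    · exact hij

theorem spread_serve_init : Spread (fun j : Fin k => serve j (1, some j) none) none := by
  have e : ∀ j : Fin k, (serve j (1, some j) none).1 none = some j := by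
    intro j
    rw [serve_none (by simp)]
    simp
  refine ⟨fun j => rfl, fun j => by rw [e]; simp, fun i j hij => ?_⟩
  simp only [e] at hij
  simpa using hij

open scoped Classical in
/-- The state of the `j`-th algorithm, as a function of what the adversary has seen, when requests
are invoked at the times in `R`, at the point that no schedule covers. -/
noncomputable def algState (e : Option (Fin k) ↪ Fin n) (R : Set ℕ) (j : Fin k) :
    List (View n k) → AlgState k
  | [] => (1, some j)
  | V :: l => if l.length ∈ R ∧ V.status = .idle then serve j (algState e R j l) (holeOf e V.tail)
      else algState e R j l

open scoped Classical in
/-- The adversary that requests, at the times in `R`, the one of the `k + 1` points that no schedule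
covers, and serves the requests by the `j`-th algorithm. -/
noncomputable def holeAdversary (e : Option (Fin k) ↪ Fin n) (R : Set ℕ) (j : Fin k) :
    Adversary n k
  | [] => none
  | V :: l => if l.length ∈ R ∧ V.status = .idle then
      some (e (holeOf e V.tail), serverFor j (algState e R j l) (holeOf e V.tail)) else none

open scoped Classical in
theorem algState_cons (e : Option (Fin k) ↪ Fin n) (R : Set ℕ) (j : Fin k) (V : View n k)
    (l : List (View n k)) : algState e R j (V :: l) =
      if l.length ∈ R ∧ V.status = .idle then serve j (algState e R j l) (holeOf e V.tail)
      else algState e R j l := rfl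

open scoped Classical in
theorem holeAdversary_cons (e : Option (Fin k) ↪ Fin n) (R : Set ℕ) (j : Fin k) (V : View n k)
    (l : List (View n k)) : holeAdversary e R j (V :: l) =
      if l.length ∈ R ∧ V.status = .idle then
        some (e (holeOf e V.tail), serverFor j (algState e R j l) (holeOf e V.tail))
      else none := rfl

theorem holeAdversary_fst (e : Option (Fin k) ↪ Fin n) (R : Set ℕ) (i j : Fin k)
    (l : List (View n k)) :
    (holeAdversary e R i l).map Prod.fst = (holeAdversary e R j l).map Prod.fst := by
  cases l with
  | nil => rfl
  | cons V l =>
    rw [holeAdversary_cons, holeAdversary_cons]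
    split_ifs <;> rfl

theorem holeAdversary_quietFrom {e : Option (Fin k) ↪ Fin n} {R : Set ℕ} (j : Fin k) {T : ℕ}
    (hR : ∀ s ∈ R, s < T) : QuietFrom (holeAdversary e R j) T := by
  intro l hl
  cases l with
  | nil => rfl
  | cons V l =>
    rw [holeAdversary_cons, if_neg]
    rintro ⟨h, -⟩
    have := hR _ h
    simp at hl
    omega

theorem algState_insert {e : Option (Fin k) ↪ Fin n} {R : Set ℕ} (j : Fin k) {T : ℕ}
    {l : List (View n k)} (hl : l.length ≤ T) :
    algState e (insert T R) j l = algState e R j l := by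
  induction l with
  | nil => rfl
  | cons V l ih =>
    have hl' : l.length < T := hl
    rw [algState_cons, algState_cons, ih hl'.le]
    have : l.length ∈ insert T R ↔ l.length ∈ R := by
      rw [Set.mem_insert_iff]; constructor
      · rintro (h | h)
        · omega
        · exact h
      · exact Or.inr
    split_ifs <;> first | rfl | tauto

theorem holeAdversary_insert {e : Option (Fin k) ↪ Fin n} {R : Set ℕ} (j : Fin k) {T : ℕ}
    {l : List (View n k)} (hl : l.length ≤ T) :
    holeAdversary e R j l = holeAdversary e (insert T R) j l := by
  cases l with
  | nil => rfl
  | cons V l =>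
    have hl' : l.length < T := hl
    rw [holeAdversary_cons, holeAdversary_cons, algState_insert j hl'.le]
    have : l.length ∈ insert T R ↔ l.length ∈ R := by
      rw [Set.mem_insert_iff]; constructor
      · rintro (h | h)
        · omega
        · exact h
      · exact Or.inr
    split_ifs <;> first | rfl | tauto

section Invariants

variable {P : Protocol n k} {N : Network n} {e : Option (Fin k) ↪ Fin n}
  {R : Set ℕ} {w : ℕ → Fin n → P.Coin}

/-- The execution against the `j`-th algorithm, from the placement at `e (some z)`. -/
noncomputable def holeConf (P : Protocol n k) (N : Network n) (e : Option (Fin k) ↪ Fin n)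
    (R : Set ℕ) (w : ℕ → Fin n → P.Coin) (j : Fin k) (t : ℕ) : Config P :=
  P.conf N (Function.Embedding.some.trans e) (holeAdversary e R j) w t

/-- The state of the `j`-th algorithm at time `t`. -/
noncomputable def holeState (P : Protocol n k) (N : Network n) (e : Option (Fin k) ↪ Fin n)
    (R : Set ℕ) (w : ℕ → Fin n → P.Coin) (t : ℕ) (j : Fin k) : AlgState k :=
  algState e R j (P.holeConf N e R w j t).views

/-- The total cost of the `k` algorithms. -/
noncomputable def holeSum (P : Protocol n k) (N : Network n) (e : Option (Fin k) ↪ Fin n)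
    (R : Set ℕ) (w : ℕ → Fin n → P.Coin) (t : ℕ) : ℕ :=
  ∑ j, (P.holeConf N e R w j t).advCost

theorem holeConf_same (i j : Fin k) (t : ℕ) :
    SameSystem (P.holeConf N e R w i t) (P.holeConf N e R w j t) :=
  sameSystem_conf P N _ (holeAdversary_fst e R i j) w t

theorem holeConf_reqAt (j : Fin k) (t : ℕ) :
    (t ∈ R ∧ afterArrival t (P.holeConf N e R w j t).status = .idle →
      P.reqAt N (Function.Embedding.some.trans e) (holeAdversary e R j) w t =
        some (e (holeOf e (P.holeConf N e R w j t).tail),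
          serverFor j (P.holeState N e R w t j) (holeOf e (P.holeConf N e R w j t).tail)) ∧
      P.holeState N e R w (t + 1) j =
        serve j (P.holeState N e R w t j) (holeOf e (P.holeConf N e R w j t).tail)) ∧
    (¬ (t ∈ R ∧ afterArrival t (P.holeConf N e R w j t).status = .idle) →
      P.reqAt N (Function.Embedding.some.trans e) (holeAdversary e R j) w t = none ∧
      P.holeState N e R w (t + 1) j = P.holeState N e R w t j) := by
  have hl : (P.conf N (Function.Embedding.some.trans e) (holeAdversary e R j) w t).views.length = t :=
    conf_views_length ..
  unfold holeState holeConf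
  constructor
  · intro h
    rw [reqAt_eq, if_pos h.2, conf_views_succ, holeAdversary_cons, algState_cons, hl]
    exact ⟨if_pos h, if_pos h⟩
  · intro h
    rw [reqAt_eq, conf_views_succ]
    constructor
    · split_ifs with hi
      · rw [holeAdversary_cons, hl]
        exact if_neg h
      · rfl
    · rw [algState_cons, hl]
      exact if_neg h

theorem holeConf_advPos (j : Fin k) (t : ℕ) (z : Fin k) :
    (P.holeConf N e R w j t).advPos z = e ((P.holeState N e R w t j).1 (some z)) := by
  induction t generalizing z with
  | zero => rfl
  | succ t ih =>
    unfold holeConf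
    rw [conf_advPos_succ]
    obtain ⟨h1, h2⟩ := holeConf_reqAt (P := P) (N := N) (e := e) (R := R) (w := w) j t
    by_cases h : t ∈ R ∧ afterArrival t (P.holeConf N e R w j t).status = .idle
    · obtain ⟨h3, h4⟩ := h1 h
      rw [h3, h4]
      simp only
      rw [serve_some]
      by_cases hz : z = serverFor j (P.holeState N e R w t j)
          (holeOf e (P.holeConf N e R w j t).tail)
      · rw [if_pos hz, hz, Function.update_self]
      · rw [if_neg hz, Function.update_of_ne hz]
        exact ih z
    · obtain ⟨h3, h4⟩ := h2 h
      rw [h3, h4]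
      exact ih z

theorem _root_.Network.dist_self (N : Network n) (u : Fin n) : N.dist u u = 0 :=
  Nat.le_zero.1 (N.dist_le_walk (SimpleGraph.Walk.nil : N.graph.Walk u u))

theorem holeConf_advCost_succ (j : Fin k) (t : ℕ) :
    (t ∈ R ∧ afterArrival t (P.holeConf N e R w j t).status = .idle →
      (P.holeConf N e R w j (t + 1)).advCost = (P.holeConf N e R w j t).advCost +
        N.dist (e ((P.holeState N e R w t j).1 (some (serverFor j (P.holeState N e R w t j)
          (holeOf e (P.holeConf N e R w j t).tail)))))
          (e (holeOf e (P.holeConf N e R w j t).tail))) ∧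
    (¬ (t ∈ R ∧ afterArrival t (P.holeConf N e R w j t).status = .idle) →
      (P.holeConf N e R w j (t + 1)).advCost = (P.holeConf N e R w j t).advCost) := by
  obtain ⟨h1, h2⟩ := holeConf_reqAt (P := P) (N := N) (e := e) (R := R) (w := w) j t
  constructor
  · intro h
    obtain ⟨h3, -⟩ := h1 h
    rw [← holeConf_advPos]
    unfold holeConf
    rw [conf_advCost_succ]
    unfold holeConf at h3
    rw [h3]
  · intro h
    obtain ⟨h3, -⟩ := h2 h
    unfold holeConf
    rw [conf_advCost_succ, h3]

/-- At most one of the algorithms has to move a server, from the last request. -/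
theorem sum_dist_serverFor_le {S : Fin k → AlgState k} {r : Option (Fin k)} (h : Spread S r)
    (u : Option (Fin k)) :
    ∑ j, N.dist (e ((S j).1 (some (serverFor j (S j) u)))) (e u) ≤ N.dist (e r) (e u) := by
  obtain ⟨h1, h2, h3⟩ := h
  have e1 : ∀ j, N.dist (e ((S j).1 (some (serverFor j (S j) u)))) (e u) =
      if (S j).1 none = u then N.dist (e r) (e u) else 0 := by
    intro j
    split_ifs with hj
    · rw [serverFor_of_hole hj (by rw [h1]; exact h2 j), h1]
    · rw [serverFor_of_not_hole hj, N.dist_self]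
  simp_rw [e1]
  rw [← Finset.sum_filter, Finset.sum_const, smul_eq_mul]
  have : (Finset.univ.filter fun j => (S j).1 none = u).card ≤ 1 := by
    refine Finset.card_le_one.2 fun a ha b hb => h3 ?_
    simp only [Finset.mem_filter] at ha hb
    simp only [ha.2, hb.2]
  calc _ ≤ 1 * N.dist (e r) (e u) := Nat.mul_le_mul_right _ this
    _ = _ := one_mul _

/-- The schedules end at all of the `k + 1` points but one, at which the pending request waits if
there is one; and the algorithms either have not started, or are spread over all configurations
that contain the last request. -/
def HoleInvariant (P : Protocol n k) (N : Network n) (e : Option (Fin k) ↪ Fin n)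
    (R : Set ℕ) (w : ℕ → Fin n → P.Coin) (j : Fin k) (t : ℕ) : Prop :=
  ∃ τ : Equiv.Perm (Option (Fin k)),
    (∀ z, (P.holeConf N e R w j t).tail z = e (τ (some z))) ∧
    (∀ u s, (P.holeConf N e R w j t).status = .waiting u s → u = e (τ none)) ∧
    (((∀ i, P.holeState N e R w t i = (1, some i)) ∧ τ = 1 ∧
        (P.holeConf N e R w j t).status = .idle ∧ P.holeSum N e R w t = 0) ∨
      ∃ r, Spread (P.holeState N e R w t) r)

/-- The effect of a pulse on the system of the `k` algorithms. -/
theorem hole_pulse (j : Fin k) (t : ℕ) :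
    (t ∈ R ∧ afterArrival t (P.holeConf N e R w j t).status = .idle →
      ∀ u, u = holeOf e (P.holeConf N e R w j t).tail →
      P.midStatus N (Function.Embedding.some.trans e) (holeAdversary e R j) w t =
        .waiting (e u) t ∧
      P.holeState N e R w (t + 1) = (fun i => serve i (P.holeState N e R w t i) u) ∧
      P.holeSum N e R w (t + 1) = P.holeSum N e R w t +
        ∑ i, N.dist (e ((P.holeState N e R w t i).1
          (some (serverFor i (P.holeState N e R w t i) u)))) (e u)) ∧
    (¬ (t ∈ R ∧ afterArrival t (P.holeConf N e R w j t).status = .idle) →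
      P.midStatus N (Function.Embedding.some.trans e) (holeAdversary e R j) w t =
        afterArrival t (P.holeConf N e R w j t).status ∧
      P.holeState N e R w (t + 1) = P.holeState N e R w t ∧
      P.holeSum N e R w (t + 1) = P.holeSum N e R w t) := by
  have hs : ∀ i, (P.holeConf N e R w i t).status = (P.holeConf N e R w j t).status :=
    fun i => (holeConf_same i j t).2.2.2.2.1
  have ht : ∀ i, (P.holeConf N e R w i t).tail = (P.holeConf N e R w j t).tail :=
    fun i => (holeConf_same i j t).2.2.2.1
  constructor
  · rintro h u rfl
    refine ⟨midStatus_of_req ((holeConf_reqAt j t).1 h).1, ?_, ?_⟩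
    · funext i
      rw [((holeConf_reqAt i t).1 (by rw [hs i]; exact h)).2, ht i]
    · unfold holeSum
      rw [← Finset.sum_add_distrib]
      refine Finset.sum_congr rfl fun i _ => ?_
      rw [(holeConf_advCost_succ i t).1 (by rw [hs i]; exact h), ht i]
  · intro h
    refine ⟨?_, ?_, ?_⟩
    · unfold midStatus
      rw [((holeConf_reqAt j t).2 h).1]
      rfl
    · funext i
      exact ((holeConf_reqAt i t).2 (by rw [hs i]; exact h)).2
    · unfold holeSum
      refine Finset.sum_congr rfl fun i _ => ?_
      exact (holeConf_advCost_succ i t).2 (by rw [hs i]; exact h)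

theorem holeInvariant (hf : ∀ (A : Adversary n k) t,
    (P.conf N (Function.Embedding.some.trans e) A w t).faulty = false) (j : Fin k) (t : ℕ) :
    HoleInvariant P N e R w j t := by
  induction t with
  | zero =>
    refine ⟨1, fun z => rfl, fun u s h => absurd h (by simp [holeConf, conf, initConfig]),
      Or.inl ⟨fun i => rfl, rfl, rfl, ?_⟩⟩
    exact Finset.sum_eq_zero fun i _ => rfl
  | succ t ih =>
    obtain ⟨τ, h1, h2, h3⟩ := ih
    obtain ⟨hreq, hno⟩ := hole_pulse (P := P) (N := N) (e := e) (R := R) (w := w) j t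
    have hp := pulse_cases P N (Function.Embedding.some.trans e) (holeAdversary e R j) w
      (hf _ (t + 1))
    have hmid : (∀ u s, P.midStatus N (Function.Embedding.some.trans e) (holeAdversary e R j) w t =
        .waiting u s → u = e (τ none)) ∧
        (((∀ i, P.holeState N e R w (t + 1) i = (1, some i)) ∧ τ = 1 ∧
          P.midStatus N (Function.Embedding.some.trans e) (holeAdversary e R j) w t = .idle ∧
          P.holeSum N e R w (t + 1) = 0) ∨ ∃ r, Spread (P.holeState N e R w (t + 1)) r) := by
      by_cases h : t ∈ R ∧ afterArrival t (P.holeConf N e R w j t).status = .idle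
      · obtain ⟨h4, h5, -⟩ := hreq h (τ none) (holeOf_eq h1).symm
        refine ⟨fun u s hs => ?_, Or.inr ?_⟩
        · rw [h4] at hs
          exact (Status.waiting.inj hs).1.symm
        · rcases h3 with ⟨h6, h7, -, -⟩ | ⟨r, hr⟩
          · refine ⟨none, ?_⟩
            rw [h5, h7]
            simp only [h6]
            exact spread_serve_init
          · exact ⟨τ none, by rw [h5]; exact hr.serve _⟩
      · obtain ⟨h4, h5, h6⟩ := hno h
        refine ⟨fun u s hs => h2 u s ?_, ?_⟩
        · rw [h4] at hs
          revert hs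
          cases (P.holeConf N e R w j t).status with
          | idle => exact id
          | waiting a b => exact id
          | moving z a b =>
            simp only [afterArrival]
            split_ifs <;> simp
        · rw [h4, h5, h6]
          rcases h3 with ⟨h7, h8, h9, h10⟩ | h3
          · exact Or.inl ⟨h7, h8, by rw [h9]; rfl, h10⟩
          · exact Or.inr h3
    obtain ⟨hm1, hm2⟩ := hmid
    rcases hp with ⟨-, hst, htl⟩ | ⟨v, z, u, s, -, hs, -, htl, hst⟩
    · refine ⟨τ, fun z => ?_, fun u s hs => hm1 u s ?_, ?_⟩
      · rw [← h1]; exact congrFun htl z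
      · rw [← hst]; exact hs
      · rcases hm2 with ⟨a, b, c, d⟩ | hm2
        · exact Or.inl ⟨a, b, hst.trans c, d⟩
        · exact Or.inr hm2
    · have hu := hm1 u s hs
      refine ⟨τ * Equiv.swap none (some z), fun y => ?_, fun a b hab => ?_, Or.inr ?_⟩
      · refine (congrFun htl y).trans ?_
        by_cases hy : y = z
        · rw [hy, Function.update_self, Equiv.Perm.mul_apply, Equiv.swap_apply_right, hu]
        · rw [Function.update_of_ne hy, Equiv.Perm.mul_apply,
            Equiv.swap_apply_of_ne_of_ne (by simp) (by simpa using hy)]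
          exact h1 y
      · have := hst.symm.trans hab
        exact absurd this (by simp)
      · rcases hm2 with ⟨a, b, c, d⟩ | hm2
        · rw [hs] at c; exact absurd c (by simp)
        · exact hm2

/-- The potential argument: the total cost of the `k` algorithms, plus the distance from the last
request to the uncovered point, is at most `X` up to the cost of a first request. -/
def HolePotential (P : Protocol n k) (N : Network n) (e : Option (Fin k) ↪ Fin n)
    (R : Set ℕ) (w : ℕ → Fin n → P.Coin) (j : Fin k) (t X : ℕ) : Prop :=
  ∀ r, Spread (P.holeState N e R w t) r → P.holeSum N e R w t +
    N.dist (e r) (e (holeOf e (P.holeConf N e R w j t).tail)) ≤ X + k * N.diam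

theorem holeConf_insert {T : ℕ} (j : Fin k) {t : ℕ} (ht : t ≤ T) :
    P.holeConf N e R w j t = P.holeConf N e (insert T R) w j t :=
  conf_congr P N _ _ _ w (fun _ hl => holeAdversary_insert j hl) ht

theorem holeState_insert {T : ℕ} {t : ℕ} (ht : t ≤ T) :
    P.holeState N e R w t = P.holeState N e (insert T R) w t := by
  funext j
  unfold holeState
  rw [← holeConf_insert j ht, algState_insert]
  unfold holeConf
  rw [conf_views_length]
  exact ht

theorem holeSum_insert {T : ℕ} {t : ℕ} (ht : t ≤ T) :
    P.holeSum N e R w t = P.holeSum N e (insert T R) w t :=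
  Finset.sum_congr rfl fun j _ => by rw [holeConf_insert j ht]

/-- Between requests, the system of the algorithms does not change. -/
theorem hole_const {T t : ℕ} (hR : ∀ s ∈ R, s < T) (ht : T ≤ t) (j : Fin k) :
    P.holeState N e R w t = P.holeState N e R w T ∧ P.holeSum N e R w t = P.holeSum N e R w T := by
  induction t, ht using Nat.le_induction with
  | base => exact ⟨rfl, rfl⟩
  | succ t ht ih =>
    obtain ⟨-, h2, h3⟩ := (hole_pulse (P := P) (N := N) (e := e) (R := R) (w := w) j t).2
      (fun h => by have := hR t h.1; omega)
    exact ⟨h2.trans ih.1, h3.trans ih.2⟩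

/-- The effect of a request at time `T` on the potential, in general and if the request is served
in a period that would otherwise be silent. -/
theorem HolePotential.step (hf : ∀ (A : Adversary n k) t,
      (P.conf N (Function.Embedding.some.trans e) A w t).faulty = false) (j : Fin k) {T T' X : ℕ}
    (hR : ∀ s ∈ R, s < T) (hT : T < T') (h : HolePotential P N e R w j T X) :
    HolePotential P N e (insert T R) w j T' (X + 2 * N.diam) ∧
    ((P.holeConf N e R w j T).status = .idle →
      (P.holeConf N e R w j T').cost = (P.holeConf N e R w j T).cost →
      (P.holeConf N e (insert T R) w j T').status = .idle →
      (∃ u v, u ≠ v ∧ N.dist u v + (P.holeConf N e R w j T).cost ≤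
        (P.holeConf N e (insert T R) w j T').cost) ∧
      ∀ Y, Y + (P.holeConf N e R w j T).cost =
          X + (P.holeConf N e (insert T R) w j T').cost →
        HolePotential P N e (insert T R) w j T' Y) := by
  have hk : 1 ≤ k := by have := j.2; omega
  have hkD : N.diam ≤ k * N.diam := Nat.le_mul_of_pos_left _ hk
  have hR' : ∀ s ∈ insert T R, s < T + 1 := by
    rintro s (rfl | hs)
    · omega
    · have := hR s hs; omega
  obtain ⟨hc1, hc2⟩ := hole_const (P := P) (N := N) (e := e) (w := w) hR' (show T + 1 ≤ T' from hT) j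
  obtain ⟨τ, h1, -, h3⟩ := holeInvariant (R := insert T R) hf j T
  obtain ⟨hreq, hno⟩ := hole_pulse (P := P) (N := N) (e := e) (R := insert T R) (w := w) j T
  unfold HolePotential at h
  rw [holeState_insert le_rfl, holeSum_insert le_rfl, holeConf_insert j (le_refl T),
    holeOf_eq h1] at h
  rw [holeConf_insert j (le_refl T)]
  -- the cost that the algorithms pay for the request
  have hsum : (T ∈ insert T R ∧
      afterArrival T (P.holeConf N e (insert T R) w j T).status = .idle) →
      Spread (P.holeState N e (insert T R) w T') (τ none) ∧
      P.holeSum N e (insert T R) w T' ≤ X + k * N.diam := by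
    intro hq
    obtain ⟨-, h5, h6⟩ := hreq hq (τ none) (holeOf_eq h1).symm
    rw [hc1, hc2, h5, h6]
    rcases h3 with ⟨a, b, -, d⟩ | ⟨r, hr⟩
    · constructor
      · rw [b]; simp only [a]; exact spread_serve_init
      · rw [d, zero_add]
        refine le_trans ?_ (Nat.le_add_left _ _)
        calc _ ≤ ∑ i : Fin k, N.diam := Finset.sum_le_sum fun i _ => N.dist_le_diam _ _
          _ = _ := by simp
    · refine ⟨hr.serve _, le_trans ?_ (h r hr)⟩
      exact Nat.add_le_add_left (sum_dist_serverFor_le hr _) _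
  constructor
  · intro r _
    have hd := N.dist_le_diam (e r) (e (holeOf e (P.holeConf N e (insert T R) w j T').tail))
    have hs : P.holeSum N e (insert T R) w T' ≤ X + k * N.diam := by
      by_cases hq : T ∈ insert T R ∧
          afterArrival T (P.holeConf N e (insert T R) w j T).status = .idle
      · exact (hsum hq).2
      · rw [hc2, (hno hq).2.2]
        rcases h3 with ⟨-, -, -, d⟩ | ⟨r, hr⟩
        · rw [d]; exact Nat.zero_le _
        · have := h r hr; omega
    omega
  · intro hidle hsil hidle'
    have hq : T ∈ insert T R ∧
        afterArrival T (P.holeConf N e (insert T R) w j T).status = .idle :=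
      ⟨Set.mem_insert _ _, by rw [hidle]; rfl⟩
    obtain ⟨hsp, hsm⟩ := hsum hq
    have hex : P.ExtraRequest N (Function.Embedding.some.trans e) (holeAdversary e R j)
        (holeAdversary e (insert T R) j) w T T' (e (τ none)) := by
      refine ⟨fun l hl => holeAdversary_insert j hl, hT, ?_, fun t h1 _ => ?_, ?_, fun t h1 _ => ?_⟩
      · have := holeConf_insert (P := P) (N := N) (e := e) (R := R) (w := w) j (le_refl T)
        unfold holeConf at this hidle
        rw [this]; exact hidle
      · exact (holeAdversary_quietFrom j hR).reqAt_eq_none h1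
      · have := ((holeConf_reqAt (P := P) (N := N) (w := w) j T).1 hq).1
        rw [holeOf_eq h1] at this
        exact ⟨_, this⟩
      · exact (holeAdversary_quietFrom j hR').reqAt_eq_none h1
    obtain ⟨z, hz1, hz2⟩ := hex.served (hf _) (hf _) (by
      have := holeConf_insert (P := P) (N := N) (e := e) (R := R) (w := w) j (le_refl T)
      rw [← this] at hsil
      exact hsil) hidle'
    have hTT := holeConf_insert (P := P) (N := N) (e := e) (R := R) (w := w) j (le_refl T)
    change (P.holeConf N e (insert T R) w j T').tail =
      Function.update (P.holeConf N e R w j T).tail z _ at hz1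
    change N.dist (e (τ none)) ((P.holeConf N e R w j T).tail z) +
      (P.holeConf N e R w j T).cost ≤ (P.holeConf N e (insert T R) w j T').cost at hz2
    rw [hTT, h1] at hz2
    rw [hTT] at hz1
    refine ⟨⟨_, _, fun hne => ?_, hz2⟩, fun Y hY r hr => ?_⟩
    · exact absurd (τ.injective (e.injective hne)) (by simp)
    · have hhole : holeOf e (P.holeConf N e (insert T R) w j T').tail = τ (some z) := by
        rw [holeOf_eq (τ := τ * Equiv.swap none (some z))]
        · simp
        · intro y
          rw [hz1]
          by_cases hy : y = z
          · rw [hy, Function.update_self, Equiv.Perm.mul_apply, Equiv.swap_apply_right]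
          · rw [Function.update_of_ne hy, Equiv.Perm.mul_apply,
              Equiv.swap_apply_of_ne_of_ne (by simp) (by simpa using hy)]
            exact h1 y
      have hrr : r = τ none := (hr.1 j).symm.trans (hsp.1 j)
      rw [hhole, hrr]
      omega

end Invariants

end Protocol

namespace Protocol

variable {n k : ℕ}

theorem _root_.Network.one_le_dist (N : Network n) {u v : Fin n} (h : u ≠ v) :
    1 ≤ N.dist u v := by
  have hne : {L : ℕ | ∃ q : N.graph.Walk u v, L = (q.edges.map N.weight).sum}.Nonempty :=
    ⟨_, (N.connected.preconnected u v).some, rfl⟩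
  obtain ⟨q, hq⟩ := Nat.sInf_mem hne
  change 1 ≤ sInf _
  rw [hq]
  cases q with
  | nil => exact absurd rfl h
  | cons hadj q =>
    rw [SimpleGraph.Walk.edges_cons, List.map_cons, List.sum_cons]
    exact (N.one_le_weight _ hadj).trans (Nat.le_add_right _ _)

theorem ind_or_le (a b : Prop) : ind (a ∨ b) ≤ ind a + ind b := by
  by_cases ha : a
  · rw [ind_of_true ha]; exact (ind_le_one _).trans le_self_add
  · exact (ind_mono fun h => h.resolve_left ha).trans le_add_self

/-- The hole adversary makes `J` requests, at times at which the network is likely to be quiet.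
Each request costs the protocol at least `1` and at least the distance over which the algorithms
will have to move together, unless it belongs to a bad period. -/
theorem exists_hole_requests {P : Protocol n k} {N : Network n} {ρ : ℝ≥0} (hsol : P.Solves N)
    (hcomp : P.Competitive N ρ) (e : Option (Fin k) ↪ Fin n) (j : Fin k) {ε : ℝ≥0∞} (hε : ε ≠ 0)
    (J : ℕ) :
    ∃ (R : Set ℕ) (T : ℕ) (bad : (ℕ → Fin n → P.Coin) → ℕ), (∀ s ∈ R, s < T) ∧
      P.QuietTime N (Function.Embedding.some.trans e) (holeAdversary e R j) T ε ∧
      (∀ w, P.Possible w →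
        HolePotential P N e R w j T ((P.holeConf N e R w j T).cost + 2 * N.diam * bad w) ∧
        J ≤ (P.holeConf N e R w j T).cost + bad w) ∧
      ∀ T' ≥ T, P.mean T' (fun w => (bad w : ℝ≥0∞)) ≤ J * (3 * ε) := by
  induction J with
  | zero =>
    have hR : ∀ s ∈ (∅ : Set ℕ), s < 0 := fun s hs => absurd hs (Set.notMem_empty s)
    obtain ⟨T, hT, hq⟩ := exists_quietTime hsol hcomp (Function.Embedding.some.trans e)
      (holeAdversary_quietFrom (e := e) j hR) hε
    refine ⟨∅, T, fun _ => 0, fun s hs => absurd hs (Set.notMem_empty s), hq, fun w _ => ⟨?_, ?_⟩,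
      fun T' _ => ?_⟩
    · intro r _
      have h0 : P.holeSum N e ∅ w T = 0 := by
        rw [(hole_const (P := P) (N := N) (e := e) (w := w) hR (Nat.zero_le T) j).2]
        exact Finset.sum_eq_zero fun i _ => rfl
      have hd := N.dist_le_diam (e r) (e (holeOf e (P.holeConf N e ∅ w j T).tail))
      have hkD : N.diam ≤ k * N.diam := Nat.le_mul_of_pos_left _ (by have := j.2; omega)
      omega
    · exact Nat.zero_le _
    · rw [Nat.cast_zero, P.mean_const, zero_mul, Nat.cast_zero]
  | succ J ih =>
    classical
    obtain ⟨R, T, bad, hR, hq, hpot, hbad⟩ := ih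
    have hR' : ∀ s ∈ insert T R, s < T + 1 := by
      rintro s (rfl | hs)
      · omega
      · have := hR s hs; omega
    obtain ⟨T', hT, hq'⟩ := exists_quietTime hsol hcomp (Function.Embedding.some.trans e)
      (holeAdversary_quietFrom (e := e) j hR') hε
    set B : (ℕ → Fin n → P.Coin) → Prop := fun w =>
      (P.holeConf N e R w j T).status ≠ .idle ∨
      (P.holeConf N e R w j T').cost ≠ (P.holeConf N e R w j T).cost ∨
      (P.holeConf N e (insert T R) w j T').status ≠ .idle with hB
    refine ⟨insert T R, T', fun w => bad w + if B w then 1 else 0,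
      fun s hs => (hR' s hs).trans_le hT, hq', fun w hw => ?_, fun t ht => ?_⟩
    · obtain ⟨h1, h2⟩ := hpot w hw
      obtain ⟨h3, h4⟩ := h1.step (not_faulty_of_solves hsol _ hw) j hR (show T < T' from hT)
      have hTT : (P.holeConf N e R w j T).cost = (P.holeConf N e (insert T R) w j T).cost := by
        rw [← holeConf_insert j (le_refl T)]
      have hmono : (P.holeConf N e (insert T R) w j T).cost ≤
          (P.holeConf N e (insert T R) w j T').cost :=
        cost_mono P N _ _ w (show T ≤ T' by omega)
      by_cases hb : B w
      · simp only [if_pos hb]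
        refine ⟨fun r hr => (h3 r hr).trans ?_, by omega⟩
        rw [Nat.mul_add, Nat.mul_one]
        omega
      · simp only [if_neg hb]
        simp only [hB, ne_eq, not_or, not_not] at hb
        obtain ⟨⟨u, v, huv, hle⟩, h5⟩ := h4 hb.1 hb.2.1 hb.2.2
        have := N.one_le_dist huv
        refine ⟨h5 _ ?_, by omega⟩
        rw [Nat.add_zero]
        omega
    · have e1 : ∀ w, ((bad w + if B w then 1 else 0 : ℕ) : ℝ≥0∞) = bad w + ind (B w) := by
        intro w
        unfold ind
        split_ifs <;> simp
      simp only [e1]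
      rw [mean_add]
      have hind : P.mean t (fun w => ind (B w)) ≤ 3 * ε := by
        calc P.mean t (fun w => ind (B w)) ≤ P.mean t (fun w =>
              ind ((P.holeConf N e R w j T).status ≠ .idle) +
              (ind ((P.holeConf N e R w j T').cost ≠ (P.holeConf N e R w j T).cost) +
              ind ((P.holeConf N e (insert T R) w j T').status ≠ .idle))) :=
            P.mean_mono fun w _ => (ind_or_le _ _).trans (add_le_add_right (ind_or_le _ _) _)
          _ ≤ ε + (ε + ε) := by
            rw [mean_add, mean_add]
            exact add_le_add (hq T le_rfl t (by omega)).1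
              (add_le_add (hq T' (by omega) t ht).2 (hq' T' le_rfl t ht).1)
          _ = 3 * ε := by ring
      calc _ ≤ J * (3 * ε) + 3 * ε := add_le_add (hbad t (by omega)) hind
        _ = _ := by push_cast; ring

/-- On every network with more than `k` processors, the competitive ratio is at least `k / 2`. -/
theorem servers_le_two_mul {P : Protocol n k} {N : Network n} {ρ : ℝ≥0} (hsol : P.Solves N)
    (hcomp : P.Competitive N ρ) (hk : 1 ≤ k) (hkn : k < n) : (k : ℝ) ≤ 2 * ρ := by
  obtain ⟨e⟩ : Nonempty (Option (Fin k) ↪ Fin n) := by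
    apply Function.Embedding.nonempty_of_card_le
    simpa using hkn
  set j₀ : Fin k := ⟨0, hk⟩
  set D := N.diam with hD
  set ε : ℝ≥0 := 1 / (12 * (D + 1)) with hε
  have hε0 : (ε : ℝ≥0∞) ≠ 0 := by
    rw [ENNReal.coe_ne_zero, hε]; positivity
  obtain ⟨b, hb⟩ := hcomp (Function.Embedding.some.trans e)
  -- after `J` requests
  have key : ∀ J : ℕ, ∃ a : ℝ≥0, (J : ℝ≥0) ≤ a + J * (3 * ε) ∧
      (k : ℝ≥0) * a ≤ ρ * (a + 2 * D * (J * (3 * ε)) + k * D) + k * b := by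
    intro J
    obtain ⟨R, T, bad, hR, hq, hpot, hbad⟩ := exists_hole_requests hsol hcomp e j₀ hε0 J
    set a : ℝ≥0∞ := P.mean T fun w => ((P.holeConf N e R w j₀ T).cost : ℝ≥0∞) with ha
    have hsame : ∀ j, P.mean T (fun w => ((P.holeConf N e R w j T).cost : ℝ≥0∞)) = a := fun j => by
      rw [ha]
      congr 1
      funext w
      rw [(holeConf_same j j₀ T).2.2.2.2.2.2.1]
    have hcj : ∀ j, a ≤ ρ * P.mean T (fun w => ((P.holeConf N e R w j T).advCost : ℝ≥0∞)) + b := by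
      intro j
      have := hb (holeAdversary e R j) T
      rw [expect_eq_mean, expect_eq_mean] at this
      rw [← hsame j]
      exact this
    have hafin : a ≠ ∞ := by
      refine ne_top_of_le_ne_top ?_ (hcj j₀)
      refine ENNReal.add_ne_top.2 ⟨ENNReal.mul_ne_top ENNReal.coe_ne_top ?_, ENNReal.coe_ne_top⟩
      refine ne_top_of_le_ne_top (b := ((T * N.diam : ℕ) : ℝ≥0∞)) (ENNReal.natCast_ne_top _) ?_
      rw [← P.mean_const T ((T * N.diam : ℕ) : ℝ≥0∞)]
      exact P.mean_mono fun w _ => by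
        exact_mod_cast advCost_le (holeAdversary_quietFrom j₀ hR) T
    have h1 : (J : ℝ≥0∞) ≤ a + J * (3 * ε) := by
      calc (J : ℝ≥0∞) = P.mean T (fun _ => (J : ℝ≥0∞)) := (P.mean_const T _).symm
        _ ≤ P.mean T (fun w => ((P.holeConf N e R w j₀ T).cost : ℝ≥0∞) + bad w) :=
          P.mean_mono fun w hw => by exact_mod_cast (hpot w hw).2
        _ ≤ _ := by
          rw [mean_add]
          exact add_le_add_right (hbad T le_rfl) _
    have h2 : P.mean T (fun w => (P.holeSum N e R w T : ℝ≥0∞)) ≤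
        a + 2 * D * (J * (3 * ε)) + k * D := by
      calc P.mean T (fun w => (P.holeSum N e R w T : ℝ≥0∞))
          ≤ P.mean T (fun w => ((P.holeConf N e R w j₀ T).cost : ℝ≥0∞) +
              (2 * D : ℝ≥0∞) * bad w + (k * D : ℝ≥0∞)) := by
            refine P.mean_mono fun w hw => ?_
            have : P.holeSum N e R w T ≤
                (P.holeConf N e R w j₀ T).cost + 2 * N.diam * bad w + k * N.diam := by
              obtain ⟨τ, -, -, h | ⟨r, hr⟩⟩ :=
                holeInvariant (R := R) (not_faulty_of_solves hsol _ hw) j₀ T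
              · rw [h.2.2.2]; exact Nat.zero_le _
              · have := (hpot w hw).1 r hr
                omega
            exact_mod_cast this
        _ ≤ _ := by
          rw [mean_add, mean_add, mean_const_mul, mean_const]
          gcongr
          exact hbad T le_rfl
    have h3 : (k : ℝ≥0∞) * a ≤ ρ * (a + 2 * D * (J * (3 * ε)) + k * D) + k * b := by
      calc (k : ℝ≥0∞) * a = ∑ _j : Fin k, a := by simp
        _ ≤ ∑ j : Fin k, (ρ * P.mean T (fun w => ((P.holeConf N e R w j T).advCost : ℝ≥0∞)) + b) :=
          Finset.sum_le_sum fun j _ => hcj j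
        _ = ρ * P.mean T (fun w => (P.holeSum N e R w T : ℝ≥0∞)) + k * b := by
          rw [Finset.sum_add_distrib, ← Finset.mul_sum, ← mean_sum]
          unfold holeSum
          simp
        _ ≤ _ := by gcongr
    clear_value a
    lift a to ℝ≥0 using hafin
    exact ⟨a, by exact_mod_cast h1, by exact_mod_cast h3⟩
  by_contra! hlt
  set δ : ℝ := k - 2 * ρ with hδ
  have hδ0 : 0 < δ := by linarith
  obtain ⟨J, hJ⟩ := exists_nat_gt ((ρ * (k * D) + k * b) / δ * 2)
  obtain ⟨a, h1, h2⟩ := key J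
  have h1' : (J : ℝ) ≤ a + J * (3 * ε) := by exact_mod_cast h1
  have h2' : (k : ℝ) * a ≤ ρ * (a + 2 * D * (J * (3 * ε)) + k * D) + k * b := by exact_mod_cast h2
  have hεr : (ε : ℝ) * (12 * (D + 1)) = 1 := by
    rw [hε]; push_cast; field_simp
  have hJ0 : (0 : ℝ) ≤ J := Nat.cast_nonneg J
  have hD0 : (0 : ℝ) ≤ D := Nat.cast_nonneg D
  have hε0' : (0 : ℝ) ≤ ε := ε.2
  have e1 : (D : ℝ) * ε ≤ 1 / 12 := by nlinarith
  have e2 : (ε : ℝ) ≤ 1 / 12 := by nlinarith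
  have e3 : (J : ℝ) / 2 ≤ a := by nlinarith
  have e4 : 2 * (D : ℝ) * (J * (3 * ε)) ≤ a := by nlinarith
  have e5 : δ * a ≤ ρ * (k * D) + k * b := by
    have := mul_le_mul_of_nonneg_left e4 ρ.2
    simp only [NNReal.val_eq_coe] at this
    rw [hδ]; nlinarith
  have e6 : (ρ * (k * D) + k * b) < δ * (J / 2) := by
    rw [div_mul_eq_mul_div, div_lt_iff₀ hδ0] at hJ
    linarith
  nlinarith

end Protocol

/-! ### Graphs without short cycles -/

namespace SimpleGraph

variable {V : Type*}

/-- Every walk between the ends of an edge that avoids the edge has length at least `g`; that is,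
all cycles have length more than `g`. -/
def DetourGE (H : SimpleGraph V) (g : ℕ) : Prop :=
  ∀ u v, H.Adj u v → ∀ q : H.Walk u v, s(u, v) ∉ q.edges → g ≤ q.length

/-- A walk in a graph with an additional edge `ab`, cut at the first and at the last use of `ab`. -/
theorem exists_walk_of_sup_edge {H : SimpleGraph V} {a b u v : V} (q : (H ⊔ edge a b).Walk u v) :
    (∃ q' : H.Walk u v, q'.length ≤ q.length ∧ ∀ e ∈ q'.edges, e ∈ q.edges) ∨
      ∃ c c', s(c, c') = s(a, b) ∧ ∃ (q₁ : H.Walk u c) (q₂ : H.Walk c' v),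
        q₁.length + q₂.length + 1 ≤ q.length ∧ ∀ e ∈ q₂.edges, e ∈ q.edges := by
  induction q with
  | nil => exact Or.inl ⟨Walk.nil, le_rfl, fun e he => he⟩
  | @cons u x v hadj q ih =>
    by_cases hH : H.Adj u x
    · rcases ih with ⟨q', h1, h2⟩ | ⟨c, c', hc, q₁, q₂, h1, h2⟩
      · refine Or.inl ⟨Walk.cons hH q', by simpa using h1, fun e he => ?_⟩
        rw [Walk.edges_cons, List.mem_cons] at he ⊢
        exact he.imp_right (h2 e)
      · refine Or.inr ⟨c, c', hc, Walk.cons hH q₁, q₂, ?_, fun e he => ?_⟩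
        · simp only [Walk.length_cons]; omega
        · rw [Walk.edges_cons, List.mem_cons]
          exact Or.inr (h2 e he)
    · have hux : s(u, x) = s(a, b) := by
        have := (sup_adj H (edge a b) u x).1 hadj
        rw [edge_adj] at this
        rcases this with h | h
        · exact absurd h hH
        · rw [Sym2.eq_iff]; exact h.1
      rcases ih with ⟨q', h1, h2⟩ | ⟨c, c', hc, q₁, q₂, h1, h2⟩
      · refine Or.inr ⟨u, x, hux, Walk.nil, q', ?_, fun e he => ?_⟩
        · simp only [Walk.length_cons, Walk.length_nil]; omega
        · rw [Walk.edges_cons, List.mem_cons]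
          exact Or.inr (h2 e he)
      · -- the last use of the edge ends at `u` or at `x`
        have hcc : c' = u ∨ c' = x := by
          have h3 : c' ∈ s(c, c') := Sym2.mem_mk_right c c'
          rw [hc, ← hux] at h3
          exact Sym2.mem_iff.1 h3
        rcases hcc with rfl | rfl
        · refine Or.inl ⟨q₂, ?_, fun e he => ?_⟩
          · simp only [Walk.length_cons]; omega
          · rw [Walk.edges_cons, List.mem_cons]
            exact Or.inr (h2 e he)
        · refine Or.inr ⟨u, c', hux, Walk.nil, q₂, ?_, fun e he => ?_⟩
          · simp only [Walk.length_cons, Walk.length_nil]; omega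
          · rw [Walk.edges_cons, List.mem_cons]
            exact Or.inr (h2 e he)

/-- Joining two vertices that are far apart creates no short cycle. -/
theorem DetourGE.sup_edge {H : SimpleGraph V} {g : ℕ} (h : H.DetourGE g) {a b : V}
    (hab : ∀ q : H.Walk a b, g ≤ q.length) : (H ⊔ edge a b).DetourGE g := by
  have hba : ∀ q : H.Walk b a, g ≤ q.length := fun q => by simpa using hab q.reverse
  have hcc : ∀ {c c'}, s(c, c') = s(a, b) → ∀ q : H.Walk c c', g ≤ q.length := by
    intro c c' hc q
    rw [Sym2.eq_iff] at hc
    rcases hc with ⟨rfl, rfl⟩ | ⟨rfl, rfl⟩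
    · exact hab q
    · exact hba q
  intro u v huv q hq
  by_cases hH : H.Adj u v
  · rcases exists_walk_of_sup_edge q with ⟨q', h1, h2⟩ | ⟨c, c', hc, q₁, q₂, h1, -⟩
    · exact (h u v hH q' fun he => hq (h2 _ he)).trans h1
    · have := hcc hc (q₁.reverse.append (Walk.cons hH q₂.reverse |>.copy rfl rfl))
      simp only [Walk.length_append, Walk.length_reverse, Walk.length_copy, Walk.length_cons]
        at this
      omega
  · have hs : s(u, v) = s(a, b) := by
      have := (sup_adj H (edge a b) u v).1 huv
      rw [edge_adj] at this
      rcases this with h | h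
      · exact absurd h hH
      · rw [Sym2.eq_iff]; exact h.1
    have havoid : ∀ {x y} (p : (H ⊔ edge a b).Walk x y), s(a, b) ∉ p.edges →
        ∃ p' : H.Walk x y, p'.length = p.length := by
      intro x y p
      induction p with
      | nil => exact fun _ => ⟨Walk.nil, rfl⟩
      | @cons x z y hadj p ih =>
        intro hp
        rw [Walk.edges_cons, List.mem_cons, not_or] at hp
        obtain ⟨p', hp'⟩ := ih hp.2
        have hxz : H.Adj x z := by
          have := (sup_adj H (edge a b) x z).1 hadj
          rw [edge_adj] at this
          rcases this with h | h
          · exact h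
          · exact absurd (Sym2.eq_iff.2 h.1).symm hp.1
        exact ⟨Walk.cons hxz p', by simp [hp']⟩
    obtain ⟨q', hq'⟩ := havoid q (hs ▸ hq)
    rw [← hq']
    exact hcc hs q'

/-- The number of vertices that can be reached by a short walk, if all degrees are at most `d`. -/
theorem card_ball_le [Fintype V] [DecidableEq V] {H : SimpleGraph V} [DecidableRel H.Adj] {d : ℕ}
    (hd : ∀ v, H.degree v ≤ d) (a : V) (i : ℕ) :
    ∃ B : Finset V, B.card ≤ (d + 1) ^ i ∧ ∀ v (q : H.Walk v a), q.length ≤ i → v ∈ B := by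
  induction i with
  | zero =>
    refine ⟨{a}, by simp, fun v q hq => ?_⟩
    cases q with
    | nil => simp
    | cons => simp at hq
  | succ i ih =>
    obtain ⟨B, h1, h2⟩ := ih
    refine ⟨B.biUnion fun v => insert v (H.neighborFinset v), ?_, fun v q hq => ?_⟩
    · refine Finset.card_biUnion_le.trans ?_
      calc ∑ v ∈ B, (insert v (H.neighborFinset v)).card ≤ ∑ _v ∈ B, (d + 1) :=
            Finset.sum_le_sum fun v _ => (Finset.card_insert_le _ _).trans
              (Nat.add_le_add_right (hd v) 1)
        _ ≤ (d + 1) ^ i * (d + 1) := by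
            rw [Finset.sum_const, smul_eq_mul]; exact Nat.mul_le_mul_right _ h1
        _ = (d + 1) ^ (i + 1) := (pow_succ _ _).symm
    · rw [Finset.mem_biUnion]
      cases q with
      | nil => exact ⟨a, h2 a Walk.nil (Nat.zero_le _), Finset.mem_insert_self _ _⟩
      | @cons _ x _ hadj q =>
        refine ⟨x, h2 x q (by simpa using hq), Finset.mem_insert_of_mem ?_⟩
        rw [mem_neighborFinset]; exact hadj.symm

open scoped Classical in
/-- A maximal graph among those with degrees at most `d` and without cycles of length at most `g`
has few vertices of degree less than `d`, since any two of them are close to each other. -/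
theorem exists_detourGE [Fintype V] (d g : ℕ) (hg : 2 ≤ g) :
    ∃ H : SimpleGraph V, H.DetourGE g ∧ (∀ v, H.degree v ≤ d) ∧
      (Finset.univ.filter fun v => H.degree v < d).card ≤ (d + 1) ^ g := by
  let F : Set (SimpleGraph V) := {H | H.DetourGE g ∧ ∀ v, H.degree v ≤ d}
  have hne : F.Nonempty := by
    refine ⟨⊥, fun u v h => absurd h (by simp), fun v => ?_⟩
    simp
  obtain ⟨H, hHF, hmax⟩ := (Set.toFinite F).exists_maximal hne
  obtain ⟨hH, hdeg⟩ := hHF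
  refine ⟨H, hH, hdeg, ?_⟩
  by_cases hcard : ∃ a, H.degree a < d
  · obtain ⟨a, ha⟩ := hcard
    obtain ⟨B, hB1, hB2⟩ := card_ball_le hdeg a g
    refine (Finset.card_le_card fun b hb => ?_).trans hB1
    replace hb : H.degree b < d := by simpa using hb
    by_contra hnB
    have hlong : ∀ q : H.Walk b a, g ≤ q.length := fun q => by
      by_contra hlt
      exact hnB (hB2 b q (by omega))
    have hba : b ≠ a := by
      rintro rfl
      exact hnB (hB2 b Walk.nil (Nat.zero_le _))
    have hnadj : ¬ H.Adj b a := fun h => by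
      have := hlong (Walk.cons h Walk.nil)
      simp at this
      omega
    have hmem : H ⊔ edge b a ∈ F := by
      refine ⟨hH.sup_edge hlong, fun v => ?_⟩
      have hsub : (H ⊔ edge b a).neighborFinset v ⊆ H.neighborFinset v ∪
          (if v = b then {a} else if v = a then {b} else ∅) := by
        intro x hx
        rw [mem_neighborFinset, sup_adj, edge_adj] at hx
        rw [Finset.mem_union, mem_neighborFinset]
        rcases hx with hx | ⟨⟨rfl, rfl⟩ | ⟨rfl, rfl⟩, -⟩
        · exact Or.inl hx
        · right; simp
        · right; rw [if_neg hba.symm]; simp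
      have hc := (Finset.card_le_card hsub).trans (Finset.card_union_le _ _)
      rw [card_neighborFinset_eq_degree, card_neighborFinset_eq_degree] at hc
      have := hdeg v
      have hfin : (H ⊔ edge b a).degree v ≤ d := by
        split_ifs at hc with h1 h2
        · subst h1; rw [Finset.card_singleton] at hc; omega
        · subst h2; rw [Finset.card_singleton] at hc; omega
        · rw [Finset.card_empty] at hc; omega
      convert hfin
    have hle := hmax hmem le_sup_left
    exact hnadj (hle (by rw [sup_adj, edge_adj]; exact Or.inr ⟨Or.inl ⟨rfl, rfl⟩, hba⟩))
  · push Not at hcard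
    rw [Finset.card_eq_zero.2]
    · exact Nat.zero_le _
    · exact Finset.filter_eq_empty_iff.2 fun v _ => not_lt.2 (hcard v)

end SimpleGraph

namespace SimpleGraph

variable {V : Type*}

/-- A vertex that is reachable over a set of edges of `H` is reachable by a walk that is no longer
than the number of these edges. -/
theorem exists_walk_of_reachable {H : SimpleGraph V} {E : Finset (Sym2 V)}
    (hE : ∀ e ∈ E, e ∈ H.edgeSet) {u v : V}
    (h : (fromEdgeSet (E : Set (Sym2 V))).Reachable u v) :
    ∃ q : H.Walk u v, q.length ≤ E.card ∧ (∀ e ∈ q.edges, e ∈ E) ∧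
      ∀ x ∈ q.support, (fromEdgeSet (E : Set (Sym2 V))).Reachable u x := by
  classical
  obtain ⟨q, hq⟩ := h.exists_isPath
  have hle : fromEdgeSet (E : Set (Sym2 V)) ≤ H := by
    intro a b hab
    rw [fromEdgeSet_adj] at hab
    exact hE _ hab.1
  have hqE : ∀ e ∈ q.edges, e ∈ E := fun e he => by
    have := q.edges_subset_edgeSet he
    rw [edgeSet_fromEdgeSet] at this
    exact this.1
  refine ⟨q.mapLe hle, ?_, by simpa using hqE, fun x hx => ?_⟩
  · have hlen : (q.mapLe hle).length = q.edges.toFinset.card := by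
      rw [List.toFinset_card_of_nodup hq.isTrail.edges_nodup]
      simp
    rw [hlen]
    exact Finset.card_le_card fun e he => hqE e (List.mem_toFinset.1 he)
  · have hx' : x ∈ q.support := by simpa using hx
    exact ⟨q.takeUntil x hx'⟩

/-- The parts of a graph without short cycles that different neighbours of `x` explore over few
edges, none of them the one to `x`, are disjoint. -/
theorem eq_of_reachable_of_detourGE {H : SimpleGraph V} {r : ℕ} (hH : H.DetourGE (2 * r))
    {x v v' u : V} (hv : H.Adj v x) (hv' : H.Adj v' x) {E E' : Finset (Sym2 V)}
    (hE : ∀ e ∈ E, e ∈ H.edgeSet) (hE' : ∀ e ∈ E', e ∈ H.edgeSet) (hc : E.card < r)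
    (hc' : E'.card < r) (hx : s(v, x) ∉ E) (hx' : s(v', x) ∉ E')
    (h : (fromEdgeSet (E : Set (Sym2 V))).Reachable v u)
    (h' : (fromEdgeSet (E' : Set (Sym2 V))).Reachable v' u) : v = v' := by
  by_contra hne
  obtain ⟨q, h1, h2, -⟩ := exists_walk_of_reachable hE h
  obtain ⟨q', h1', h2', h3'⟩ := exists_walk_of_reachable hE' h'
  -- `v'` does not explore `x`
  have hxq : x ∉ q'.support := by
    intro hmem
    obtain ⟨p, p1, p2, -⟩ := exists_walk_of_reachable hE' (h3' x hmem)
    have := hH v' x hv' p fun he => hx' (p2 _ he)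
    omega
  have := hH v x hv (q.append (q'.reverse.append (Walk.cons hv' Walk.nil))) (by
    simp only [Walk.edges_append, Walk.edges_reverse, Walk.edges_cons, Walk.edges_nil,
      List.mem_append, List.mem_reverse, List.mem_singleton]
    rintro (he | he | he)
    · exact hx (h2 _ he)
    · exact hxq (Walk.snd_mem_support_of_mem_edges _ he)
    · rw [Sym2.eq_iff] at he
      rcases he with ⟨e, -⟩ | ⟨e, -⟩
      · exact hne e
      · exact hv.ne e)
  simp only [Walk.length_append, Walk.length_reverse, Walk.length_cons, Walk.length_nil] at this
  omega

open scoped Classical in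
/-- Among the neighbours of `x`, few explore a given set `I` of vertices, apart from those that
explore the edge to `x`. -/
theorem card_hit_le {H : SimpleGraph V} {r : ℕ} (hH : H.DetourGE (2 * r))
    {x : V} {S : Finset V} (hS : ∀ v ∈ S, H.Adj v x) (E : V → Finset (Sym2 V))
    (hE : ∀ v ∈ S, ∀ e ∈ E v, e ∈ H.edgeSet) (hc : ∀ v ∈ S, (E v).card < r) (I : Finset V) :
    (S.filter fun v => ∃ u ∈ I, (fromEdgeSet (E v : Set (Sym2 V))).Reachable v u).card ≤
      I.card + (S.filter fun v => s(v, x) ∈ E v).card := by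
  set hit := S.filter fun v => ∃ u ∈ I, (fromEdgeSet (E v : Set (Sym2 V))).Reachable v u with hhit
  set Z := S.filter fun v => s(v, x) ∈ E v with hZ
  have h1 : hit.card ≤ (hit \ Z).card + Z.card := by
    calc hit.card ≤ ((hit \ Z) ∪ Z).card := Finset.card_le_card (by
          intro v hv; by_cases h : v ∈ Z <;> simp [h, hv])
      _ ≤ _ := Finset.card_union_le _ _
  refine h1.trans (Nat.add_le_add_right ?_ _)
  have hex : ∀ v : V, ∃ u, v ∈ hit \ Z →
      u ∈ I ∧ (fromEdgeSet (E v : Set (Sym2 V))).Reachable v u := by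
    intro v
    by_cases hv : v ∈ hit \ Z
    · obtain ⟨u, hu1, hu2⟩ := (Finset.mem_filter.1 (Finset.mem_sdiff.1 hv).1).2
      exact ⟨u, fun _ => ⟨hu1, hu2⟩⟩
    · exact ⟨v, fun h => absurd h hv⟩
  choose f hf using hex
  refine Finset.card_le_card_of_injOn f (fun v hv => (hf v hv).1) fun v hv v' hv' hff => ?_
  have hvS := (Finset.mem_filter.1 (Finset.mem_sdiff.1 hv).1).1
  have hvS' := (Finset.mem_filter.1 (Finset.mem_sdiff.1 hv').1).1
  have hx : s(v, x) ∉ E v := fun h =>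
    (Finset.mem_sdiff.1 hv).2 (Finset.mem_filter.2 ⟨hvS, h⟩)
  have hx' : s(v', x) ∉ E v' := fun h =>
    (Finset.mem_sdiff.1 hv').2 (Finset.mem_filter.2 ⟨hvS', h⟩)
  exact eq_of_reachable_of_detourGE hH (hS v hvS) (hS v' hvS') (hE v hvS) (hE v' hvS')
    (hc v hvS) (hc v' hvS') hx hx' (hf v hv).2 (hff ▸ (hf v' hv').2)

end SimpleGraph

/-! ### Distances, and a graph with a heavy star -/

namespace Network

variable {n : ℕ}

theorem exists_walk_dist (N : Network n) (u v : Fin n) :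
    ∃ q : N.graph.Walk u v, N.dist u v = (q.edges.map N.weight).sum :=
  Nat.sInf_mem (s := {L : ℕ | ∃ q : N.graph.Walk u v, L = (q.edges.map N.weight).sum})
    ⟨_, (N.connected.preconnected u v).some, rfl⟩

theorem dist_triangle (N : Network n) (u v x : Fin n) :
    N.dist u x ≤ N.dist u v + N.dist v x := by
  obtain ⟨q, hq⟩ := N.exists_walk_dist u v
  obtain ⟨q', hq'⟩ := N.exists_walk_dist v x
  rw [hq, hq']
  refine (N.dist_le_walk (q.append q')).trans ?_
  simp

theorem dist_le_weight (N : Network n) {u v : Fin n} (h : N.graph.Adj u v) :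
    N.dist u v ≤ N.weight s(u, v) := by
  refine (N.dist_le_walk (SimpleGraph.Walk.cons h SimpleGraph.Walk.nil)).trans ?_
  simp

open scoped Classical in
/-- The graph `H`, with edges of weight `1`, and a star with centre `c`, with edges of weight `r`,
which makes the distances at most `2 * r`. -/
noncomputable def withStar (H : SimpleGraph (Fin n)) (c : Fin n) (r : ℕ) (hr : 1 ≤ r) :
    Network n where
  graph := H ⊔ SimpleGraph.fromRel fun u _ => u = c
  connected := by
    have h : ∀ u, (H ⊔ SimpleGraph.fromRel fun u _ => u = c).Reachable u c := by
      intro u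
      by_cases hu : u = c
      · rw [hu]
      · refine SimpleGraph.Adj.reachable ?_
        rw [SimpleGraph.sup_adj, SimpleGraph.fromRel_adj]
        exact Or.inr ⟨hu, Or.inr rfl⟩
    have : Nonempty (Fin n) := ⟨c⟩
    exact ⟨fun u v => (h u).trans (h v).symm⟩
  weight := fun e => if e ∈ H.edgeSet then 1 else r
  one_le_weight := fun e _ => by split_ifs <;> omega

variable {H : SimpleGraph (Fin n)} {c : Fin n} {r : ℕ} {hr : 1 ≤ r}

theorem withStar_mem_edgeSet {e : Sym2 (Fin n)} (h : (withStar H c r hr).weight e < r) :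
    e ∈ H.edgeSet := by
  by_contra hn
  have : (withStar H c r hr).weight e = r := by
    unfold withStar
    exact if_neg hn
  omega

theorem withStar_dist_le_one {u v : Fin n} (h : H.Adj u v) : (withStar H c r hr).dist u v ≤ 1 := by
  have hadj : (withStar H c r hr).graph.Adj u v := (le_sup_left : H ≤ _) h
  refine (dist_le_weight _ hadj).trans (le_of_eq ?_)
  classical exact if_pos h

theorem withStar_diam_le : (withStar H c r hr).diam ≤ 2 * r := by
  have hw : ∀ e, (withStar H c r hr).weight e ≤ r := by
    intro e
    unfold withStar
    simp only
    split_ifs <;> omega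
  have h1 : ∀ u, (withStar H c r hr).dist u c ≤ r ∧ (withStar H c r hr).dist c u ≤ r := by
    intro u
    by_cases hu : u = c
    · rw [hu, Network.dist_self]; omega
    · have hadj : (withStar H c r hr).graph.Adj u c := by
        change (H ⊔ SimpleGraph.fromRel fun u _ => u = c).Adj u c
        rw [SimpleGraph.sup_adj, SimpleGraph.fromRel_adj]
        exact Or.inr ⟨hu, Or.inr rfl⟩
      exact ⟨(dist_le_weight _ hadj).trans (hw _), (dist_le_weight _ hadj.symm).trans (hw _)⟩
  refine Finset.sup_le fun q _ => ?_
  have := dist_triangle (withStar H c r hr) q.1 c q.2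
  have := (h1 q.1).1
  have := (h1 q.2).2
  omega

end Network

/-! ### Requests near a hidden centre -/

namespace Protocol

variable {n k : ℕ}

/-- The oblivious adversary that requests `sc t` at time `t` and always uses its server `z₀`. -/
def scriptAdversary (z₀ : Fin k) (sc : ℕ → Option (Fin n)) : Adversary n k
  | [] => none
  | _ :: l => (sc l.length).map fun u => (u, z₀)

variable {P : Protocol n k} {N : Network n} {p : Fin k ↪ Fin n} {z₀ : Fin k}
  {sc : ℕ → Option (Fin n)} {w : ℕ → Fin n → P.Coin}

theorem scriptAdversary_quietFrom {T : ℕ} (h : ∀ t ≥ T, sc t = none) :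
    QuietFrom (scriptAdversary z₀ sc) T := by
  intro l hl
  cases l with
  | nil => rfl
  | cons V l =>
    have : T ≤ l.length := by simp at hl; omega
    change (sc l.length).map _ = none
    rw [h _ this]; rfl

theorem scriptAdversary_congr {sc' : ℕ → Option (Fin n)} {T : ℕ} (h : ∀ t < T, sc t = sc' t)
    (l : List (View n k)) (hl : l.length ≤ T) :
    scriptAdversary z₀ sc l = scriptAdversary z₀ sc' l := by
  cases l with
  | nil => rfl
  | cons V l =>
    change (sc l.length).map _ = (sc' l.length).map _
    rw [h _ hl]

open scoped Classical in
theorem scriptAdversary_reqAt (t : ℕ) : P.reqAt N p (scriptAdversary z₀ sc) w t =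
    if afterArrival t (P.conf N p (scriptAdversary z₀ sc) w t).status = .idle then
      (sc t).map fun u => (u, z₀) else none := by
  rw [reqAt_eq]
  change (if _ then (sc (P.conf N p (scriptAdversary z₀ sc) w t).views.length).map _ else _) = _
  rw [conf_views_length]

theorem extraRequest_script {T T' : ℕ} (hsc : ∀ t ≥ T, sc t = none) (hT : T < T') (v : Fin n)
    (hidle : (P.conf N p (scriptAdversary z₀ sc) w T).status = .idle) :
    P.ExtraRequest N p (scriptAdversary z₀ sc)
      (scriptAdversary z₀ (Function.update sc T (some v))) w T T' v := by
  have heq : ∀ l : List (View n k), l.length ≤ T →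
      scriptAdversary z₀ sc l = scriptAdversary z₀ (Function.update sc T (some v)) l :=
    scriptAdversary_congr fun t ht => by rw [Function.update_of_ne (by omega)]
  refine ⟨heq, hT, hidle, fun t h1 _ => ?_, ⟨z₀, ?_⟩, fun t h1 _ => ?_⟩
  · exact (scriptAdversary_quietFrom hsc).reqAt_eq_none h1
  · rw [scriptAdversary_reqAt, ← conf_congr P N p _ _ w heq le_rfl, hidle, Function.update_self]
    exact if_pos rfl
  · rw [scriptAdversary_reqAt, Function.update_of_ne (by omega), hsc t (by omega)]
    simp

open scoped Classical in
/-- The processors that can tell apart the scripts `sc` and `sq` before time `T`, and those at which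
a schedule ends at time `t` under the script `sc`. -/
noncomputable def informed (P : Protocol n k) (N : Network n) (p : Fin k ↪ Fin n) (z₀ : Fin k)
    (sc sq : ℕ → Option (Fin n)) (w : ℕ → Fin n → P.Coin) (t T : ℕ) : Finset (Fin n) :=
  Finset.univ.filter fun u =>
    ¬ P.Agree N p (scriptAdversary z₀ sc) (scriptAdversary z₀ sq) w u T ∨
      ∃ z, (P.conf N p (scriptAdversary z₀ sc) w t).tail z = u

/-- The number of processors that are informed of the requests since `t₀` is bounded by the number
of these requests and the messages sent since then. -/
theorem card_informed_le {sq : ℕ → Option (Fin n)} {t₀ t T : ℕ} {Y : Finset (Fin n)}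
    (hf : ∀ (A : Adversary n k) t, (P.conf N p A w t).faulty = false)
    (hsc : ∀ s ≥ t₀, sc s = none) (hT : t₀ < T)
    (hagree : ∀ s < t₀, sc s = sq s)
    (hY : ∀ s u, t₀ ≤ s → sq s = some u → u ∈ Y)
    (hidle : (P.conf N p (scriptAdversary z₀ sc) w t₀).status = .idle)
    (hsil : (P.conf N p (scriptAdversary z₀ sc) w T).cost =
      (P.conf N p (scriptAdversary z₀ sc) w t₀).cost) :
    (informed P N p z₀ sc sq w t T).card + (P.conf N p (scriptAdversary z₀ sc) w t₀).cost ≤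
      k + Y.card + (P.conf N p (scriptAdversary z₀ sq) w T).cost := by
  classical
  set O := scriptAdversary z₀ sc (k := k)
  set Q := scriptAdversary z₀ sq (k := k)
  have hOQ : ∀ l : List (View n k), l.length ≤ t₀ → O l = Q l := scriptAdversary_congr hagree
  have hconf : P.conf N p O w t₀ = P.conf N p Q w t₀ := conf_congr P N p O Q w hOQ le_rfl
  have hOidle : ∀ s, t₀ ≤ s → (P.conf N p O w s).status = .idle := fun s hs =>
    (idle_of_no_req (hf O) hs hidle fun r hr _ =>
      (scriptAdversary_quietFrom hsc).reqAt_eq_none hr).1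
  have hreqQ : ∀ s u z, t₀ ≤ s → P.reqAt N p Q w s = some (u, z) → u ∈ Y := by
    intro s u z hs h
    rw [scriptAdversary_reqAt] at h
    split_ifs at h
    rw [Option.map_eq_some_iff] at h
    obtain ⟨u', h1, h2⟩ := h
    exact hY s u hs (h1.trans (by rw [(Prod.mk.inj h2).1]))
  have hsub : informed P N p z₀ sc sq w t T ⊆
      (Y ∪ P.receivers N p Q w t₀ T) ∪ Finset.univ.image (P.conf N p O w t).tail := by
    intro u hu
    rw [Finset.mem_union]
    rcases (Finset.mem_filter.1 hu).2 with h | ⟨z, hz⟩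
    · left
      by_contra hn
      apply h
      have key := agree_of_notMem (P := P) (N := N) (p := p) (A := O) (B := Q) (w := w)
        (C := (↑(Y ∪ P.receivers N p Q w t₀ T) : Set (Fin n))) (T := t₀) (t := T - 1)
        (fun v => agree_of_conf_eq hOQ v) (fun s hs hsT v hv => ?_) (fun s a b hs hsT ha hab => ?_)
        u (by simpa using hn)
      · rwa [Nat.sub_add_cancel (by omega)] at key
      · have hvY : v ∉ Y := fun h => hv (by simp [h])
        constructor
        · rw [request_of_none v ((scriptAdversary_quietFrom hsc).reqAt_eq_none hs)]
          rcases hq : P.reqAt N p Q w s with _ | ⟨a, z⟩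
          · rw [request_of_none v hq]
          · rw [request_of_ne hq]
            rintro rfl
            exact hvY (hreqQ s a z hs hq)
        · rw [arrival_of_idle v (hOidle s hs), arrival_of_pendingNode_ne]
          intro hp
          refine hvY (pendingNode_mem (C := (↑Y : Set (Fin n))) (hf Q) hs
            (by rw [← hconf]; exact hidle) (fun r a z hr _ h => hreqQ r a z hr h) hp)
      · rcases hab with hab | hab
        · exact absurd hab (not_sends_of_cost_eq hsil hs (by omega) a b)
        · have : b ∈ P.receivers N p Q w t₀ T :=
            Finset.mem_filter.2 ⟨Finset.mem_univ _, s, a, hs, by omega, hab⟩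
          simp [this]
    · exact Or.inr (Finset.mem_image.2 ⟨z, Finset.mem_univ _, hz⟩)
  have h1 := (Finset.card_le_card hsub).trans ((Finset.card_union_le _ _).trans
    (Nat.add_le_add_right (Finset.card_union_le _ _) _))
  have h2 : (Finset.univ.image (P.conf N p O w t).tail).card ≤ k :=
    Finset.card_image_le.trans (by simp)
  have h3 := card_receivers_le (P := P) (N := N) (p := p) (A := Q) (w := w) hT.le
  rw [← hconf] at h3
  omega

/-- The edges that a request at `v` at time `t` explores, at a cost below `r`, if nothing has been
requested after the script `sc`. -/
noncomputable def soloEdges (P : Protocol n k) (N : Network n) (p : Fin k ↪ Fin n) (z₀ : Fin k)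
    (sc : ℕ → Option (Fin n)) (w : ℕ → Fin n → P.Coin) (t T r : ℕ) (v : Fin n) :
    Finset (Sym2 (Fin n)) :=
  P.exploredEdges N p (scriptAdversary z₀ (Function.update sc t (some v))) w t T r

/-- The events that spoil the period from `t` to `T`, apart from the service of the new request:
the network is not idle at the beginning, or not silent without the new request. -/
def Disturbed (P : Protocol n k) (N : Network n) (p : Fin k ↪ Fin n) (z₀ : Fin k)
    (sc sq : ℕ → Option (Fin n)) (w : ℕ → Fin n → P.Coin) (t₀ t T : ℕ) : Prop :=
  (P.conf N p (scriptAdversary z₀ sc) w t₀).status ≠ .idle ∨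
  (P.conf N p (scriptAdversary z₀ sc) w T).cost ≠
    (P.conf N p (scriptAdversary z₀ sc) w t₀).cost ∨
  (P.conf N p (scriptAdversary z₀ sq) w t).status ≠ .idle ∨
  (P.conf N p (scriptAdversary z₀ sq) w T).cost ≠ (P.conf N p (scriptAdversary z₀ sq) w t).cost

open scoped Classical in
/-- After the script `sq`, which continues `sc` from time `t₀` on, a further request at a neighbour
of `x` costs `r` on average over the neighbours, up to the number of informed processors and of
neighbours that explore the edge to `x`. -/
theorem sum_window_cost {H : SimpleGraph (Fin n)} {r : ℕ} (hr : 0 < r)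
    (hH : H.DetourGE (2 * r)) (hN : ∀ e ∈ N.graph.edgeSet, N.weight e < r → e ∈ H.edgeSet)
    {x : Fin n} {S : Finset (Fin n)} (hS : ∀ v ∈ S, H.Adj v x)
    {sq : ℕ → Option (Fin n)} {t₀ t T : ℕ} {Y : Finset (Fin n)}
    (hf : ∀ (A : Adversary n k) t, (P.conf N p A w t).faulty = false)
    (hsc : ∀ s ≥ t₀, sc s = none) (ht : t₀ ≤ t) (hT : t < T)
    (hagree : ∀ s < t₀, sc s = sq s) (hsq : ∀ s ≥ t, sq s = none)
    (hY : ∀ s u, t₀ ≤ s → sq s = some u → u ∈ Y) :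
    S.card * (r + ((P.conf N p (scriptAdversary z₀ sq) w t).cost -
        (P.conf N p (scriptAdversary z₀ sc) w t₀).cost)) ≤
      (∑ v ∈ S, ((P.conf N p (scriptAdversary z₀ (Function.update sq t (some v))) w T).cost -
        (P.conf N p (scriptAdversary z₀ sc) w t₀).cost)) +
      r * ((∑ v ∈ S, if Disturbed P N p z₀ sc sq w t₀ t T ∨
          (P.conf N p (scriptAdversary z₀ (Function.update sq t (some v))) w T).status ≠ .idle
          then 1 else 0) +
        (k + Y.card + ((P.conf N p (scriptAdversary z₀ sq) w t).cost -
          (P.conf N p (scriptAdversary z₀ sc) w t₀).cost)) +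
        (S.filter fun v => s(v, x) ∈ soloEdges P N p z₀ sc w t T r v).card) := by
  set O := scriptAdversary z₀ sc (k := k) with hO
  set Q := scriptAdversary z₀ sq (k := k) with hQ
  have hOQ : ∀ l : List (View n k), l.length ≤ t₀ → O l = Q l := scriptAdversary_congr hagree
  have hQA : ∀ v, P.conf N p (scriptAdversary z₀ (Function.update sq t (some v))) w t =
      P.conf N p Q w t := fun v =>
    conf_congr P N p _ _ w (scriptAdversary_congr fun s hs => by
      rw [Function.update_of_ne (by omega)]) le_rfl
  have hmono : ∀ v, (P.conf N p Q w t).cost ≤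
      (P.conf N p (scriptAdversary z₀ (Function.update sq t (some v))) w T).cost := fun v => by
    rw [← hQA v]; exact cost_mono P N p _ w hT.le
  by_cases hd : Disturbed P N p z₀ sc sq w t₀ t T
  · -- nothing is claimed about a disturbed period
    simp only [hd, true_or, if_true]
    rw [Finset.sum_const, smul_eq_mul, mul_one, Nat.mul_add, Nat.mul_add, Nat.mul_add]
    have : S.card * ((P.conf N p Q w t).cost - (P.conf N p O w t₀).cost) ≤
        ∑ v ∈ S, ((P.conf N p (scriptAdversary z₀ (Function.update sq t (some v))) w T).cost -
          (P.conf N p O w t₀).cost) := by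
      rw [← smul_eq_mul, ← Finset.sum_const]
      exact Finset.sum_le_sum fun v _ => Nat.sub_le_sub_right (hmono v) _
    rw [Nat.mul_comm S.card r]
    omega
  · have hd' := hd
    simp only [Disturbed, ne_eq, not_or, not_not] at hd'
    obtain ⟨h1, h2, h3, h4⟩ : (P.conf N p O w t₀).status = .idle ∧
        (P.conf N p O w T).cost = (P.conf N p O w t₀).cost ∧ (P.conf N p Q w t).status = .idle ∧
        (P.conf N p Q w T).cost = (P.conf N p Q w t).cost := hd'
    have hcO : (P.conf N p O w t).cost = (P.conf N p O w t₀).cost := by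
      have a1 : (P.conf N p O w t₀).cost ≤ (P.conf N p O w t).cost := cost_mono P N p _ w ht
      have a2 : (P.conf N p O w t).cost ≤ (P.conf N p O w T).cost := cost_mono P N p _ w hT.le
      omega
    have hidleO : (P.conf N p O w t).status = .idle :=
      (idle_of_no_req (hf O) ht h1 fun r hr _ =>
        (scriptAdversary_quietFrom hsc).reqAt_eq_none hr).1
    have hEH : ∀ v, ∀ e ∈ soloEdges P N p z₀ sc w t T r v, e ∈ H.edgeSet := by
      intro v e he
      refine hN e (usedEdges_subset_edgeSet he) ?_
      exact (Finset.single_le_sum (f := N.weight) (fun _ _ => Nat.zero_le _) he).trans_lt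
        (sum_weight_exploredEdges_lt hr hT.le)
    have hEc : ∀ v, (soloEdges P N p z₀ sc w t T r v).card < r := by
      intro v
      refine lt_of_le_of_lt ?_ (sum_weight_exploredEdges_lt (P := P) (N := N) (p := p)
        (S := scriptAdversary z₀ (Function.update sc t (some v))) (w := w) hr hT.le)
      rw [Finset.card_eq_sum_ones]
      exact Finset.sum_le_sum fun e he => N.one_le_weight e (usedEdges_subset_edgeSet he)
    have hhit := SimpleGraph.card_hit_le hH hS (fun v => soloEdges P N p z₀ sc w t T r v)
      (fun v _ => hEH v) (fun v _ => hEc v) (informed P N p z₀ sc sq w t T)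
    have hinf : (informed P N p z₀ sc sq w t T).card + (P.conf N p O w t₀).cost ≤
        k + Y.card + (P.conf N p Q w T).cost :=
      card_informed_le (t := t) hf hsc (ht.trans_lt hT) hagree hY h1 h2
    rw [h4] at hinf
    obtain ⟨hit, hmem, hle⟩ : ∃ hit : Finset (Fin n), (∀ v, v ∈ hit ↔ v ∈ S ∧
        ∃ u ∈ informed P N p z₀ sc sq w t T, (SimpleGraph.fromEdgeSet
          (soloEdges P N p z₀ sc w t T r v : Set (Sym2 (Fin n)))).Reachable v u) ∧
        hit.card ≤ (informed P N p z₀ sc sq w t T).card +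
          (S.filter fun v => s(v, x) ∈ soloEdges P N p z₀ sc w t T r v).card :=
      ⟨_, fun v => Finset.mem_filter, by convert hhit⟩
    have hc0 : (P.conf N p O w t₀).cost ≤ (P.conf N p Q w t).cost := by
      rw [conf_congr P N p O Q w hOQ le_rfl]
      exact cost_mono P N p _ w ht
    -- a neighbour that is not hit pays `r`
    have hone : ∀ v ∈ S, r + ((P.conf N p Q w t).cost - (P.conf N p O w t₀).cost) ≤
        ((P.conf N p (scriptAdversary z₀ (Function.update sq t (some v))) w T).cost -
          (P.conf N p O w t₀).cost) +
        r * ((if Disturbed P N p z₀ sc sq w t₀ t T ∨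
          (P.conf N p (scriptAdversary z₀ (Function.update sq t (some v))) w T).status ≠ .idle
          then 1 else 0) + if v ∈ hit then 1 else 0) := by
      intro v hv
      have hm := hmono v
      by_cases hb : Disturbed P N p z₀ sc sq w t₀ t T ∨
          (P.conf N p (scriptAdversary z₀ (Function.update sq t (some v))) w T).status ≠ .idle
      · rw [if_pos hb, Nat.mul_add, Nat.mul_one]; omega
      by_cases hv' : v ∈ hit
      · rw [if_pos hv', Nat.mul_add, Nat.mul_one]; omega
      rw [if_neg hb, if_neg hv', Nat.add_zero, Nat.mul_zero, Nat.add_zero]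
      have hidleA : (P.conf N p (scriptAdversary z₀ (Function.update sq t (some v))) w T).status =
          .idle := by
        by_contra hne; exact hb (Or.inr hne)
      by_contra hlt
      obtain ⟨u, hu, hu'⟩ := exists_mem_explored hr
        (extraRequest_script (fun s hs => hsc s (ht.trans hs)) hT v hidleO) (extraRequest_script hsq hT v h3) hf
        (h2.trans hcO.symm) h4 hidleA
        (by change _ < (P.conf N p Q w t).cost + r; omega)
      exact hv' ((hmem v).2 ⟨hv, u,
        Finset.mem_filter.2 ⟨Finset.mem_univ _, hu'⟩, hu⟩)
    have hsum := Finset.sum_le_sum hone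
    rw [Finset.sum_const, smul_eq_mul, Finset.sum_add_distrib, ← Finset.mul_sum,
      Finset.sum_add_distrib] at hsum
    refine hsum.trans (Nat.add_le_add_left (Nat.mul_le_mul_left _ ?_) _)
    have hcard : (∑ v ∈ S, if v ∈ hit then 1 else 0) = hit.card := by
      rw [← Finset.sum_filter, ← Finset.card_eq_sum_ones, Finset.filter_mem_eq_inter,
        Finset.inter_eq_right.2 fun v hv => ((hmem v).1 hv).1]
    rw [hcard]
    omega

/-- On average over `x`, few vertices explore the edge to `x`. -/
theorem sum_card_solo_le {r : ℕ} (hr : 0 < r) {t T : ℕ} (hT : t ≤ T)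
    (X : Finset (Fin n)) (S : Fin n → Finset (Fin n)) :
    ∑ x ∈ X, ((S x).filter fun v => s(v, x) ∈ soloEdges P N p z₀ sc w t T r v).card ≤ n * r := by
  classical
  calc ∑ x ∈ X, ((S x).filter fun v => s(v, x) ∈ soloEdges P N p z₀ sc w t T r v).card
      ≤ ∑ x : Fin n, ∑ v : Fin n,
          if s(v, x) ∈ soloEdges P N p z₀ sc w t T r v then 1 else 0 := by
        refine (Finset.sum_le_sum_of_subset (Finset.subset_univ X)).trans ?_
        refine Finset.sum_le_sum fun x _ => ?_
        rw [← Finset.card_filter]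
        exact Finset.card_le_card (Finset.filter_subset_filter _ (Finset.subset_univ _))
    _ = ∑ v : Fin n, (Finset.univ.filter fun x =>
          s(v, x) ∈ soloEdges P N p z₀ sc w t T r v).card := by
        rw [Finset.sum_comm]
        exact Finset.sum_congr rfl fun v _ => (Finset.card_filter _ _).symm
    _ ≤ ∑ _v : Fin n, r := by
        refine Finset.sum_le_sum fun v _ => ?_
        have h1 : (soloEdges P N p z₀ sc w t T r v).card ≤ r := by
          refine le_of_lt (lt_of_le_of_lt ?_ (sum_weight_exploredEdges_lt (P := P) (N := N) (p := p)
            (S := scriptAdversary z₀ (Function.update sc t (some v))) (w := w) hr hT))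
          rw [Finset.card_eq_sum_ones]
          exact Finset.sum_le_sum fun e he => N.one_le_weight e (usedEdges_subset_edgeSet he)
        refine le_trans (Finset.card_le_card_of_injOn (fun x => s(v, x)) (fun x hx => ?_)
          fun x _ y _ hxy => ?_) h1
        · exact (Finset.mem_filter.1 hx).2
        · exact Sym2.congr_right.1 hxy
    _ = n * r := by simp

end Protocol

namespace Protocol

variable {n k : ℕ} {P : Protocol n k} {N : Network n} {p : Fin k ↪ Fin n} {z₀ : Fin k}

theorem QuietFrom.adv_eq {A : Adversary n k} {w : ℕ → Fin n → P.Coin} {t T : ℕ}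
    (h : QuietFrom A t) (hT : t ≤ T) :
    (P.conf N p A w T).advCost = (P.conf N p A w t).advCost ∧
      (P.conf N p A w T).advPos = (P.conf N p A w t).advPos := by
  induction T, hT using Nat.le_induction with
  | base => exact ⟨rfl, rfl⟩
  | succ T hT ih =>
    rw [conf_advCost_succ, conf_advPos_succ, h.reqAt_eq_none hT]
    exact ih

theorem update_quiet {sq : ℕ → Option (Fin n)} {t : ℕ} (hsq : ∀ s ≥ t, sq s = none) (v : Fin n) :
    ∀ s ≥ t + 1, Function.update sq t (some v) s = none := fun s hs => by
  rw [Function.update_of_ne (by omega), hsq s (by omega)]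

theorem conf_update_script {sq : ℕ → Option (Fin n)} (w : ℕ → Fin n → P.Coin) (t : ℕ)
    (v : Fin n) :
    P.conf N p (scriptAdversary z₀ (Function.update sq t (some v))) w t =
      P.conf N p (scriptAdversary z₀ sq) w t :=
  conf_congr P N p _ _ w (scriptAdversary_congr fun s hs => by
    rw [Function.update_of_ne (by omega)]) le_rfl

/-- A further request at `v` moves the server of the adversary to `v`, unless it is omitted because
an earlier request is still pending. -/
theorem adv_update_script {sq : ℕ → Option (Fin n)} {w : ℕ → Fin n → P.Coin} {t T : ℕ}
    (hsq : ∀ s ≥ t, sq s = none) (hT : t < T) (v : Fin n) :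
    ((P.conf N p (scriptAdversary z₀ (Function.update sq t (some v))) w T).advCost =
        (P.conf N p (scriptAdversary z₀ sq) w t).advCost ∧
      (P.conf N p (scriptAdversary z₀ (Function.update sq t (some v))) w T).advPos =
        (P.conf N p (scriptAdversary z₀ sq) w t).advPos) ∨
    ((P.conf N p (scriptAdversary z₀ (Function.update sq t (some v))) w T).advCost =
        (P.conf N p (scriptAdversary z₀ sq) w t).advCost +
          N.dist ((P.conf N p (scriptAdversary z₀ sq) w t).advPos z₀) v ∧
      (P.conf N p (scriptAdversary z₀ (Function.update sq t (some v))) w T).advPos z₀ = v) := by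
  classical
  obtain ⟨e1, e2⟩ := (scriptAdversary_quietFrom (z₀ := z₀) (update_quiet hsq v)).adv_eq
    (P := P) (N := N) (p := p) (w := w) hT
  rw [e1, e2, conf_advCost_succ, conf_advPos_succ, conf_update_script, scriptAdversary_reqAt,
    Function.update_self]
  split_ifs
  · exact Or.inr ⟨rfl, Function.update_self _ _ _⟩
  · exact Or.inl ⟨rfl, rfl⟩

/-- Times for further requests after a script, however they are chosen, such that the network is
likely to be quiet at each of these times. The set `F j` contains the scripts with the first `j`
further requests. -/
theorem exists_request_times {ρ : ℝ≥0} (hsol : P.Solves N) (hcomp : P.Competitive N ρ)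
    (p : Fin k ↪ Fin n) (z₀ : Fin k) {ε : ℝ≥0∞} (hε : ε ≠ 0) {sc : ℕ → Option (Fin n)} {t : ℕ}
    (hsc : ∀ s ≥ t, sc s = none) :
    ∃ (T : ℕ → ℕ) (F : ℕ → Finset (ℕ → Option (Fin n))), t ≤ T 0 ∧ StrictMono T ∧ sc ∈ F 0 ∧
      ∀ j, ∀ sq ∈ F j, (∀ s ≥ T j, sq s = none) ∧
        P.QuietTime N p (scriptAdversary z₀ sq) (T j) ε ∧
        ∀ v, Function.update sq (T j) (some v) ∈ F (j + 1) := by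
  classical
  have hex : ∀ (F : Finset (ℕ → Option (Fin n))) (t : ℕ), ∃ T ≥ t,
      (∀ sq ∈ F, ∀ s ≥ t, sq s = none) →
      ∀ sq ∈ F, P.QuietTime N p (scriptAdversary z₀ sq) T ε := by
    intro F t
    by_cases h : ∀ sq ∈ F, ∀ s ≥ t, sq s = none
    · choose! g hg1 hg2 using fun sq hsq => exists_quietTime hsol hcomp p
        (scriptAdversary_quietFrom (z₀ := z₀) (h sq hsq)) hε
      exact ⟨max t (F.sup g), le_max_left _ _, fun _ sq hsq =>
        (hg2 sq hsq).mono ((Finset.le_sup hsq).trans (le_max_right _ _))⟩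
    · exact ⟨t, le_rfl, fun h' => absurd h' h⟩
  choose g hg1 hg2 using hex
  let next : Finset (ℕ → Option (Fin n)) × ℕ → Finset (ℕ → Option (Fin n)) × ℕ := fun a =>
    let F := Finset.image₂ (fun sq v => Function.update sq a.2 (some v)) a.1 Finset.univ
    (F, g F (a.2 + 1))
  let G : ℕ → Finset (ℕ → Option (Fin n)) × ℕ := fun j => next^[j] ({sc}, g {sc} t)
  have hG : ∀ j, G (j + 1) = next (G j) := fun j => Function.iterate_succ_apply' _ _ _
  have hlt : ∀ j, (G j).2 + 1 ≤ (G (j + 1)).2 := fun j => by rw [hG]; exact hg1 _ _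
  have key : ∀ j, ∀ sq ∈ (G j).1, (∀ s ≥ (G j).2, sq s = none) ∧
      P.QuietTime N p (scriptAdversary z₀ sq) (G j).2 ε := by
    intro j
    induction j with
    | zero =>
      have h0 : ∀ sq ∈ ({sc} : Finset (ℕ → Option (Fin n))), ∀ s ≥ t, sq s = none := by
        intro sq hsq; rw [Finset.mem_singleton.1 hsq]; exact hsc
      exact fun sq hsq => ⟨fun s hs => h0 sq hsq s ((hg1 {sc} t).trans hs), hg2 {sc} t h0 sq hsq⟩
    | succ j ih =>
      have h0 : ∀ sq ∈ (G (j + 1)).1, ∀ s ≥ (G j).2 + 1, sq s = none := by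
        rw [hG]
        intro sq hsq
        obtain ⟨sq', h', v, -, rfl⟩ := Finset.mem_image₂.1 hsq
        exact update_quiet (ih sq' h').1 v
      intro sq hsq
      refine ⟨fun s hs => h0 sq hsq s ((hlt j).trans hs), ?_⟩
      rw [hG] at h0 hsq ⊢
      exact hg2 _ _ h0 sq hsq
  refine ⟨fun j => (G j).2, fun j => (G j).1, hg1 _ _, strictMono_nat_of_lt_succ hlt,
    Finset.mem_singleton_self _, fun j sq hsq => ⟨(key j sq hsq).1, (key j sq hsq).2, fun v => ?_⟩⟩
  change _ ∈ (G (j + 1)).1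
  rw [hG]
  exact Finset.mem_image₂.2 ⟨sq, hsq, v, Finset.mem_univ _, rfl⟩

/-- The mean additional cost of a script over the cost of `sc` at time `t₀`. -/
noncomputable def extraCost (P : Protocol n k) (N : Network n) (p : Fin k ↪ Fin n) (z₀ : Fin k)
    (sc sq : ℕ → Option (Fin n)) (t₀ t T : ℕ) : ℝ≥0∞ :=
  P.mean T fun w => (((P.conf N p (scriptAdversary z₀ sq) w t).cost -
    (P.conf N p (scriptAdversary z₀ sc) w t₀).cost : ℕ) : ℝ≥0∞)

open scoped Classical in
/-- The mean number of vertices of `S` that explore the edge to `x`. -/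
noncomputable def meanSolo (P : Protocol n k) (N : Network n) (p : Fin k ↪ Fin n) (z₀ : Fin k)
    (sc : ℕ → Option (Fin n)) (t T r : ℕ) (S : Finset (Fin n)) (x : Fin n) (T' : ℕ) : ℝ≥0∞ :=
  P.mean T' fun w => ((S.filter fun v => s(v, x) ∈ soloEdges P N p z₀ sc w t T r v).card : ℝ≥0∞)

/-- Some neighbour of `x` is a costly choice for the next request. -/
theorem exists_costly_request {H : SimpleGraph (Fin n)} {r : ℕ} (hr : 0 < r)
    (hH : H.DetourGE (2 * r)) (hN : ∀ e ∈ N.graph.edgeSet, N.weight e < r → e ∈ H.edgeSet)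
    (hsol : P.Solves N) {x : Fin n} {S : Finset (Fin n)} (hS : ∀ v ∈ S, H.Adj v x)
    (hne : S.Nonempty) {sc sq : ℕ → Option (Fin n)} {t₀ t T Tf : ℕ} {Y : Finset (Fin n)}
    (hsc : ∀ s ≥ t₀, sc s = none) (ht : t₀ ≤ t) (hT : t < T) (hTf : T ≤ Tf)
    (hagree : ∀ s < t₀, sc s = sq s) (hsq : ∀ s ≥ t, sq s = none)
    (hY : ∀ s u, t₀ ≤ s → sq s = some u → u ∈ Y) {ε : ℝ≥0∞}
    (hqsc : P.QuietTime N p (scriptAdversary z₀ sc) t₀ ε)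
    (hqsq : P.QuietTime N p (scriptAdversary z₀ sq) t ε)
    (hqv : ∀ v, P.QuietTime N p (scriptAdversary z₀ (Function.update sq t (some v))) T ε) :
    ∃ v ∈ S, S.card * (r + P.extraCost N p z₀ sc sq t₀ t Tf) ≤
      S.card * P.extraCost N p z₀ sc (Function.update sq t (some v)) t₀ T Tf +
        r * (S.card * (5 * ε) + (k + Y.card + P.extraCost N p z₀ sc sq t₀ t Tf) +
          P.meanSolo N p z₀ sc t T r S x Tf) := by
  classical
  set a := P.extraCost N p z₀ sc sq t₀ t Tf with ha
  set e := P.meanSolo N p z₀ sc t T r S x Tf with he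
  have hdist : ∀ v, P.mean Tf (fun w => ind (Disturbed P N p z₀ sc sq w t₀ t T ∨
      (P.conf N p (scriptAdversary z₀ (Function.update sq t (some v))) w T).status ≠ .idle)) ≤
      5 * ε := by
    intro v
    calc _ ≤ P.mean Tf (fun w =>
          ((ind ((P.conf N p (scriptAdversary z₀ sc) w t₀).status ≠ .idle) +
          (ind ((P.conf N p (scriptAdversary z₀ sc) w T).cost ≠
            (P.conf N p (scriptAdversary z₀ sc) w t₀).cost) +
          (ind ((P.conf N p (scriptAdversary z₀ sq) w t).status ≠ .idle) +
          ind ((P.conf N p (scriptAdversary z₀ sq) w T).cost ≠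
            (P.conf N p (scriptAdversary z₀ sq) w t).cost)))) +
          ind ((P.conf N p (scriptAdversary z₀ (Function.update sq t (some v))) w T).status ≠
            .idle))) := by
          refine P.mean_mono fun w _ => (ind_or_le _ _).trans (add_le_add_left ?_ _)
          refine (ind_or_le _ _).trans (add_le_add_right ?_ _)
          refine (ind_or_le _ _).trans (add_le_add_right ?_ _)
          exact ind_or_le _ _
      _ ≤ (ε + (ε + (ε + ε))) + ε := by
          simp only [mean_add]
          refine add_le_add (add_le_add ?_ (add_le_add ?_ (add_le_add ?_ ?_))) ?_
          · exact (hqsc t₀ le_rfl Tf (by omega)).1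
          · exact (hqsc T (by omega) Tf hTf).2
          · exact (hqsq t le_rfl Tf (by omega)).1
          · exact (hqsq T hT.le Tf hTf).2
          · exact (hqv v T le_rfl Tf hTf).1
      _ = 5 * ε := by ring
  have hsum : ∑ _v ∈ S, ((r : ℝ≥0∞) + a) ≤
      ∑ v ∈ S, (P.extraCost N p z₀ sc (Function.update sq t (some v)) t₀ T Tf +
        (r * (5 * ε) + r * (k + Y.card + a + e) / S.card)) := by
    have hc0 : (S.card : ℝ≥0∞) ≠ 0 := by simpa using hne.ne_empty
    calc ∑ _v ∈ S, ((r : ℝ≥0∞) + a)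
        = P.mean Tf (fun w => S.card * (r + (((P.conf N p (scriptAdversary z₀ sq) w t).cost -
            (P.conf N p (scriptAdversary z₀ sc) w t₀).cost : ℕ) : ℝ≥0∞))) := by
          rw [mean_const_mul, mean_add, mean_const, Finset.sum_const, nsmul_eq_mul]; rfl
      _ ≤ P.mean Tf (fun w => (∑ v ∈ S, (((P.conf N p
            (scriptAdversary z₀ (Function.update sq t (some v))) w T).cost -
            (P.conf N p (scriptAdversary z₀ sc) w t₀).cost : ℕ) : ℝ≥0∞)) +
          r * ((∑ v ∈ S, ind (Disturbed P N p z₀ sc sq w t₀ t T ∨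
            (P.conf N p (scriptAdversary z₀ (Function.update sq t (some v))) w T).status ≠ .idle)) +
          (((k + Y.card : ℕ) : ℝ≥0∞) + (((P.conf N p (scriptAdversary z₀ sq) w t).cost -
            (P.conf N p (scriptAdversary z₀ sc) w t₀).cost : ℕ) : ℝ≥0∞)) +
          ((S.filter fun v => s(v, x) ∈ soloEdges P N p z₀ sc w t T r v).card : ℝ≥0∞))) := by
          refine P.mean_mono fun w hw => ?_
          have h := sum_window_cost (p := p) (z₀ := z₀) hr hH hN hS
            (fun A t => not_faulty_of_solves hsol p hw A t) hsc ht hT hagree hsq hY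
          unfold ind
          exact_mod_cast h
      _ = (∑ v ∈ S, P.extraCost N p z₀ sc (Function.update sq t (some v)) t₀ T Tf) +
          r * ((∑ v ∈ S, P.mean Tf (fun w => ind (Disturbed P N p z₀ sc sq w t₀ t T ∨
            (P.conf N p (scriptAdversary z₀ (Function.update sq t (some v))) w T).status ≠
              .idle))) + (((k + Y.card : ℕ) : ℝ≥0∞) + a) + e) := by
          simp only [mean_add, mean_const_mul, mean_sum, mean_const]
          rfl
      _ ≤ (∑ v ∈ S, P.extraCost N p z₀ sc (Function.update sq t (some v)) t₀ T Tf) +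
          r * ((∑ _v ∈ S, 5 * ε) + (((k + Y.card : ℕ) : ℝ≥0∞) + a) + e) := by
          gcongr with v hv
          exact hdist v
      _ = _ := by
          rw [Finset.sum_add_distrib, Finset.sum_const, Finset.sum_const, nsmul_eq_mul,
            nsmul_eq_mul, mul_add (S.card : ℝ≥0∞),
            ENNReal.mul_div_cancel hc0 (ENNReal.natCast_ne_top _)]
          push_cast
          ring
  obtain ⟨v, hv, hle⟩ := ENNReal.exists_le_of_sum_le hne hsum
  refine ⟨v, hv, (mul_le_mul_right hle _).trans (le_of_eq ?_)⟩
  rw [mul_add, mul_add, ENNReal.mul_div_cancel (by simpa using hne.ne_empty)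
    (ENNReal.natCast_ne_top _)]
  ring

/-- Some vertex `x` with many neighbours is explored by few of them on average, at all times. -/
theorem exists_centre {sc : ℕ → Option (Fin n)} {r : ℕ} (hr : 0 < r) {T : ℕ → ℕ}
    (hT : StrictMono T) (L Tf : ℕ) (X : Finset (Fin n)) (hX : n ≤ 2 * X.card) (hX' : X.Nonempty)
    (S : Fin n → Finset (Fin n)) :
    ∃ x ∈ X, ∑ j ∈ Finset.range L,
      P.meanSolo N p z₀ sc (T j) (T (j + 1)) r (S x) x Tf ≤ 2 * r * L := by
  classical
  apply ENNReal.exists_le_of_sum_le hX'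
  rw [Finset.sum_comm]
  calc ∑ j ∈ Finset.range L, ∑ x ∈ X, P.meanSolo N p z₀ sc (T j) (T (j + 1)) r (S x) x Tf
      ≤ ∑ j ∈ Finset.range L, ((n * r : ℕ) : ℝ≥0∞) := by
        refine Finset.sum_le_sum fun j _ => ?_
        unfold meanSolo
        rw [← mean_sum, ← P.mean_const Tf ((n * r : ℕ) : ℝ≥0∞)]
        refine P.mean_mono fun w _ => ?_
        exact_mod_cast sum_card_solo_le (P := P) (N := N) (p := p) (z₀ := z₀) (sc := sc) (w := w)
          hr (hT (Nat.lt_succ_self j)).le X S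
    _ = ((L * (n * r) : ℕ) : ℝ≥0∞) := by simp
    _ ≤ ((X.card * (2 * r * L) : ℕ) : ℝ≥0∞) := by
        have : L * (n * r) ≤ X.card * (2 * r * L) := by nlinarith [Nat.mul_le_mul_right (L * r) hX]
        exact_mod_cast this
    _ = ∑ x ∈ X, (2 * r * L : ℝ≥0∞) := by
        rw [Finset.sum_const, nsmul_eq_mul]; push_cast; ring

end Protocol

/-! ### Phases of requests -/

namespace Protocol

variable {n k : ℕ} {P : Protocol n k} {N : Network n} {p : Fin k ↪ Fin n} {z₀ : Fin k}

/-- The progress of the mean extra cost from `a` to `a'` at one request: as long as it is below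
`m ^ 2 / 4`, it grows by at least `3 * m / 4`, minus `e / (32 * m)`, where `e` is the mean number
of neighbours that explore the edge to the centre. The degree of the centre is `32 * m ^ 2`, and `c` counts the requested nodes. -/
theorem extraCost_step {m k c : ℕ} {j : ℕ} {a a' e E : ℝ≥0∞} (hm : 1 ≤ m) (hk : k ≤ m) (hj : j ≤ m)
    (hc : c ≤ j) (haa' : a ≤ a')
    (h : ((32 * m ^ 2 : ℕ) : ℝ≥0∞) * (m + a) ≤ ((32 * m ^ 2 : ℕ) : ℝ≥0∞) * a' +
      m * (((32 * m ^ 2 : ℕ) : ℝ≥0∞) * (5 * ((1 / 40 : ℝ≥0) : ℝ≥0∞)) + (k + c + a) + e))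
    (ih : (m : ℝ≥0∞) ^ 2 ≤ 4 * a ∨ 24 * (j : ℝ≥0∞) * m ^ 2 ≤ 32 * m * a + E) :
    (m : ℝ≥0∞) ^ 2 ≤ 4 * a' ∨
      24 * ((j + 1 : ℕ) : ℝ≥0∞) * m ^ 2 ≤ 32 * m * a' + (E + e) := by
  by_cases hsmall : (m : ℝ≥0∞) ^ 2 ≤ 4 * a
  · exact Or.inl (hsmall.trans (mul_le_mul_right haa' _))
  have ih' := ih.resolve_left hsmall
  rcases eq_or_ne a' ∞ with rfl | ha'
  · left; rw [ENNReal.mul_top (by norm_num)]; exact le_top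
  rcases eq_or_ne e ∞ with rfl | he
  · right; simp
  rcases eq_or_ne E ∞ with rfl | hE
  · right; simp
  have ha : a ≠ ∞ := ne_top_of_le_ne_top ha' haa'
  lift a to ℝ≥0 using ha
  lift a' to ℝ≥0 using ha'
  lift e to ℝ≥0 using he
  lift E to ℝ≥0 using hE
  right
  have h1 : ((32 * m ^ 2 : ℕ) : ℝ) * (m + a) ≤ ((32 * m ^ 2 : ℕ) : ℝ) * a' +
      m * (((32 * m ^ 2 : ℕ) : ℝ) * (5 * ((1 / 40 : ℝ≥0) : ℝ)) + (k + c + a) + e) := by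
    exact_mod_cast h
  have h2 : 24 * (j : ℝ) * m ^ 2 ≤ 32 * m * a + E := by exact_mod_cast ih'
  have h3 : 4 * (a : ℝ) < (m : ℝ) ^ 2 := by
    have : (4 * a : ℝ≥0) < (m : ℝ≥0) ^ 2 := by
      have := lt_of_not_ge hsmall
      exact_mod_cast this
    exact_mod_cast this
  have h4 : 24 * ((j + 1 : ℕ) : ℝ) * m ^ 2 ≤ 32 * m * a' + (E + e) := by
    have hm1 : (1 : ℝ) ≤ m := by exact_mod_cast hm
    have hk' : (k : ℝ) ≤ m := by exact_mod_cast hk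
    have hc' : (c : ℝ) ≤ m := by exact_mod_cast hc.trans hj
    push_cast at h1 ⊢
    have h5 : (m : ℝ) * (32 * m * (m + a)) ≤
        m * (32 * m * a' + (32 * m ^ 2 * (1 / 8) + (k + c + a) + e)) := by
      refine le_trans (le_of_eq (by ring)) (h1.trans (le_of_eq (by ring)))
    have h6 := le_of_mul_le_mul_left h5 (by linarith)
    nlinarith
  exact_mod_cast h4

/-- One phase: after any script there are `m` further requests, within distance `1` of a centre,
that cost the protocol at least `m ^ 2 / 4` on average and the adversary at most `4 * m`. -/
theorem exists_phase {H : SimpleGraph (Fin n)} {m : ℕ} (hm : 1 ≤ m) (hkm : k ≤ m) {ρ : ℝ≥0}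
    (hsol : P.Solves N) (hcomp : P.Competitive N ρ) (p : Fin k ↪ Fin n) (z₀ : Fin k)
    (hH : H.DetourGE (2 * m)) (hN : ∀ e ∈ N.graph.edgeSet, N.weight e < m → e ∈ H.edgeSet)
    (hadj : ∀ u v, H.Adj u v → N.dist u v ≤ 1) (hdiam : N.diam ≤ 2 * m)
    {X : Finset (Fin n)} (hX : n ≤ 2 * X.card) (hXne : X.Nonempty) {S : Fin n → Finset (Fin n)}
    (hS : ∀ x ∈ X, (S x).card = 32 * m ^ 2 ∧ ∀ v ∈ S x, H.Adj v x)
    {sc : ℕ → Option (Fin n)} {t : ℕ} (hsc : ∀ s ≥ t, sc s = none) :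
    ∃ (sq : ℕ → Option (Fin n)) (T : ℕ), t ≤ T ∧ (∀ s ≥ T, sq s = none) ∧
      (∀ w, (P.conf N p (scriptAdversary z₀ sq) w T).advCost ≤
        (P.conf N p (scriptAdversary z₀ sc) w t).advCost + 4 * m) ∧
      (m : ℝ≥0∞) ^ 2 +
          4 * P.mean T (fun w => ((P.conf N p (scriptAdversary z₀ sc) w t).cost : ℝ≥0∞)) ≤
        4 * P.mean T (fun w => ((P.conf N p (scriptAdversary z₀ sq) w T).cost : ℝ≥0∞)) := by
  classical
  -- five events of probability `1 / 40` spoil at most an eighth of a request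
  have hε : ((1 / 40 : ℝ≥0) : ℝ≥0∞) ≠ 0 := by
    rw [ENNReal.coe_ne_zero]; positivity
  obtain ⟨T, F, hT0, hT, hF0, hF⟩ := exists_request_times hsol hcomp p z₀ hε hsc
  obtain ⟨x, hx, hxsum⟩ := exists_centre (P := P) (N := N) (p := p) (z₀ := z₀) (sc := sc)
    (r := m) hm hT m (T m) X hX hXne S
  obtain ⟨hcard, hSx⟩ := hS x hx
  have hne : (S x).Nonempty := by
    rw [← Finset.card_pos, hcard]; positivity
  set e : ℕ → ℝ≥0∞ := fun j => P.meanSolo N p z₀ sc (T j) (T (j + 1)) m (S x) x (T m) with he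
  have key : ∀ j ≤ m, ∃ sq ∈ F j, (∀ s < T 0, sc s = sq s) ∧
      (∃ Y : Finset (Fin n), Y.card ≤ j ∧ ∀ s u, T 0 ≤ s → sq s = some u → u ∈ Y) ∧
      (∀ w, (P.conf N p (scriptAdversary z₀ sq) w (T j)).advCost =
          (P.conf N p (scriptAdversary z₀ sc) w (T 0)).advCost ∨
        N.dist ((P.conf N p (scriptAdversary z₀ sq) w (T j)).advPos z₀) x ≤ 1 ∧
        (P.conf N p (scriptAdversary z₀ sq) w (T j)).advCost ≤
          (P.conf N p (scriptAdversary z₀ sc) w (T 0)).advCost + 2 * m + 2 * j) ∧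
      ((m : ℝ≥0∞) ^ 2 ≤ 4 * P.extraCost N p z₀ sc sq (T 0) (T j) (T m) ∨
        24 * (j : ℝ≥0∞) * m ^ 2 ≤ 32 * m * P.extraCost N p z₀ sc sq (T 0) (T j) (T m) +
          ∑ i ∈ Finset.range j, e i) := by
    intro j
    induction j with
    | zero =>
      intro _
      refine ⟨sc, hF0, fun _ _ => rfl, ⟨∅, le_rfl, fun s u hs hu => ?_⟩, fun w => Or.inl rfl,
        Or.inr (by simp)⟩
      rw [hsc s (hT0.trans hs)] at hu
      exact absurd hu (by simp)
    | succ j ih =>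
      intro hj
      obtain ⟨sq, hsqF, hagree, ⟨Y, hYc, hY⟩, hadv, hcost⟩ := ih (by omega)
      obtain ⟨hsq, hqsq, hsqv⟩ := hF j sq hsqF
      have hlt : T j < T (j + 1) := hT (Nat.lt_succ_self j)
      have h0j : T 0 ≤ T j := hT.monotone (Nat.zero_le j)
      obtain ⟨v, hv, hle⟩ := exists_costly_request (z₀ := z₀) hm hH hN hsol hSx hne
        (fun s hs => hsc s (hT0.trans hs)) h0j hlt (hT.monotone hj) hagree hsq hY
        (hF 0 sc hF0).2.1 hqsq fun v => (hF (j + 1) _ (hsqv v)).2.1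
      refine ⟨Function.update sq (T j) (some v), hsqv v, fun s hs => ?_,
        ⟨insert v Y, (Finset.card_insert_le _ _).trans (by omega), fun s u hs hu => ?_⟩,
        fun w => ?_, ?_⟩
      · rw [Function.update_of_ne (by omega)]; exact hagree s hs
      · by_cases hsj : s = T j
        · subst hsj
          rw [Function.update_self] at hu
          rw [← Option.some.inj hu]
          exact Finset.mem_insert_self _ _
        · rw [Function.update_of_ne hsj] at hu
          exact Finset.mem_insert_of_mem (hY s u hs hu)
      · rcases adv_update_script (P := P) (N := N) (p := p) (z₀ := z₀) (w := w) hsq hlt v with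
          ⟨e1, e2⟩ | ⟨e1, e2⟩
        · rw [e1, e2]
          rcases hadv w with h | ⟨h1, h2⟩
          · exact Or.inl h
          · exact Or.inr ⟨h1, h2.trans (by omega)⟩
        · rw [e1, e2]
          refine Or.inr ⟨hadj v x (hSx v hv), ?_⟩
          rcases hadv w with h | ⟨h1, h2⟩
          · have := N.dist_le_diam ((P.conf N p (scriptAdversary z₀ sq) w (T j)).advPos z₀) v
            omega
          · have h3 := N.dist_triangle ((P.conf N p (scriptAdversary z₀ sq) w (T j)).advPos z₀) x v
            have h4 := hadj x v (hSx v hv).symm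
            omega
      · rw [Finset.sum_range_succ]
        rw [hcard] at hle
        refine extraCost_step hm hkm (by omega) hYc ?_ hle hcost
        refine P.mean_mono fun w _ => ?_
        have := cost_mono P N p (scriptAdversary z₀ (Function.update sq (T j) (some v))) w hlt.le
        simp only [conf_update_script] at this
        exact_mod_cast Nat.sub_le_sub_right this _
  obtain ⟨sq, hsqF, hagree, -, hadv, hcost⟩ := key m le_rfl
  have h0m : T 0 ≤ T m := hT.monotone (Nat.zero_le m)
  refine ⟨sq, T m, hT0.trans h0m, (hF m sq hsqF).1, fun w => ?_, ?_⟩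
  · have h1 := ((scriptAdversary_quietFrom (z₀ := z₀) hsc).adv_eq (P := P) (N := N) (p := p)
      (w := w) hT0).1
    rcases hadv w with h | h <;> omega
  · have hextra : (m : ℝ≥0∞) ^ 2 ≤ 4 * P.extraCost N p z₀ sc sq (T 0) (T m) (T m) := by
      rcases hcost with h | h
      · exact h
      set a := P.extraCost N p z₀ sc sq (T 0) (T m) (T m)
      have h' := h.trans (add_le_add_right hxsum _)
      clear_value a
      rcases eq_or_ne a ∞ with rfl | ha
      · rw [ENNReal.mul_top (by norm_num)]; exact le_top
      lift a to ℝ≥0 using ha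
      have h1 : 24 * (m : ℝ) * m ^ 2 ≤ 32 * m * a + 2 * m * m := by exact_mod_cast h'
      have h2 : (m : ℝ) ^ 2 ≤ 4 * a := by
        have hm1 : (1 : ℝ) ≤ m := by exact_mod_cast hm
        have h3 : (m : ℝ) * (24 * m ^ 2) ≤ m * (32 * a + 2 * m) := by linarith
        have h4 := le_of_mul_le_mul_left h3 (by linarith)
        nlinarith
      exact_mod_cast h2
    calc _ ≤ 4 * P.extraCost N p z₀ sc sq (T 0) (T m) (T m) + 4 * P.mean (T m) (fun w =>
          ((P.conf N p (scriptAdversary z₀ sc) w t).cost : ℝ≥0∞)) := add_le_add_left hextra _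
      _ = 4 * P.mean (T m) (fun w => (((P.conf N p (scriptAdversary z₀ sq) w (T m)).cost -
          (P.conf N p (scriptAdversary z₀ sc) w (T 0)).cost : ℕ) : ℝ≥0∞) +
          ((P.conf N p (scriptAdversary z₀ sc) w t).cost : ℝ≥0∞)) := by
        rw [← mul_add, extraCost, mean_add]
      _ ≤ _ := by
        refine mul_le_mul_right (P.mean_mono fun w _ => ?_) _
        have h1 : (P.conf N p (scriptAdversary z₀ sc) w t).cost ≤
          (P.conf N p (scriptAdversary z₀ sc) w (T 0)).cost := cost_mono P N p _ w hT0
        have h2 : (P.conf N p (scriptAdversary z₀ sq) w (T 0)).cost ≤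
          (P.conf N p (scriptAdversary z₀ sq) w (T m)).cost := cost_mono P N p _ w h0m
        rw [← conf_congr P N p _ _ w (scriptAdversary_congr hagree) le_rfl] at h2
        have h3 : (P.conf N p (scriptAdversary z₀ sq) w (T m)).cost -
          (P.conf N p (scriptAdversary z₀ sc) w (T 0)).cost +
          (P.conf N p (scriptAdversary z₀ sc) w t).cost ≤
          (P.conf N p (scriptAdversary z₀ sq) w (T m)).cost := by omega
        exact_mod_cast h3

/-- On a network whose short edges form a graph without short cycles in which many vertices have
large degree, the competitive ratio is at least `m / 16`. -/
theorem le_sixteen_mul {H : SimpleGraph (Fin n)} {m : ℕ} (hm : 1 ≤ m) (hk : 1 ≤ k) (hkm : k ≤ m)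
    (hkn : k < n) {ρ : ℝ≥0} (hsol : P.Solves N) (hcomp : P.Competitive N ρ)
    (hH : H.DetourGE (2 * m)) (hN : ∀ e ∈ N.graph.edgeSet, N.weight e < m → e ∈ H.edgeSet)
    (hadj : ∀ u v, H.Adj u v → N.dist u v ≤ 1) (hdiam : N.diam ≤ 2 * m)
    {X : Finset (Fin n)} (hX : n ≤ 2 * X.card) {S : Fin n → Finset (Fin n)}
    (hS : ∀ x ∈ X, (S x).card = 32 * m ^ 2 ∧ ∀ v ∈ S x, H.Adj v x) : (m : ℝ) ≤ 16 * ρ := by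
  obtain ⟨p⟩ : Nonempty (Fin k ↪ Fin n) :=
    Function.Embedding.nonempty_of_card_le (by simpa using hkn.le)
  set z₀ : Fin k := ⟨0, hk⟩
  have hXne : X.Nonempty := by rw [← Finset.card_pos]; omega
  have key : ∀ J : ℕ, ∃ (sc : ℕ → Option (Fin n)) (T : ℕ), (∀ s ≥ T, sc s = none) ∧
      (∀ w, (P.conf N p (scriptAdversary z₀ sc) w T).advCost ≤ J * (4 * m)) ∧
      (J : ℝ≥0∞) * m ^ 2 ≤
        4 * P.mean T (fun w => ((P.conf N p (scriptAdversary z₀ sc) w T).cost : ℝ≥0∞)) := by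
    intro J
    induction J with
    | zero => exact ⟨fun _ => none, 0, fun _ _ => rfl, fun w => Nat.zero_le _, by simp⟩
    | succ J ih =>
      obtain ⟨sc, t, hsc, h1, h2⟩ := ih
      obtain ⟨sq, T, htT, hsq, h3, h4⟩ :=
        exists_phase hm hkm hsol hcomp p z₀ hH hN hadj hdiam hX hXne hS hsc
      refine ⟨sq, T, hsq, fun w => ?_, le_trans ?_ h4⟩
      · have := h1 w
        have := h3 w
        rw [Nat.add_mul, Nat.one_mul]
        omega
      · rw [mean_conf_eq P N p (scriptAdversary z₀ sc) htT fun c => (c.cost : ℝ≥0∞)]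
        push_cast
        rw [add_mul, one_mul, add_comm]
        exact add_le_add_right h2 _
  obtain ⟨b, hb⟩ := hcomp p
  have hJ : ∀ J : ℕ, (J : ℝ) * m ^ 2 ≤ 4 * (ρ * (J * (4 * m)) + b) := by
    intro J
    obtain ⟨sc, T, -, h1, h2⟩ := key J
    have h3 := hb (scriptAdversary z₀ sc) T
    rw [expect_eq_mean, expect_eq_mean] at h3
    have h4 : P.mean T (fun w => ((P.conf N p (scriptAdversary z₀ sc) w T).advCost : ℝ≥0∞)) ≤
        ((J * (4 * m) : ℕ) : ℝ≥0∞) := by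
      rw [← P.mean_const T ((J * (4 * m) : ℕ) : ℝ≥0∞)]
      exact P.mean_mono fun w _ => by exact_mod_cast h1 w
    have h5 : (J : ℝ≥0∞) * m ^ 2 ≤ 4 * (ρ * ((J * (4 * m) : ℕ) : ℝ≥0∞) + b) :=
      h2.trans (mul_le_mul_right (h3.trans (add_le_add_left (mul_le_mul_right h4 _) _)) _)
    exact_mod_cast h5
  by_contra! hlt
  have hm0 : (0 : ℝ) < m := by exact_mod_cast hm
  have hpos : 0 < (m : ℝ) * (m - 16 * ρ) := mul_pos hm0 (by linarith)
  obtain ⟨J, hJ'⟩ := exists_nat_gt (4 * b / ((m : ℝ) * (m - 16 * ρ)))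
  rw [div_lt_iff₀ hpos] at hJ'
  nlinarith [hJ J]

end Protocol

/-! ### The choice of the network -/

open scoped Classical in
/-- If `n` is large in terms of `m`, some network has competitive ratio at least `m / 16` for at
most `m` servers. -/
theorem Network.exists_le_sixteen_mul {n m : ℕ} (hn : 1 ≤ n)
    (h : 2 * (32 * m ^ 2 + 1) ^ (2 * m) ≤ n) :
    ∃ N : Network n, ∀ k : ℕ, 1 ≤ k → k ≤ m → k < n → ∀ P : Protocol n k, P.Solves N →
      ∀ ρ : ℝ≥0, P.Competitive N ρ → (m : ℝ) ≤ 16 * ρ := by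
  rcases Nat.eq_zero_or_pos m with rfl | hm
  · exact ⟨withStar ⊥ ⟨0, hn⟩ 1 le_rfl, fun k h1 h2 => absurd h1 (by omega)⟩
  obtain ⟨H, hH, hdeg, hcard⟩ := SimpleGraph.exists_detourGE (V := Fin n) (32 * m ^ 2) (2 * m)
    (by omega)
  refine ⟨withStar H ⟨0, hn⟩ m hm, fun k hk hkm hkn P hsol ρ hcomp => ?_⟩
  refine Protocol.le_sixteen_mul (H := H) hm hk hkm hkn hsol hcomp hH
    (fun e _ he => withStar_mem_edgeSet he) (fun u v => withStar_dist_le_one) withStar_diam_le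
    (X := Finset.univ.filter fun v => ¬ H.degree v < 32 * m ^ 2) ?_
    (S := fun x => H.neighborFinset x) fun x hx => ⟨?_, fun v hv => ?_⟩
  · have := Finset.card_filter_add_card_filter_not (s := (Finset.univ : Finset (Fin n)))
      fun v => H.degree v < 32 * m ^ 2
    rw [Finset.card_univ, Fintype.card_fin] at this
    omega
  · have := (Finset.mem_filter.1 hx).2
    have := hdeg x
    rw [SimpleGraph.card_neighborFinset_eq_degree]
    omega
  · exact ((H.mem_neighborFinset x v).1 hv).symm

/-- Inverting the estimate that `n` is at most exponential in `M * log M`. -/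
theorem log_div_log_log_le {n M : ℕ} (hn : 3 ≤ n) (hM : 1 ≤ M)
    (h : n < 2 * (32 * M ^ 2 + 1) ^ (2 * M)) :
    Real.log n / Real.log (Real.log n) ≤ 400 * M := by
  have hM1 : (1 : ℝ) ≤ M := by exact_mod_cast hM
  have hn3 : (3 : ℝ) ≤ n := by exact_mod_cast hn
  have hlM : 0 ≤ Real.log M := Real.log_nonneg hM1
  have l2 := Real.log_two_gt_d9
  have l2' := Real.log_two_lt_d9
  set y := Real.log n with hy
  have hy1 : 1.03 ≤ y := by
    have h9 : Real.log 8 ≤ Real.log ((3 : ℝ) ^ 2) := Real.log_le_log (by norm_num) (by norm_num)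
    rw [show (8 : ℝ) = 2 ^ 3 by norm_num, Real.log_pow, Real.log_pow] at h9
    have h3 : Real.log 3 ≤ y := Real.log_le_log (by norm_num) hn3
    push_cast at h9
    linarith
  have hyM : y ≤ 10 * (M * (1 + Real.log M)) := by
    have h1 : (n : ℝ) ≤ 2 * (64 * M ^ 2) ^ (2 * M) := by
      have h2 : n ≤ 2 * (64 * M ^ 2) ^ (2 * M) := by
        refine h.le.trans (Nat.mul_le_mul_left _ (Nat.pow_le_pow_left ?_ _))
        have : 1 ≤ M ^ 2 := Nat.one_le_pow _ _ hM
        omega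
      exact_mod_cast h2
    have h2 := Real.log_le_log (by linarith) h1
    rw [Real.log_mul (by norm_num) (by positivity), Real.log_pow,
      Real.log_mul (by norm_num) (by positivity), Real.log_pow,
      show (64 : ℝ) = 2 ^ 6 by norm_num, Real.log_pow] at h2
    push_cast at h2
    have h3 := mul_nonneg (by linarith : (0 : ℝ) ≤ M) hlM
    have h4 : (M : ℝ) * Real.log 2 ≤ M * 0.6931471808 := by gcongr
    nlinarith
  have hlogy : 1 - y⁻¹ ≤ Real.log y := Real.one_sub_inv_le_log_of_pos (by linarith)
  have hlogy' : (0.025 : ℝ) ≤ Real.log y := by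
    have : y⁻¹ ≤ (1.03 : ℝ)⁻¹ := inv_anti₀ (by norm_num) hy1
    have : (1.03 : ℝ)⁻¹ ≤ 0.975 := by norm_num
    linarith
  rw [div_le_iff₀ (by linarith)]
  -- `log y` is bounded away from `0`, and it exceeds `1 + log M` if `y > 10 * M`
  rcases le_or_gt y (10 * M) with hle | hgt
  · nlinarith
  · have h1 : Real.log (8 * M) ≤ Real.log y := Real.log_le_log (by positivity) (by linarith)
    rw [Real.log_mul (by norm_num) (by positivity), show (8 : ℝ) = 2 ^ 3 by norm_num,
      Real.log_pow] at h1
    push_cast at h1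
    have h2 : 1 + Real.log M ≤ Real.log y := by linarith
    have h3 : (M : ℝ) * (1 + Real.log M) ≤ M * Real.log y := by gcongr
    have h4 : 0 ≤ (M : ℝ) * Real.log y := by
      have := mul_nonneg (by linarith : (0 : ℝ) ≤ M) hlM
      nlinarith
    linarith

theorem theorem4 :
    ∃ c : ℝ, 0 < c ∧ ∀ n : ℕ, 1 ≤ n → ∃ N : Network n,
      ∀ k : ℕ, 1 ≤ k → k < n → ∀ P : Protocol n k, P.Solves N →
        ∀ ρ : ℝ≥0, P.Competitive N ρ →
          c * max (k : ℝ) (Real.log n / Real.log (Real.log n)) ≤ (ρ : ℝ) := by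
  refine ⟨1 / 12800, by norm_num, fun n hn => ?_⟩
  rcases Nat.eq_or_lt_of_le hn with rfl | hn2
  · -- there is no admissible `k`
    exact ⟨Network.withStar ⊥ 0 1 le_rfl, fun k h1 h2 => absurd h1 (by omega)⟩
  set Q : ℕ → Prop := fun m => 2 * (32 * m ^ 2 + 1) ^ (2 * m) ≤ n with hQ
  classical
  set m := Nat.findGreatest Q n with hm
  have hQm : Q m := Nat.findGreatest_spec (Nat.zero_le n) (by simp [hQ]; omega)
  have hQm' : ¬ Q (m + 1) := by
    intro h
    have h1 : m + 1 ≤ n := by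
      refine le_trans ?_ h
      calc m + 1 ≤ 32 * (m + 1) ^ 2 + 1 := by nlinarith
        _ ≤ (32 * (m + 1) ^ 2 + 1) ^ (2 * (m + 1)) := Nat.le_self_pow (by omega) _
        _ ≤ _ := Nat.le_mul_of_pos_left _ (by norm_num)
    have := Nat.le_findGreatest h1 h
    omega
  obtain ⟨N, hN⟩ := Network.exists_le_sixteen_mul hn hQm
  refine ⟨N, fun k hk hkn P hsol ρ hcomp => ?_⟩
  have h1 := Protocol.servers_le_two_mul hsol hcomp hk hkn
  have hk1 : (1 : ℝ) ≤ k := by exact_mod_cast hk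
  have h2 : Real.log n / Real.log (Real.log n) ≤ 12800 * ρ := by
    rcases Nat.eq_or_lt_of_le hn2 with rfl | hn3
    · -- `log (log 2)` is negative
      have l2 := Real.log_two_gt_d9
      have l2' := Real.log_two_lt_d9
      have : Real.log ((2 : ℕ) : ℝ) / Real.log (Real.log ((2 : ℕ) : ℝ)) ≤ 0 := by
        push_cast
        exact div_nonpos_of_nonneg_of_nonpos (by linarith)
          (Real.log_nonpos (by linarith) (by linarith))
      push_cast at this ⊢
      linarith
    · have h3 := log_div_log_log_le (M := m + 1) hn3 (by omega) (not_le.1 hQm')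
      push_cast at h3
      -- if `k > m`, the bound by the number of servers dominates
      rcases le_or_gt k m with hkm | hkm
      · have h4 := hN k hk hkm hkn P hsol ρ hcomp
        have h5 : (k : ℝ) ≤ m := by exact_mod_cast hkm
        linarith
      · have h5 : (m : ℝ) + 1 ≤ k := by exact_mod_cast hkm
        linarith
  rw [one_div, inv_mul_le_iff₀ (by norm_num)]
  exact max_le (by linarith) h2
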